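/- Let $q$ be a prime power, $V$ an $m$-dimensional vector space over $\mathbb F_{q^2}$ and $\eta$ a non-degenerate Hermitian form on $V$ (with respect to $x\mapsto x^q$). Let $\mathbb H\subset \mathrm{PG}(\bigwedge^2V)$ be the image of the set of totally $\eta$-isotropic $2$-dimensional subspaces of $V$ under the Plücker map $\langle v,w\rangle\mapsto[v\wedge w]$. Choose for each point $P\in\mathbb H$ a vector representative $\omega_P\in\bigwedge^2V$, and let $\mathcal C=\{(\varphi(\omega_P))_{P\in\mathbb H}:\varphi\in(\bigwedge^2V)^*\}\subseteq\mathbb F_{q^2}^{\mathbb H}$ be the associated projective code. A semilinear monomial automorphism of $\mathcal C$ is a map $f$ of $\mathbb F_{q^2}^{\mathbb H}$ with $f(\mathcal C)=\mathcal C$ of the form $f(x)_{\pi(P)}=d_P\,\tau(x_P)$, where $\pi$ is a permutation of $\mathbb H$, $d_P\in\mathbb F_{q^2}^*$ and $\tau\in\mathrm{Aut}(\mathbb F_{q^2})$; it is linear if $\tau=1$. (1) If $m>5$, then the group of semilinear monomial automorphisms of $\mathcal C$ modulo scalars is isomorphic to $\mathrm{P\Gamma U}(m,q)$, the group of semilinear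 similitudes of $\eta$ modulo scalars; so is the group of permutations $\pi$ of the coordinates that the semilinear monomial automorphisms of $\mathcal C$ induce. (2) If $m=4$, then $\mathbb H$ is an elliptic quadric $Q^-(5,q)$ of a subgeometry $\mathrm{PG}(5,q)$ of $\mathrm{PG}(\bigwedge^2V)$: there are a quadratic form $Q$ on $\mathbb F_q^6$ with non-degenerate polar form and Witt index $2$, and a basis $b_1,\dots,b_6$ of $\bigwedge^2V$, such that $\mathbb H=\{[\sum_i u_ib_i]:0\ne u\in\mathbb F_q^6,\ Q(u)=0\}$. The group of linear monomial automorphisms of $\mathcal C$ modulo scalars is isomorphic to the projective orthogonal group $\mathrm{PGO}^-(6,q)$ of linear similitudes of $Q$ modulo scalars, and the group of permutations of the coordinates that the semilinear monomial automorphisms of $\mathcal C$ induce is isomorphic to $\mathrm{P\Gamma O}^-(6,q)$, the group of semilinear similitudes of $Q$ modulo scalars. -/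

import Mathlib

open scoped LinearAlgebra.Projectivization

noncomputable section

/-! ### Semilinear groups and their projective quotients -/

theorem perm_apply_inv {M : Type*} (f : Equiv.Perm M) (x : M) : f (f⁻¹ x) = x :=
  f.apply_symm_apply x

theorem ringAut_apply_inv {K : Type*} [Field K] (τ : K ≃+* K) (x : K) : τ (τ⁻¹ x) = x :=
  τ.apply_symm_apply x

/-- `f` is semilinear with companion field automorphism `τ`. -/
def IsSemilinearWith {K M : Type*} [Field K] [AddCommGroup M] [Module K M]
    (τ : K ≃+* K) (f : Equiv.Perm M) : Prop :=
  (∀ x y : M, f (x + y) = f x + f y) ∧ ∀ (c : K) (x : M), f (c • x) = τ c • f x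

theorem IsSemilinearWith.one {K M : Type*} [Field K] [AddCommGroup M] [Module K M] :
    IsSemilinearWith (1 : K ≃+* K) (1 : Equiv.Perm M) := ⟨fun _ _ => rfl, fun _ _ => rfl⟩

theorem IsSemilinearWith.mul {K M : Type*} [Field K] [AddCommGroup M] [Module K M]
    {τ υ : K ≃+* K} {f g : Equiv.Perm M} (hf : IsSemilinearWith τ f)
    (hg : IsSemilinearWith υ g) : IsSemilinearWith (τ * υ) (f * g) :=
  ⟨fun x y => by simp only [Equiv.Perm.mul_apply, hg.1, hf.1],
    fun c x => by simp only [Equiv.Perm.mul_apply, hg.2, hf.2, RingAut.mul_apply]⟩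

theorem IsSemilinearWith.inv {K M : Type*} [Field K] [AddCommGroup M] [Module K M]
    {τ : K ≃+* K} {f : Equiv.Perm M} (hf : IsSemilinearWith τ f) :
    IsSemilinearWith τ⁻¹ f⁻¹ :=
  ⟨fun x y => f.injective (by simp only [hf.1, perm_apply_inv]),
    fun c x => f.injective (by
      simp only [hf.2, perm_apply_inv, ringAut_apply_inv])⟩

/-- The group `ΓL(M)` of all bijective semilinear maps of the `K`-vector space `M`. -/
def GammaL (K M : Type*) [Field K] [AddCommGroup M] [Module K M] : Subgroup (Equiv.Perm M) where
  carrier := {f | ∃ τ : K ≃+* K, IsSemilinearWith τ f}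
  one_mem' := ⟨1, .one⟩
  mul_mem' := fun ⟨_, hf⟩ ⟨_, hg⟩ => ⟨_, hf.mul hg⟩
  inv_mem' := fun ⟨_, hf⟩ => ⟨_, hf.inv⟩

/-- The subgroup of `ΓL(M)` of the scalar maps `x ↦ c x`, `c ≠ 0`. -/
def scalarMaps (K M : Type*) [Field K] [AddCommGroup M] [Module K M] :
    Subgroup (GammaL K M) where
  carrier := {f | ∃ c : Kˣ, ∀ x : M, (f : Equiv.Perm M) x = c • x}
  one_mem' := ⟨1, fun x => (one_smul _ x).symm⟩
  mul_mem' := fun {f g} ⟨c, hf⟩ ⟨d, hg⟩ => ⟨c * d, fun x => by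
    rw [Subgroup.coe_mul, Equiv.Perm.mul_apply, hg, hf, mul_smul]⟩
  inv_mem' := fun {f} ⟨c, hf⟩ => ⟨c⁻¹, fun x => by
    apply (f : Equiv.Perm M).injective
    rw [Subgroup.coe_inv, perm_apply_inv, hf, smul_inv_smul]⟩

instance scalarMaps_normal (K M : Type*) [Field K] [AddCommGroup M] [Module K M] :
    (scalarMaps K M).Normal where
  conj_mem := by
    rintro f ⟨c, hf⟩ ⟨g, τ, hg⟩
    refine ⟨Units.map (τ : K →* K) c, fun x => ?_⟩
    have h := hg.2 (c : K) (g⁻¹ x)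
    rw [perm_apply_inv] at h
    change g ((f : Equiv.Perm M) (g⁻¹ x)) = _
    rw [hf, Units.smul_def, h]
    rfl

/-- The collineation group `PΓL(M)`: semilinear bijections modulo scalars. -/
abbrev PGammaL (K M : Type*) [Field K] [AddCommGroup M] [Module K M] :=
  GammaL K M ⧸ scalarMaps K M

/-- For a group `G` of semilinear maps, the group induced by `G` in `PΓL(M)`,
that is, `G` modulo the scalar maps it contains. -/
def projGroup (K : Type*) {M : Type*} [Field K] [AddCommGroup M] [Module K M]
    (G : Subgroup (Equiv.Perm M)) : Subgroup (PGammaL K M) :=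
  (G.subgroupOf (GammaL K M)).map (QuotientGroup.mk' (scalarMaps K M))

/-! ### Hermitian forms and unitary groups -/

/-- The involution `x ↦ x ^ q` of `K`, where `q = |F|` (of order two if `[K : F] = 2`). -/
abbrev conjHom (F K : Type*) [Field F] [Fintype F] [Field K] [Algebra F K] : K →+* K :=
  (FiniteField.frobeniusAlgHom F K : K →+* K)

/-- The group `ΓU(η)` of semilinear similitudes of a form `η`: bijective `τ`-semilinear maps `g`
with `η(g x, g y) = c τ(η(x, y))` for a nonzero constant `c`. -/
def GammaU {K V : Type*} [Field K] [AddCommGroup V] [Module K V] {σ : K →+* K}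
    (η : V →ₛₗ[σ] V →ₗ[K] K) : Subgroup (Equiv.Perm V) where
  carrier := {g | ∃ (τ : K ≃+* K) (c : Kˣ), IsSemilinearWith τ g ∧
    ∀ x y, η (g x) (g y) = c * τ (η x y)}
  one_mem' := ⟨1, 1, .one, fun x y => by simp⟩
  mul_mem' := by
    rintro f g ⟨τ, c, hf, hf'⟩ ⟨υ, d, hg, hg'⟩
    refine ⟨τ * υ, c * Units.map (τ : K →* K) d, hf.mul hg, fun x y => ?_⟩
    simp [Equiv.Perm.mul_apply, hf', hg', mul_assoc]
  inv_mem' := by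
    rintro g ⟨τ, c, hg, hg'⟩
    refine ⟨τ⁻¹, Units.map ((τ⁻¹ : K ≃+* K) : K →* K) c⁻¹, hg.inv, fun x y => ?_⟩
    apply τ.injective
    have h := hg' (g⁻¹ x) (g⁻¹ y)
    rw [perm_apply_inv, perm_apply_inv] at h
    rw [h]
    simp

/-- `PΓU(η)`. -/
abbrev PGammaU {K V : Type*} [Field K] [AddCommGroup V] [Module K V] {σ : K →+* K}
    (η : V →ₛₗ[σ] V →ₗ[K] K) : Subgroup (PGammaL K V) :=
  projGroup K (GammaU η)

/-! ### Quadratic forms and orthogonal groups -/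

/-- The group `ΓO(Q)` of semilinear similitudes of a quadratic form `Q`. -/
def GammaO {F U : Type*} [Field F] [AddCommGroup U] [Module F U] (Q : QuadraticForm F U) :
    Subgroup (Equiv.Perm U) where
  carrier := {g | ∃ (τ : F ≃+* F) (c : Fˣ), IsSemilinearWith τ g ∧ ∀ x, Q (g x) = c * τ (Q x)}
  one_mem' := ⟨1, 1, .one, fun x => by simp⟩
  mul_mem' := by
    rintro f g ⟨τ, c, hf, hf'⟩ ⟨υ, d, hg, hg'⟩
    refine ⟨τ * υ, c * Units.map (τ : F →* F) d, hf.mul hg, fun x => ?_⟩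
    simp [Equiv.Perm.mul_apply, hf', hg', mul_assoc]
  inv_mem' := by
    rintro g ⟨τ, c, hg, hg'⟩
    refine ⟨τ⁻¹, Units.map ((τ⁻¹ : F ≃+* F) : F →* F) c⁻¹, hg.inv, fun x => ?_⟩
    apply τ.injective
    have h := hg' (g⁻¹ x)
    rw [perm_apply_inv] at h
    rw [h]
    simp

/-- The subgroup of the permutation group of `M` of the `K`-linear bijections. -/
def linearMaps (K M : Type*) [Field K] [AddCommGroup M] [Module K M] : Subgroup (Equiv.Perm M) where
  carrier := {f | IsSemilinearWith (1 : K ≃+* K) f}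
  one_mem' := .one
  mul_mem' := fun hf hg => by simpa using hf.mul hg
  inv_mem' := fun hf => by simpa using hf.inv

/-- `PΓO(Q)`: semilinear similitudes of `Q` modulo scalars. -/
abbrev PGammaO {F U : Type*} [Field F] [AddCommGroup U] [Module F U] (Q : QuadraticForm F U) :
    Subgroup (PGammaL F U) :=
  projGroup F (GammaO Q)

/-- `PGO(Q)`: linear similitudes of `Q` modulo scalars. -/
abbrev PGO {F U : Type*} [Field F] [AddCommGroup U] [Module F U] (Q : QuadraticForm F U) :
    Subgroup (PGammaL F U) :=
  projGroup F (GammaO Q ⊓ linearMaps F U)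

/-- Elliptic quadratic forms in six variables, those whose singular points form `Q⁻(5, q)`:
the polar form is nondegenerate and the maximal totally singular subspaces have vector
dimension two. -/
def IsElliptic {F : Type*} [Field F] (Q : QuadraticForm F (Fin 6 → F)) : Prop :=
  Q.polarBilin.Nondegenerate ∧
  (∃ S : Submodule F (Fin 6 → F), Module.finrank F S = 2 ∧ ∀ x ∈ S, Q x = 0) ∧
  ∀ S : Submodule F (Fin 6 → F), (∀ x ∈ S, Q x = 0) → Module.finrank F S ≤ 2

/-! ### Hermitian Grassmannians and their Plücker images -/

/-- The points of the Hermitian `k`-Grassmannian: the totally `η`-isotropic subspaces of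
dimension `k`. -/
def isotropicGrassmannian {K V : Type*} [Field K] [AddCommGroup V] [Module K V] {σ : K →+* K}
    (η : V →ₛₗ[σ] V →ₗ[K] K) (k : ℕ) : Set (Submodule K V) :=
  {X | Module.finrank K X = k ∧ ∀ x ∈ X, ∀ y ∈ X, η x y = 0}

/-- The image of the Hermitian `k`-Grassmannian under the Plücker embedding
`⟨v₁, …, v_k⟩ ↦ [v₁ ∧ ⋯ ∧ v_k]`. -/
def pluckerImage {K V : Type*} [Field K] [AddCommGroup V] [Module K V] {σ : K →+* K}
    (η : V →ₛₗ[σ] V →ₗ[K] K) (k : ℕ) : Set (ℙ K (⋀[K]^k V)) :=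
  {P | ∃ X ∈ isotropicGrassmannian η k, ∃ v : Fin k → V,
    Submodule.span K (Set.range v) = X ∧
    P.submodule = Submodule.span K {exteriorPower.ιMulti K k v}}

/-! ### Projective codes and monomial automorphisms -/

/-- `ω` selects a vector representative of every point of `Ω`. -/
def IsRepresentatives {K W : Type*} [Field K] [AddCommGroup W] [Module K W]
    (Ω : Set (ℙ K W)) (ω : Ω → W) : Prop :=
  ∀ P : Ω, ∃ h : ω P ≠ 0, Projectivization.mk K (ω P) h = P

/-- The code with coordinate positions `ι` whose generator matrix has the vectors `ω i` as
columns: its words are `(φ (ω i))_i` for the linear functionals `φ`. -/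
def codeOf {K W ι : Type*} [Field K] [AddCommGroup W] [Module K W] (ω : ι → W) :
    Submodule K (ι → K) :=
  LinearMap.range (LinearMap.pi fun i => Module.Dual.eval K W (ω i))

/-- `f` is the semilinear monomial map with permutation `π`, nonzero entries `d i`, and field
automorphism `τ`. -/
def IsMonomialWith {K ι : Type*} [Field K] (π : Equiv.Perm ι) (d : ι → Kˣ) (τ : K ≃+* K)
    (f : Equiv.Perm (ι → K)) : Prop :=
  ∀ (x : ι → K) (i : ι), f x (π i) = d i * τ (x i)

theorem IsMonomialWith.one {K ι : Type*} [Field K] :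
    IsMonomialWith (1 : Equiv.Perm ι) (fun _ => 1) (1 : K ≃+* K) 1 := fun x i => by simp

theorem IsMonomialWith.mul {K ι : Type*} [Field K] {π ρ : Equiv.Perm ι} {d e : ι → Kˣ}
    {τ υ : K ≃+* K} {f g : Equiv.Perm (ι → K)} (hf : IsMonomialWith π d τ f)
    (hg : IsMonomialWith ρ e υ g) :
    IsMonomialWith (π * ρ) (fun i => d (ρ i) * Units.map (τ : K →* K) (e i)) (τ * υ) (f * g) :=
  fun x i => by
    rw [Equiv.Perm.mul_apply, Equiv.Perm.mul_apply, hf, hg]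
    simp [mul_assoc]

theorem IsMonomialWith.inv {K ι : Type*} [Field K] {π : Equiv.Perm ι} {d : ι → Kˣ}
    {τ : K ≃+* K} {f : Equiv.Perm (ι → K)} (hf : IsMonomialWith π d τ f) :
    IsMonomialWith π⁻¹ (fun i => Units.map ((τ⁻¹ : K ≃+* K) : K →* K) (d (π⁻¹ i))⁻¹) τ⁻¹ f⁻¹ :=
  fun x i => by
    apply τ.injective
    have h := hf (f⁻¹ x) (π⁻¹ i)
    rw [perm_apply_inv, perm_apply_inv] at h
    rw [h]
    simp

/-- The group of all semilinear monomial maps of `K^ι` that map the code `C` onto itself. -/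
def monomialAut {K ι : Type*} [Field K] (C : Submodule K (ι → K)) :
    Subgroup (Equiv.Perm (ι → K)) where
  carrier := {f | (∃ π d τ, IsMonomialWith π d τ f) ∧ ∀ x, f x ∈ C ↔ x ∈ C}
  one_mem' := ⟨⟨_, _, _, .one⟩, fun _ => Iff.rfl⟩
  mul_mem' := by
    rintro f g ⟨⟨_, _, _, hf⟩, hf'⟩ ⟨⟨_, _, _, hg⟩, hg'⟩
    exact ⟨⟨_, _, _, hf.mul hg⟩, fun x => by rw [Equiv.Perm.mul_apply, hf', hg']⟩
  inv_mem' := by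
    rintro f ⟨⟨_, _, _, hf⟩, hf'⟩
    exact ⟨⟨_, _, _, hf.inv⟩, fun x => by rw [← hf', perm_apply_inv]⟩

/-- Semilinear monomial automorphisms of `C` modulo scalars. -/
abbrev PGammaMonAut {K ι : Type*} [Field K] (C : Submodule K (ι → K)) :
    Subgroup (PGammaL K (ι → K)) :=
  projGroup K (monomialAut C)

/-- Linear monomial automorphisms of `C` modulo scalars. -/
abbrev PMonAut {K ι : Type*} [Field K] (C : Submodule K (ι → K)) :
    Subgroup (PGammaL K (ι → K)) :=
  projGroup K (monomialAut C ⊓ linearMaps K (ι → K))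

/-- The permutations of the coordinate positions that are induced by the semilinear monomial
automorphisms of `C`. -/
def monomialPerm {K ι : Type*} [Field K] (C : Submodule K (ι → K)) :
    Subgroup (Equiv.Perm ι) where
  carrier := {π | ∃ f ∈ monomialAut C, ∃ d τ, IsMonomialWith π d τ f}
  one_mem' := ⟨1, one_mem _, _, _, .one⟩
  mul_mem' := by
    rintro π ρ ⟨f, hf, _, _, hf'⟩ ⟨g, hg, _, _, hg'⟩
    exact ⟨f * g, mul_mem hf hg, _, _, hf'.mul hg'⟩
  inv_mem' := by
    rintro π ⟨f, hf, _, _, hf'⟩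
    exact ⟨f⁻¹, inv_mem hf, _, _, hf'.inv⟩

end

/-! The vectors `ω P` span ⋀²V, so words of the code are functionals on ⋀²V, and a monomial map
preserving the code is dual to a semilinear bijection of ⋀²V permuting the points of ℍ
(`exists_permutes`, `Permutes.mem_monomialAut`). The problem becomes one about collineations of
PG(⋀²V) stabilising ℍ. Groups are compared through correspondences: a subgroup of a product
projecting onto both factors, with matching kernels, identifies the quotients
(`nonempty_mulEquiv_of_relation`).

For m > 5 such a collineation g must be recovered from a map of V. The bivectors of two isotropic
lines on a common point have a combination that is again decomposable and isotropic (or zero). The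
image of this combination is decomposable too, so the image lines meet (`exists_mem_inter`). Hence
the star p ∧ pᗮ of an isotropic p goes to the star of an isotropic p'
(`PreservesIsotropic.exists_mapsStar`). The stars at a hyperbolic pair e, f give two semilinear maps
on W = ⟨e, f⟩ᗮ, which agree projectively on isotropic vectors and so are proportional
(`NondegOn.proportional`). They assemble to a semilinear bijection of V; after dividing by its
exterior square, g fixes all e ∧ w and f ∧ w. Such a map is a scalar l on ⋀²W and l⁻¹ on e ∧ f
(`FixesFrame.exists_scalar`), and rescaling e and f absorbs l. The resulting map of V preserves
isotropic vectors, which determine the Hermitian form up to a factor (`IsHypPair.form_unique`), so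
it is a similitude. The bound on m makes dim W ≥ 4: then W contains isotropic lines, and these
connect its isotropic vectors, which is how scalars propagate. A collineation induced from V that
fixes ℍ pointwise is trivial, so permutations and maps modulo scalars give the same group.

For m = 4, Plücker coordinates in a hyperbolic frame turn isotropy into reality conditions: up to a
common scalar, two coordinates are fixed by conjugation, two are skew and two are conjugate. The
Plücker relation becomes u₀u₁ + δu₂u₃ - N(u₄, u₅) over F, with N the norm form of K/F, hence
elliptic. A collineation stabilising ℍ preserves the subgeometry, because the scalars it introduces
have ratios in F along singular lines (`exists_similitude_of_preserves`), and the singular vectors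
determine the form (`ellipticForm_unique`). Conjugation of coordinates fixes ℍ pointwise without
being scalar; this is why PGO arises from linear automorphisms modulo scalars, but PΓO only from the
induced permutations. -/

/-! ### Unitary involutions of a field -/

/-- An involution `σ ≠ 1` of a field whose norm `a σ(a)` is onto the fixed field. -/
structure IsUnitaryInvolution {K : Type*} [Field K] (σ : K →+* K) : Prop where
  invol : ∀ x, σ (σ x) = x
  norm_surj : ∀ r, σ r = r → ∃ a, a * σ a = r
  exists_ne : ∃ z, σ z ≠ z

namespace IsUnitaryInvolution

variable {K : Type*} [Field K] {σ : K →+* K} (hσ : IsUnitaryInvolution σ)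
include hσ

theorem exists_skew : ∃ d, d ≠ 0 ∧ σ d = -d := by
  obtain ⟨z, hz⟩ := hσ.exists_ne
  refine ⟨z - σ z, sub_ne_zero.2 (Ne.symm hz), ?_⟩
  rw [map_sub, hσ.invol]; ring

/-- The quotient of z by the skew element z - σ z has trace one in every characteristic, where 1/2
would fail in characteristic two. -/
theorem exists_trace_one : ∃ a, a + σ a = 1 := by
  obtain ⟨z, hz⟩ := hσ.exists_ne
  have hd : z - σ z ≠ 0 := sub_ne_zero.2 (Ne.symm hz)
  refine ⟨z / (z - σ z), ?_⟩
  have h2 : σ (z - σ z) = -(z - σ z) := by rw [map_sub, hσ.invol]; ring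
  rw [map_div₀, h2, div_neg, ← sub_eq_add_neg, ← sub_div, div_self hd]

theorem exists_trace_eq {r : K} (hr : σ r = r) : ∃ a, a + σ a = r := by
  obtain ⟨a, ha⟩ := hσ.exists_trace_one
  exact ⟨r * a, by rw [map_mul, hr, ← mul_add, ha, mul_one]⟩

theorem eq_zero_of_trace {x : K} (h : ∀ a, a * x + σ (a * x) = 0) : x = 0 := by
  by_contra hx
  obtain ⟨a, ha⟩ := hσ.exists_trace_one
  have := h (a * x⁻¹)
  rw [mul_assoc, inv_mul_cancel₀ hx, mul_one, ha] at this
  exact one_ne_zero this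

end IsUnitaryInvolution

/-! ### Hermitian geometry relative to a nondegenerate subspace -/

section Hermitian

variable {K V : Type*} [Field K] [AddCommGroup V] [Module K V] {σ : K →+* K}

/-- The restriction of `η` to `S` is nondegenerate. -/
def NondegOn (η : V →ₛₗ[σ] V →ₗ[K] K) (S : Submodule K V) : Prop :=
  ∀ x ∈ S, (∀ y ∈ S, η x y = 0) → x = 0

/-- `e`, `f` is a hyperbolic pair. -/
structure IsHypPair (η : V →ₛₗ[σ] V →ₗ[K] K) (e f : V) : Prop where
  ee : η e e = 0
  ff : η f f = 0
  ef : η e f = 1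
  fe : η f e = 1

/-- The part of `S` orthogonal to `e` and `f`. -/
def hypPerp (η : V →ₛₗ[σ] V →ₗ[K] K) (S : Submodule K V) (e f : V) : Submodule K V :=
  S ⊓ LinearMap.ker (η e) ⊓ LinearMap.ker (η f)

theorem mem_hypPerp {η : V →ₛₗ[σ] V →ₗ[K] K} {S : Submodule K V} {e f x : V} :
    x ∈ hypPerp η S e f ↔ x ∈ S ∧ η e x = 0 ∧ η f x = 0 := by
  simp [hypPerp, and_assoc]

variable {η : V →ₛₗ[σ] V →ₗ[K] K} {S : Submodule K V}

theorem IsHypPair.sub_mem {e f : V} (h : IsHypPair η e f) (he : e ∈ S) (hf : f ∈ S) {x : V}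
    (hx : x ∈ S) : x - η f x • e - η e x • f ∈ hypPerp η S e f := by
  refine mem_hypPerp.2
    ⟨S.sub_mem (S.sub_mem hx (S.smul_mem _ he)) (S.smul_mem _ hf), ?_, ?_⟩ <;>
  simp [h.ee, h.ef, h.fe, h.ff]

theorem IsHypPair.ne_zero {e f : V} (h : IsHypPair η e f) : e ≠ 0 := by
  rintro rfl
  simpa using h.ef

theorem IsHypPair.ne_zero' {e f : V} (h : IsHypPair η e f) : f ≠ 0 := by
  rintro rfl
  simpa using h.ef

theorem IsHypPair.symm {e f : V} (h : IsHypPair η e f) : IsHypPair η f e :=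
  ⟨h.ff, h.ee, h.fe, h.ef⟩

theorem IsHypPair.nondegOn {e f : V} (h : IsHypPair η e f) (hη : η.IsSymm) (he : e ∈ S)
    (hf : f ∈ S) (hS : NondegOn η S) : NondegOn η (hypPerp η S e f) := by
  intro x hx hxy
  obtain ⟨hxS, hex, hfx⟩ := mem_hypPerp.1 hx
  refine hS x hxS fun y hy => ?_
  have h1 := hxy _ (h.sub_mem he hf hy)
  have h2 : η x e = 0 := hη.eq_iff.1 hex
  have h3 : η x f = 0 := hη.eq_iff.1 hfx
  simpa [h2, h3] using h1

theorem finrank_le_inf_ker [FiniteDimensional K V] (S : Submodule K V) (φ : V →ₗ[K] K) :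
    Module.finrank K S ≤ Module.finrank K ↥(S ⊓ LinearMap.ker φ) + 1 := by
  have h1 := Submodule.finrank_sup_add_finrank_inf_eq S (LinearMap.ker φ)
  have h2 := LinearMap.finrank_range_add_finrank_ker φ
  have h3 : Module.finrank K (LinearMap.range φ) ≤ 1 := by
    simpa using Submodule.finrank_le (LinearMap.range φ)
  have h4 := Submodule.finrank_le (S ⊔ LinearMap.ker φ)
  omega

theorem finrank_le_hypPerp [FiniteDimensional K V] (η : V →ₛₗ[σ] V →ₗ[K] K)
    (S : Submodule K V) (e f : V) :
    Module.finrank K S ≤ Module.finrank K (hypPerp η S e f) + 2 := by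
  have h1 := finrank_le_inf_ker S (η e)
  have h2 := finrank_le_inf_ker (S ⊓ LinearMap.ker (η e)) (η f)
  unfold hypPerp
  omega

theorem exists_mem_ne_zero_of_finrank_pos {S : Submodule K V} (h : 0 < Module.finrank K S) :
    ∃ x ∈ S, x ≠ 0 := by
  have : S ≠ ⊥ := by
    rintro rfl
    simp at h
  exact Submodule.exists_mem_ne_zero_of_ne_bot this

variable [FiniteDimensional K V] (hσ : IsUnitaryInvolution σ) (hη : η.IsSymm)
include hσ hη

/-- On two orthogonal vectors the form is diagonal with entries in the fixed field, so surjectivity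
of the norm solves η(x, x) + a σ(a) η(y, y) = 0. -/
theorem exists_isotropic_of_finrank (h2 : 2 ≤ Module.finrank K S) :
    ∃ e ∈ S, e ≠ 0 ∧ η e e = 0 := by
  obtain ⟨x, hx, hx0⟩ := exists_mem_ne_zero_of_finrank_pos (S := S) (by omega)
  by_cases hxx : η x x = 0
  · exact ⟨x, hx, hx0, hxx⟩
  obtain ⟨y, hy, hy0⟩ := exists_mem_ne_zero_of_finrank_pos (S := S ⊓ LinearMap.ker (η x))
    (by have := finrank_le_inf_ker S (η x); omega)
  obtain ⟨hyS, hxy⟩ := hy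
  have hxy : η x y = 0 := hxy
  by_cases hyy : η y y = 0
  · exact ⟨y, hyS, hy0, hyy⟩
  obtain ⟨a, ha⟩ := hσ.norm_surj (-(η x x) / η y y) (by
    rw [map_div₀, map_neg, hη.eq, hη.eq])
  refine ⟨x + a • y, S.add_mem hx (S.smul_mem _ hyS), fun h0 => hxx ?_, ?_⟩
  · have := congrArg (η x) h0
    simpa [hxy] using this
  · have hyx : η y x = 0 := hη.eq_iff.1 hxy
    have : a * σ a * η y y = -(η x x) := by rw [ha, div_mul_cancel₀ _ hyy]
    simp only [map_add, LinearMap.map_smulₛₗ, LinearMap.add_apply, LinearMap.smul_apply, hxy, hyx,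
      smul_eq_mul, RingHom.id_apply]
    linear_combination this

omit [FiniteDimensional K V] in
-- If η(e, z) = 1, adding c e to z changes η(z, z) by the trace of c, and traces fill the fixed
-- field.
theorem NondegOn.exists_hypPair (hS : NondegOn η S) {e : V} (he : e ∈ S) (he0 : e ≠ 0)
    (hee : η e e = 0) : ∃ f ∈ S, IsHypPair η e f := by
  have : ∃ y ∈ S, η e y ≠ 0 := by
    by_contra! h
    exact he0 (hS e he h)
  obtain ⟨y, hy, hey⟩ := this
  obtain ⟨z, hz, hez⟩ : ∃ z ∈ S, η e z = 1 :=
    ⟨(η e y)⁻¹ • y, S.smul_mem _ hy, by simp [hey]⟩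
  have hze : η z e = 1 := by rw [← hη.eq, hez, map_one]
  obtain ⟨c, hc⟩ := hσ.exists_trace_eq (r := -(η z z)) (by rw [map_neg, hη.eq])
  have hf1 : η e (z + c • e) = 1 := by simp [hez, hee]
  refine ⟨z + c • e, S.add_mem hz (S.smul_mem _ he), hee, ?_, hf1, ?_⟩
  · simp only [map_add, LinearMap.map_smulₛₗ, LinearMap.add_apply, LinearMap.smul_apply, hez, hze,
      smul_eq_mul, hee, RingHom.id_apply]
    linear_combination hc
  · rw [← hη.eq, hf1, map_one]

theorem NondegOn.exists_pair (hS : NondegOn η S) (h2 : 2 ≤ Module.finrank K S) :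
    ∃ e ∈ S, ∃ f ∈ S, IsHypPair η e f := by
  obtain ⟨e, he, he0, hee⟩ := exists_isotropic_of_finrank hσ hη h2
  obtain ⟨f, hf, h⟩ := hS.exists_hypPair hσ hη he he0 hee
  exact ⟨e, he, f, hf, h⟩

/-- The isotropic vectors of `S` generate `S` as an additive group. -/
theorem NondegOn.le_of_isotropic_mem (hS : NondegOn η S) (h2 : 2 ≤ Module.finrank K S)
    (T : AddSubgroup V) (hT : ∀ x ∈ S, η x x = 0 → x ∈ T) {x : V} (hx : x ∈ S) : x ∈ T := by
  obtain ⟨e, he, f, hf, h⟩ := hS.exists_pair hσ hη h2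
  have hw := h.sub_mem he hf hx
  set w := x - η f x • e - η e x • f with hwdef
  obtain ⟨hwS, hew, hfw⟩ := mem_hypPerp.1 hw
  have hE : ∀ c : K, c • e ∈ T := fun c => hT _ (S.smul_mem _ he) (by simp [h.ee])
  have hF : ∀ c : K, c • f ∈ T := fun c => hT _ (S.smul_mem _ hf) (by simp [h.ff])
  have hwT : w ∈ T := by
    obtain ⟨a, ha⟩ := hσ.exists_trace_eq (r := -(η w w)) (by rw [map_neg, hη.eq])
    -- The trace of a is -η(w, w), which cancels the value of the form at the arbitrary vector w of
    -- the complement.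
    have h1 : e + a • f + w ∈ T := hT _
      (S.add_mem (S.add_mem he (S.smul_mem _ hf)) hwS) (by
        have hwe : η w e = 0 := hη.eq_iff.1 hew
        have hwf : η w f = 0 := hη.eq_iff.1 hfw
        simp only [map_add, LinearMap.map_smulₛₗ, LinearMap.add_apply, LinearMap.smul_apply, h.ee,
          h.ef, h.fe, h.ff, hew, hfw, hwe, hwf, smul_eq_mul, RingHom.id_apply]
        linear_combination ha)
    have h2 := T.sub_mem (T.sub_mem h1 (hF a)) (hE 1)
    convert h2 using 1
    rw [one_smul]; abel
  have : x = w + η f x • e + η e x • f := by rw [hwdef]; abel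
  rw [this]
  exact T.add_mem (T.add_mem hwT (hE _)) (hF _)

omit [FiniteDimensional K V] hσ in
theorem hypPair_of_ne_zero {x y : V} (hxx : η x x = 0) (hyy : η y y = 0) (hxy : η x y ≠ 0) :
    IsHypPair η x ((η x y)⁻¹ • y) := by
  have h1 : η x ((η x y)⁻¹ • y) = 1 := by simp [hxy]
  exact ⟨hxx, by simp [hyy], h1, by rw [← hη.eq, h1, map_one]⟩

/-- Two nonorthogonal isotropic vectors have a common isotropic neighbour. -/
theorem exists_common_isotropic (h4 : 4 ≤ Module.finrank K S) {x y : V}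
    (hxx : η x x = 0) (hyy : η y y = 0) (hxy : η x y ≠ 0) :
    ∃ z ∈ S, η z z = 0 ∧ η x z = 0 ∧ η y z = 0 ∧ LinearIndependent K ![x, z] ∧
      LinearIndependent K ![y, z] := by
  have h := hypPair_of_ne_zero hη hxx hyy hxy
  obtain ⟨z, hz, hz0, hzz⟩ := exists_isotropic_of_finrank (S := hypPerp η S x ((η x y)⁻¹ • y)) hσ hη
    (by have := finrank_le_hypPerp η S x ((η x y)⁻¹ • y); omega)
  obtain ⟨hzS, hxz, hyz⟩ := mem_hypPerp.1 hz
  have hyz : η y z = 0 := by simpa [hxy] using hyz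
  have hyx : η y x ≠ 0 := fun h => hxy (hη.eq_iff.1 h)
  refine ⟨z, hzS, hzz, hxz, hyz, ?_, ?_⟩ <;> rw [LinearIndependent.pair_iff] <;> intro s t hst
  · have h1 := congrArg (η y) hst
    have hs : s = 0 := by simpa [hyz, hyx] using h1
    subst hs
    exact ⟨rfl, by simpa [hz0] using hst⟩
  · have h1 := congrArg (η x) hst
    have hs : s = 0 := by simpa [hxz, hxy] using h1
    subst hs
    exact ⟨rfl, by simpa [hz0] using hst⟩

/-- A property of isotropic vectors that passes along isotropic lines is independent of the
vector. -/
theorem NondegOn.rel_of_line (hS : NondegOn η S) (h4 : 4 ≤ Module.finrank K S)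
    {α : Type*} (c : V → α) (hc : ∀ x ∈ S, ∀ y ∈ S, η x x = 0 → η y y = 0 → η x y = 0 →
      LinearIndependent K ![x, y] → c x = c y) {x y : V}
    (hx : x ∈ S) (hy : y ∈ S) (hxx : η x x = 0) (hyy : η y y = 0) (hx0 : x ≠ 0) (hy0 : y ≠ 0) :
    c x = c y := by
  have key : ∀ x ∈ S, ∀ y ∈ S, η x x = 0 → η y y = 0 → η x y ≠ 0 → c x = c y := by
    intro x hx y hy hxx hyy hxy
    obtain ⟨z, hz, hzz, hxz, hyz, h1, h2⟩ := exists_common_isotropic hσ hη h4 hxx hyy hxy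
    rw [hc x hx z hz hxx hzz hxz h1, hc y hy z hz hyy hzz hyz h2]
  by_cases hxy : η x y = 0
  · by_cases hl : LinearIndependent K ![x, y]
    · exact hc x hx y hy hxx hyy hxy hl
    -- Proportional vectors span no line; a hyperbolic partner f of x is nonorthogonal to both and
    -- links them.
    · obtain ⟨f, hf, h⟩ := hS.exists_hypPair hσ hη hx hx0 hxx
      obtain ⟨a, ha⟩ : ∃ a : K, a • x = y := by
        by_contra! hne
        exact hl ((LinearIndependent.pair_iff' hx0).2 hne)
      have ha0 : a ≠ 0 := by rintro rfl; exact hy0 (by simpa using ha.symm)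
      rw [key x hx f hf hxx h.ff (by simp [h.ef]), key y hy f hf hyy h.ff]
      rw [← ha]
      simp [h.ef, ha0]
  · exact key x hx y hy hxx hyy hxy

omit hσ hη [FiniteDimensional K V] in
theorem LinearIndependent.pair_map {M : Type*} [AddCommGroup M] [Module K M] {τ : K ≃+* K}
    {A : V → M} (hadd : ∀ x y, A (x + y) = A x + A y) (hsmul : ∀ (c : K) x, A (c • x) = τ c • A x)
    (hinj : ∀ x ∈ S, A x = 0 → x = 0) {x y : V} (hx : x ∈ S) (hy : y ∈ S)
    (h : LinearIndependent K ![x, y]) : LinearIndependent K ![A x, A y] := by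
  rw [LinearIndependent.pair_iff] at h ⊢
  intro s t hst
  have := h (τ.symm s) (τ.symm t) (hinj _
    (S.add_mem (S.smul_mem _ hx) (S.smul_mem _ hy)) (by rw [hadd, hsmul, hsmul]; simpa using hst))
  simpa using this

/-- If two maps agree projectively on the isotropic vectors, they are proportional. -/
theorem NondegOn.proportional (hS : NondegOn η S) (h4 : 4 ≤ Module.finrank K S)
    {M : Type*} [AddCommGroup M] [Module K M] {τ : K ≃+* K}
    {A B : V → M} (hadd : ∀ x y, A (x + y) = A x + A y) (hsmul : ∀ (c : K) x, A (c • x) = τ c • A x)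
    (hinj : ∀ x ∈ S, A x = 0 → x = 0) (hB : ∀ x y, B (x + y) = B x + B y)
    (hAB : ∀ x ∈ S, η x x = 0 → ∃ c : K, B x = c • A x) :
    ∃ c : K, ∀ x ∈ S, B x = c • A x := by
  choose! c hc using hAB
  have key : ∀ x ∈ S, ∀ y ∈ S, η x x = 0 → η y y = 0 → η x y = 0 →
      LinearIndependent K ![x, y] → c x = c y := by
    intro x hx y hy hxx hyy hxy hl
    have hyx : η y x = 0 := hη.eq_iff.1 hxy
    -- The sum x + y is isotropic, and its factor must equal those of x and y because A x and A y
    -- are independent.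
    have h1 := hc _ (S.add_mem hx hy) (by simp [hxx, hyy, hxy, hyx])
    rw [hB, hc x hx hxx, hc y hy hyy, hadd, smul_add] at h1
    have h2 := LinearIndependent.pair_map hadd hsmul hinj hx hy hl
    rw [LinearIndependent.pair_iff] at h2
    have h3 := h2 (c x - c (x + y)) (c y - c (x + y)) (by
      rw [sub_smul, sub_smul, sub_add_sub_comm, h1, sub_self])
    rw [sub_eq_zero.1 h3.1, sub_eq_zero.1 h3.2]
  obtain ⟨e, he, he0, hee⟩ := exists_isotropic_of_finrank (S := S) hσ hη (by omega)
  have hA0 : A 0 = 0 := by have := hadd 0 0; simpa using this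
  have hB0 : B 0 = 0 := by have := hB 0 0; simpa using this
  have hAn : ∀ x, A (-x) = -A x := fun x => by
    have := hadd x (-x); rw [add_neg_cancel, hA0] at this; exact (neg_eq_of_add_eq_zero_right this.symm).symm
  have hBn : ∀ x, B (-x) = -B x := fun x => by
    have := hB x (-x); rw [add_neg_cancel, hB0] at this; exact (neg_eq_of_add_eq_zero_right this.symm).symm
  let T : AddSubgroup V :=
    { carrier := {x | B x = c e • A x}
      add_mem' := fun {x y} hx hy => by
        change B (x + y) = _
        rw [hB, hadd, smul_add, show B x = _ from hx, show B y = _ from hy]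
      zero_mem' := by change B 0 = _; rw [hB0, hA0, smul_zero]
      neg_mem' := fun {x} hx => by
        change B (-x) = _; rw [hBn, hAn, show B x = _ from hx, smul_neg] }
  refine ⟨c e, fun x hx => hS.le_of_isotropic_mem hσ hη (by omega) T (fun y hy hyy => ?_) hx⟩
  change B y = _
  by_cases hy0 : y = 0
  · rw [hy0, hB0, hA0, smul_zero]
  · rw [hc y hy hyy, hS.rel_of_line hσ hη h4 c key hy he hyy hee hy0 he0]

/-- An alternating map vanishing on all isotropic orthogonal pairs vanishes. -/
theorem NondegOn.alternating_eq_zero (hS : NondegOn η S) (h4 : 4 ≤ Module.finrank K S)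
    {M : Type*} [AddCommGroup M] [Module K M] (β : V →ₗ[K] V →ₗ[K] M) (hβ : ∀ x, β x x = 0)
    (h : ∀ x ∈ S, ∀ y ∈ S, η x x = 0 → η y y = 0 → η x y = 0 → β x y = 0) {x y : V}
    (hx : x ∈ S) (hy : y ∈ S) : β x y = 0 := by
  have hpp : ∀ e ∈ S, ∀ f ∈ S, IsHypPair η e f → ∀ w ∈ hypPerp η S e f, β e w = 0 := by
    intro e he f hf hef w hw
    refine (hef.nondegOn hη he hf hS).le_of_isotropic_mem hσ hη
      (by have := finrank_le_hypPerp η S e f; omega) (LinearMap.ker (β e)).toAddSubgroup ?_ hw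
    intro u hu huu
    obtain ⟨huS, heu, -⟩ := mem_hypPerp.1 hu
    exact h e he u huS hef.ee huu heu
  have hpair : ∀ e ∈ S, ∀ f ∈ S, IsHypPair η e f → β e f = 0 := by
    intro e he f hf hef
    obtain ⟨w, hw, v, hv, hwv⟩ := (hef.nondegOn hη he hf hS).exists_pair hσ hη
      (by have := finrank_le_hypPerp η S e f; omega)
    obtain ⟨hwS, hew, hfw⟩ := mem_hypPerp.1 hw
    obtain ⟨hvS, hev, hfv⟩ := mem_hypPerp.1 hv
    have hwe : η w e = 0 := hη.eq_iff.1 hew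
    have hwf : η w f = 0 := hη.eq_iff.1 hfw
    have hve : η v e = 0 := hη.eq_iff.1 hev
    have hvf : η v f = 0 := hη.eq_iff.1 hfv
    -- The vectors e + a w and f - σ(a)⁻¹ v are isotropic and orthogonal for every a ≠ 0, and the
    -- mixed terms of β on them vanish. As a/σ(a) takes the value 1 at a = 1 and another at a = z, β
    -- w v must vanish.
    have key : ∀ a : K, a ≠ 0 → β e f = (a * (σ a)⁻¹) • β w v := by
      intro a ha
      have ha' : σ a ≠ 0 := (map_ne_zero σ).2 ha
      have h1 := h (e + a • w) (S.add_mem he (S.smul_mem _ hwS))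
        (f - (σ a)⁻¹ • v) (S.sub_mem hf (S.smul_mem _ hvS))
        (by simp [hef.ee, hew, hwe, hwv.ee]) (by simp [hef.ff, hfv, hvf, hwv.ff])
        (by simp [hef.ef, hev, hwf, hwv.ef, ha'])
      have h2 : β e v = 0 := hpp e he f hf hef v hv
      have h3 : β f w = 0 := hpp f hf e he hef.symm w
        (mem_hypPerp.2 ⟨hwS, hfw, hew⟩)
      have h4 : β w f = 0 := by
        have := hβ (w + f); simp [hβ, h3] at this; exact this
      simp only [map_add, map_sub, map_smul, LinearMap.add_apply, LinearMap.smul_apply, h2, h4,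
        smul_zero, add_zero, zero_add] at h1
      rw [smul_smul, mul_comm] at h1
      exact sub_eq_zero.1 h1
    obtain ⟨z, hz⟩ := hσ.exists_ne
    have hz0 : z ≠ 0 := by rintro rfl; simp at hz
    have h1 := key 1 one_ne_zero
    have h2 := key z hz0
    rw [map_one, inv_one, mul_one, one_smul] at h1
    rw [h1] at h2 ⊢
    have h3 : (1 - z * (σ z)⁻¹) • β w v = 0 := by rw [sub_smul, one_smul, ← h2, sub_self]
    refine (smul_eq_zero.1 h3).resolve_left fun h0 => hz ?_
    have hz0' : σ z ≠ 0 := (map_ne_zero σ).2 hz0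
    field_simp at h0
    exact sub_eq_zero.1 (h0.trans (mul_zero _))
  refine hS.le_of_isotropic_mem hσ hη (by omega) (LinearMap.ker (β x)).toAddSubgroup
    (fun y hy hyy => ?_) hy
  change β x y = 0
  refine hS.le_of_isotropic_mem hσ hη (by omega) (LinearMap.ker (β.flip y)).toAddSubgroup
    (fun x hx hxx => ?_) hx
  change β x y = 0
  by_cases hxy : η x y = 0
  · exact h x hx y hy hxx hyy hxy
  · have := hpair x hx _ (S.smul_mem _ hy) (hypPair_of_ne_zero hη hxx hyy hxy)
    simpa [hxy] using this

omit [FiniteDimensional K V] in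
/-- A Hermitian form is determined up to a scalar by its isotropic vectors. -/
theorem IsHypPair.form_unique {e f : V} (h : IsHypPair η e f) {η' : V →ₛₗ[σ] V →ₗ[K] K}
    (hη' : η'.IsSymm) (hiso : ∀ x, η x x = 0 → η' x x = 0) :
    ∃ c : K, ∀ x y, η' x y = c * η x y := by
  have hfix : ∀ {x : K}, (∀ t, σ t = -t → t * x + σ (t * x) = 0) → σ x = x := by
    intro x hx
    obtain ⟨d, hd0, hd⟩ := hσ.exists_skew
    have := hx d hd
    rw [map_mul, hd] at this
    exact (mul_left_cancel₀ hd0 (by linear_combination this)).symm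
  have expand : ∀ (θ : V →ₛₗ[σ] V →ₗ[K] K), θ.IsSymm → ∀ x y, θ (x + y) (x + y) =
      θ x x + θ y y + (θ x y + σ (θ x y)) := by
    intro θ hθ x y
    rw [hθ.eq]
    simp only [map_add, LinearMap.add_apply]
    ring
  have hc : σ (η' e f) = η' e f := hfix fun t ht => by
    have h1 := hiso (e + t • f) (by
      rw [expand η hη]; simp [h.ee, h.ff, h.ef, ht])
    rw [expand η' hη'] at h1
    simpa [hiso e h.ee, hiso f h.ff] using h1
  -- the expansion of `η'` at the isotropic vector `e + a f + w`
  have hgen : ∀ e f, IsHypPair η e f → σ (η' e f) = η' e f → ∀ w, η e w = 0 → η f w = 0 →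
      ∀ a, a + σ a = -(η w w) →
      η' w w - η' e f * η w w + ((η' e w + σ (η' e w)) + (σ a * η' f w + σ (σ a * η' f w))) = 0 := by
    intro e f h hc w hew hfw a ha
    have h1 := hiso (e + a • f + w) (by
      rw [expand η hη, expand η hη]; simp [h.ee, h.ff, h.ef, hew, hfw]
      linear_combination ha)
    rw [expand η' hη', expand η' hη'] at h1
    simp only [map_smul, LinearMap.map_smulₛₗ, LinearMap.smul_apply, hiso e h.ee, hiso f h.ff,
      map_add, LinearMap.add_apply, smul_eq_mul, mul_zero, zero_add, map_mul, hc] at h1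
    simp only [map_mul]
    linear_combination h1 - η' e f * ha
  have hperp : ∀ e f, IsHypPair η e f → σ (η' e f) = η' e f → ∀ w, η e w = 0 → η f w = 0 →
      η' f w = 0 := by
    intro e f h hc w hew hfw
    -- Replacing a by a - t with t skew keeps its trace, so η'(f, w) passes the test `hfix` and is
    -- fixed by σ. The same holds for z • w with σ z ≠ z, which forces it to be zero.
    have hfx : ∀ w, η e w = 0 → η f w = 0 → σ (η' f w) = η' f w := by
      intro w hew hfw
      obtain ⟨a, ha⟩ := hσ.exists_trace_eq (r := -(η w w)) (by rw [map_neg, hη.eq])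
      refine hfix fun t ht => ?_
      have h1 := hgen e f h hc w hew hfw a ha
      have h2 := hgen e f h hc w hew hfw (a - t) (by rw [map_sub, ht]; linear_combination ha)
      simp only [map_sub, ht, sub_neg_eq_add, add_mul, map_add] at h2
      linear_combination h2 - h1
    obtain ⟨z, hz⟩ := hσ.exists_ne
    have h1 := hfx w hew hfw
    have h2 := hfx (z • w) (by simp [hew]) (by simp [hfw])
    rw [map_smul, smul_eq_mul, map_mul, h1] at h2
    by_contra h0
    exact hz (mul_right_cancel₀ h0 h2)
  set c := η' e f with hcdef
  have hdiag : ∀ x, η' x x = c * η x x := by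
    intro x
    have hw := h.sub_mem (S := ⊤) trivial trivial (x := x) trivial
    set w := x - η f x • e - η e x • f
    have hx : x = (η f x • e + η e x • f) + w := by simp [w]
    obtain ⟨-, hew, hfw⟩ := mem_hypPerp.1 hw
    have h1 : η' f w = 0 := hperp e f h hc w hew hfw
    have h2 : η' e w = 0 := hperp f e h.symm (by rw [← hη'.eq, hσ.invol, ← hcdef, hc]) w hfw hew
    obtain ⟨a, ha⟩ := hσ.exists_trace_eq (r := -(η w w)) (by rw [map_neg, hη.eq])
    have h3 := hgen e f h hc w hew hfw a ha
    rw [h1, h2] at h3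
    generalize η f x = r at hx
    generalize η e x = s at hx
    rw [hx, expand η' hη', expand η hη, expand η' hη', expand η hη]
    simp only [map_smul, LinearMap.map_smulₛₗ, LinearMap.smul_apply, hiso e h.ee, hiso f h.ff,
      map_add, LinearMap.add_apply, smul_eq_mul, mul_zero, zero_add, add_zero, map_mul, h1, h2, hew,
      hfw, h.ee, h.ff, h.ef, ← hcdef, hc, map_zero, map_one] at h3 ⊢
    linear_combination h3
  -- The diagonal values at x + a y determine the trace of a η(x, y) for every a, and the trace form
  -- is nondegenerate.
  refine ⟨c, fun x y => sub_eq_zero.1 (hσ.eq_zero_of_trace fun a => ?_)⟩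
  have h1 := hdiag (x + a • y)
  rw [expand η' hη', expand η hη] at h1
  simp only [map_smul, LinearMap.map_smulₛₗ, LinearMap.smul_apply, smul_eq_mul, hdiag, map_mul] at h1
  simp only [map_mul, map_sub, hc]
  linear_combination h1

end Hermitian

/-! ### Bivectors -/

section Wedge

variable {K V : Type*} [Field K] [AddCommGroup V] [Module K V]

omit [AddCommGroup V] in
theorem range_pair (x y : V) : Set.range ![x, y] = {x, y} := by
  ext z; simp [or_comm, eq_comm]

omit [AddCommGroup V] in
theorem pluckerPair_update_zero (v : Fin 2 → V) (x : V) : Function.update v 0 x = ![x, v 1] := by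
  ext i; fin_cases i <;> simp

omit [AddCommGroup V] in
theorem pluckerPair_update_one (v : Fin 2 → V) (x : V) : Function.update v 1 x = ![v 0, x] := by
  ext i; fin_cases i <;> simp

/-- The exterior product of two vectors. -/
noncomputable def wedge : V →ₗ[K] V →ₗ[K] ⋀[K]^2 V :=
  LinearMap.mk₂ K (fun x y => exteriorPower.ιMulti K 2 ![x, y])
    (fun x x' y => by
      have := (exteriorPower.ιMulti K 2 (M := V)).map_update_add ![x, y] 0 x x'
      simpa [pluckerPair_update_zero] using this)
    (fun c x y => by
      have := (exteriorPower.ιMulti K 2 (M := V)).map_update_smul ![x, y] 0 c x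
      simpa [pluckerPair_update_zero] using this)
    (fun x y y' => by
      have := (exteriorPower.ιMulti K 2 (M := V)).map_update_add ![x, y] 1 y y'
      simpa [pluckerPair_update_one] using this)
    (fun c x y => by
      have := (exteriorPower.ιMulti K 2 (M := V)).map_update_smul ![x, y] 1 c y
      simpa [pluckerPair_update_one] using this)

theorem wedge_apply (x y : V) : wedge (K := K) x y = exteriorPower.ιMulti K 2 ![x, y] := rfl

theorem ιMulti_eq_wedge (v : Fin 2 → V) : exteriorPower.ιMulti K 2 v = wedge (K := K) (v 0) (v 1) := by
  rw [wedge_apply]; congr 1; ext i; fin_cases i <;> rfl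

@[simp] theorem wedge_self (x : V) : wedge (K := K) x x = 0 :=
  (exteriorPower.ιMulti K 2 (M := V)).map_eq_zero_of_eq ![x, x] (i := 0) (j := 1) rfl (by decide)

theorem wedge_swap (x y : V) : wedge (K := K) x y = -wedge y x := by
  have h := wedge_self (K := K) (x + y)
  simp only [map_add, LinearMap.add_apply, wedge_self, zero_add, add_zero] at h
  exact eq_neg_of_add_eq_zero_right h

/-- The alternating map attached to an alternating bilinear map. -/
def alternatingOfBilin {M : Type*} [AddCommGroup M] [Module K M] (β : V →ₗ[K] V →ₗ[K] M)
    (hβ : ∀ x, β x x = 0) : V [⋀^Fin 2]→ₗ[K] M where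
  toFun v := β (v 0) (v 1)
  map_update_add' v i x y := by
    fin_cases i <;> simp
  map_update_smul' v i c x := by
    fin_cases i <;> simp
  map_eq_zero_of_eq' v i j hij hne := by
    have : v 0 = v 1 := by
      fin_cases i <;> fin_cases j <;> simp_all
    change β (v 0) (v 1) = 0
    rw [this, hβ]

/-- The linear map on bivectors induced by an alternating bilinear map. -/
noncomputable def wedgeLift {M : Type*} [AddCommGroup M] [Module K M] (β : V →ₗ[K] V →ₗ[K] M)
    (hβ : ∀ x, β x x = 0) : ⋀[K]^2 V →ₗ[K] M :=
  exteriorPower.alternatingMapLinearEquiv (alternatingOfBilin β hβ)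

@[simp] theorem wedgeLift_wedge {M : Type*} [AddCommGroup M] [Module K M]
    (β : V →ₗ[K] V →ₗ[K] M) (hβ : ∀ x, β x x = 0) (x y : V) :
    wedgeLift β hβ (wedge x y) = β x y := by
  rw [wedgeLift, wedge_apply, exteriorPower.alternatingMapLinearEquiv_apply_ιMulti]
  rfl

/-- Every bivector is a sum of exterior products. -/
theorem wedge_addSubgroup_eq_top (T : AddSubgroup (⋀[K]^2 V))
    (hT : ∀ x y, wedge (K := K) x y ∈ T) (z : ⋀[K]^2 V) : z ∈ T := by
  have hz : z ∈ Submodule.span K (Set.range (exteriorPower.ιMulti K 2 (M := V))) := by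
    rw [exteriorPower.ιMulti_span]; trivial
  have : ∀ z ∈ Submodule.span K (Set.range (exteriorPower.ιMulti K 2 (M := V))),
      ∀ c : K, c • z ∈ T := by
    intro z hz
    induction hz using Submodule.span_induction with
    | mem x hx =>
      obtain ⟨v, rfl⟩ := hx
      intro c
      rw [ιMulti_eq_wedge, ← LinearMap.smul_apply, ← map_smul]
      exact hT _ _
    | zero => intro c; rw [smul_zero]; exact T.zero_mem
    | add x y _ _ hx hy => intro c; rw [smul_add]; exact T.add_mem (hx c) (hy c)
    | smul a x _ hx => intro c; rw [smul_smul]; exact hx _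
  simpa using this z hz 1

/-- Contraction of a bivector with a linear functional. -/
noncomputable def contract (φ : V →ₗ[K] K) : ⋀[K]^2 V →ₗ[K] V :=
  wedgeLift (LinearMap.mk₂ K (fun x y => φ x • y - φ y • x)
    (fun x x' y => by simp only [map_add, add_smul, smul_add]; abel)
    (fun c x y => by simp only [map_smul, smul_sub, smul_smul, smul_eq_mul, mul_comm])
    (fun x y y' => by simp only [map_add, add_smul, smul_add]; abel)
    (fun c x y => by simp only [map_smul, smul_sub, smul_smul, smul_eq_mul, mul_comm]))
    (fun x => by simp)

@[simp] theorem contract_wedge (φ : V →ₗ[K] K) (x y : V) :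
    contract φ (wedge x y) = φ x • y - φ y • x := by
  simp [contract]

theorem exists_functional_pair {x y : V} (h : LinearIndependent K ![x, y]) :
    ∃ φ : V →ₗ[K] K, φ x = 1 ∧ φ y = 0 := by
  have hx : x ∉ Submodule.span K {y} := by
    intro hx
    obtain ⟨a, rfl⟩ := Submodule.mem_span_singleton.1 hx
    have := LinearIndependent.pair_iff.1 h 1 (-a) (by simp)
    exact one_ne_zero this.1
  obtain ⟨φ, h1, h2⟩ := Submodule.exists_le_ker_of_notMem hx
  refine ⟨(φ x)⁻¹ • φ, by simp [h1], ?_⟩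
  have : φ y = 0 := h2 (Submodule.mem_span_singleton_self y)
  simp [this]

theorem LinearIndependent.pair_swap {x y : V} (h : LinearIndependent K ![x, y]) :
    LinearIndependent K ![y, x] := by
  rw [LinearIndependent.pair_iff] at h ⊢
  intro s t hst
  exact (h t s (by rw [add_comm]; exact hst)).symm

/-- Contraction with a functional that is 1 on x and 0 on y isolates y on one side and leaves a
combination of s and t on the other. -/
theorem mem_span_pair_of_wedge_eq {x y s t : V} (h : LinearIndependent K ![x, y])
    (he : wedge (K := K) x y = wedge s t) : y ∈ Submodule.span K {s, t} := by
  obtain ⟨φ, h1, h2⟩ := exists_functional_pair h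
  have := congrArg (contract φ) he
  rw [contract_wedge, contract_wedge, h1, h2, one_smul, zero_smul, sub_zero] at this
  rw [this, Submodule.mem_span_pair]
  exact ⟨-φ t, φ s, by rw [neg_smul]; abel⟩

theorem mem_span_pair_of_wedge_eq' {x y s t : V} (h : LinearIndependent K ![x, y])
    (he : wedge (K := K) x y = wedge s t) : x ∈ Submodule.span K {s, t} :=
  Set.pair_comm s t ▸ mem_span_pair_of_wedge_eq (s := t) (t := s) h.pair_swap
    (by rw [wedge_swap, he, ← wedge_swap])

theorem wedge_ne_zero_iff {x y : V} : wedge (K := K) x y ≠ 0 ↔ LinearIndependent K ![x, y] := by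
  constructor
  · intro h
    by_contra hl
    apply h
    by_cases hx : x = 0
    · rw [hx]; simp
    · obtain ⟨a, rfl⟩ : ∃ a : K, a • x = y := by
        by_contra! hne
        exact hl ((LinearIndependent.pair_iff' hx).2 hne)
      simp
  · intro h h0
    obtain ⟨φ, h1, h2⟩ := exists_functional_pair h
    have h3 := congrArg (contract φ) h0
    rw [contract_wedge, h1, h2, one_smul, zero_smul, sub_zero, map_zero] at h3
    have := LinearIndependent.pair_iff.1 h 0 1 (by simp [h3])
    exact one_ne_zero this.2

/-- A nonzero decomposable bivector can be written with any nonzero vector of its support as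
first factor. -/
theorem exists_wedge_eq_of_mem {s t p : V} (hp : p ≠ 0) (hps : p ∈ Submodule.span K {s, t}) :
    ∃ q ∈ Submodule.span K {s, t}, wedge (K := K) s t = wedge p q := by
  obtain ⟨a, b, rfl⟩ := Submodule.mem_span_pair.1 hps
  by_cases ha : a = 0
  · have hb : b ≠ 0 := by rintro rfl; simp [ha] at hp
    refine ⟨-(b⁻¹ • s), Submodule.neg_mem _ (Submodule.smul_mem _ _
      (Submodule.subset_span (by simp))), ?_⟩
    rw [wedge_swap]
    simp [ha, hb, smul_smul]
  · refine ⟨a⁻¹ • t, Submodule.smul_mem _ _ (Submodule.subset_span (by simp)), ?_⟩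
    simp [ha, smul_smul]

/-- Two factors of the same nonzero bivector. -/
theorem exists_smul_wedge {p q a b : V} (h : wedge (K := K) p a = wedge q b)
    (hpq : LinearIndependent K ![p, q]) : ∃ c : K, wedge (K := K) p a = c • wedge p q := by
  by_cases h0 : wedge (K := K) p a = 0
  · exact ⟨0, by rw [h0, zero_smul]⟩
  have hli := wedge_ne_zero_iff.1 (h ▸ h0)
  have hq := mem_span_pair_of_wedge_eq' hli h.symm
  obtain ⟨r, s, hrs⟩ := Submodule.mem_span_pair.1 hq
  have hs : s ≠ 0 := by
    rintro rfl
    have := LinearIndependent.pair_iff.1 hpq r (-1) (by rw [← hrs]; simp)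
    simp at this
  refine ⟨s⁻¹, ?_⟩
  rw [← hrs]
  simp [smul_smul, hs]

/-- If the sum of two nonzero decomposable bivectors is decomposable, their supports meet. -/
theorem exists_mem_inter_of_wedge_add {x y z w s t : V} (hxy : LinearIndependent K ![x, y])
    (hzw : LinearIndependent K ![z, w]) (h : wedge (K := K) x y + wedge z w = wedge s t) :
    ∃ p ≠ 0, p ∈ Submodule.span K {x, y} ∧ p ∈ Submodule.span K {z, w} := by
  by_contra! hne
  -- With disjoint supports, a functional killing y, z, w but not x contracts the sum to a multiple
  -- of y, which therefore lies in ⟨s, t⟩. By symmetry ⟨s, t⟩ would contain a four-dimensional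
  -- space.
  have key : ∀ x y z w : V, LinearIndependent K ![x, y] →
      (∀ p ≠ 0, p ∈ Submodule.span K {x, y} → p ∉ Submodule.span K {z, w}) →
      wedge (K := K) x y + wedge z w = wedge s t → y ∈ Submodule.span K {s, t} := by
    intro x y z w hxy hne h
    have hx : x ∉ Submodule.span K {y} ⊔ Submodule.span K {z, w} := by
      intro hx
      obtain ⟨u, hu, v, hv, huv⟩ := Submodule.mem_sup.1 hx
      obtain ⟨a, rfl⟩ := Submodule.mem_span_singleton.1 hu
      by_cases hv0 : v = 0
      · have := LinearIndependent.pair_iff.1 hxy 1 (-a) (by rw [← huv, hv0]; simp)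
        exact one_ne_zero this.1
      · refine hne v hv0 (Submodule.mem_span_pair.2 ⟨1, -a, ?_⟩) hv
        rw [← huv]; simp
    obtain ⟨φ, h1, h2⟩ := Submodule.exists_le_ker_of_notMem hx
    have hy : φ y = 0 := h2 (Submodule.mem_sup_left (Submodule.mem_span_singleton_self y))
    have hz : φ z = 0 := h2 (Submodule.mem_sup_right (Submodule.subset_span (by simp)))
    have hw : φ w = 0 := h2 (Submodule.mem_sup_right (Submodule.subset_span (by simp)))
    have h3 := congrArg (contract φ) h
    simp only [map_add, contract_wedge, hy, hz, hw, zero_smul, sub_zero, add_zero] at h3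
    have h4 : φ x • y ∈ Submodule.span K {s, t} := by
      rw [h3, Submodule.mem_span_pair]
      exact ⟨-φ t, φ s, by rw [neg_smul]; abel⟩
    exact (Submodule.smul_mem_iff _ h1).1 h4
  have hy := key x y z w hxy hne h
  -- Since x ∧ y = (-y) ∧ x, the same argument reaches x.
  have hx := key (-y) x z w (by
      rw [LinearIndependent.pair_iff] at hxy ⊢
      intro a b hab
      have := hxy b (-a) (by rw [← hab]; simp [add_comm])
      exact ⟨by simpa using this.2, this.1⟩)
    (fun p hp hp1 => hne p hp (by
      obtain ⟨a, b, rfl⟩ := Submodule.mem_span_pair.1 hp1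
      exact Submodule.mem_span_pair.2 ⟨b, -a, by simp [add_comm]⟩))
    (by rw [← h, map_neg, LinearMap.neg_apply, ← wedge_swap])
  have hw := key z w x y hzw (fun p hp h1 h2 => hne p hp h2 h1) (by rw [← h, add_comm])
  have hz := key (-w) z x y (by
      rw [LinearIndependent.pair_iff] at hzw ⊢
      intro a b hab
      have := hzw b (-a) (by rw [← hab]; simp [add_comm])
      exact ⟨by simpa using this.2, this.1⟩)
    (fun p hp hp1 hp2 => hne p hp hp2 (by
      obtain ⟨a, b, rfl⟩ := Submodule.mem_span_pair.1 hp1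
      exact Submodule.mem_span_pair.2 ⟨b, -a, by simp [add_comm]⟩))
    (by rw [← h, map_neg, LinearMap.neg_apply, ← wedge_swap, add_comm])
  have hle : Submodule.span K {x, y} ⊔ Submodule.span K {z, w} ≤ Submodule.span K {s, t} := by
    refine sup_le ?_ ?_ <;> rw [Submodule.span_le] <;> rintro u (rfl | rfl) <;> assumption
  have hinf : Submodule.span K {x, y} ⊓ Submodule.span K {z, w} = ⊥ := by
    rw [Submodule.eq_bot_iff]
    rintro p ⟨h1, h2⟩
    by_contra hp
    exact hne p hp h1 h2
  have hfin : ∀ a b : V, FiniteDimensional K (Submodule.span K {a, b}) := fun a b =>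
    FiniteDimensional.span_of_finite K (Set.toFinite _)
  have hdim : ∀ {a b : V}, LinearIndependent K ![a, b] →
      Module.finrank K (Submodule.span K {a, b}) = 2 := by
    intro a b hab
    have := finrank_span_eq_card hab
    rw [range_pair] at this
    simpa using this
  have h1 := Submodule.finrank_sup_add_finrank_inf_eq (Submodule.span K {x, y})
    (Submodule.span K {z, w})
  rw [hinf, finrank_bot, hdim hxy, hdim hzw] at h1
  have h2 := Submodule.finrank_mono hle
  have h3 : Module.finrank K (Submodule.span K {s, t}) ≤ 2 := by
    have := finrank_range_le_card (R := K) ![s, t]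
    rw [Set.finrank, range_pair] at this
    simpa using this
  omega

/-! ### Semilinear maps and bivectors -/

/-- `M` with the scalars acting through `τ`. -/
def Twisted (_τ : K →+* K) (M : Type*) := M

instance (τ : K →+* K) (M : Type*) [AddCommGroup M] : AddCommGroup (Twisted τ M) :=
  inferInstanceAs (AddCommGroup M)

instance (τ : K →+* K) (M : Type*) [AddCommGroup M] [Module K M] : Module K (Twisted τ M) :=
  Module.compHom M τ

/-- A τ-semilinear map is linear into the module twisted by τ, so the universal property of the
exterior square applies. -/
theorem exists_wedge_semilinear {τ : K →+* K} {h : V → V} (hadd : ∀ x y, h (x + y) = h x + h y)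
    (hsmul : ∀ (c : K) x, h (c • x) = τ c • h x) :
    ∃ g : ⋀[K]^2 V → ⋀[K]^2 V, (∀ x y, g (x + y) = g x + g y) ∧
      (∀ (c : K) x, g (c • x) = τ c • g x) ∧ ∀ x y, g (wedge x y) = wedge (h x) (h y) := by
  let β : V →ₗ[K] V →ₗ[K] Twisted τ (⋀[K]^2 V) := LinearMap.mk₂ K
    (fun x y => (wedge (h x) (h y) : ⋀[K]^2 V))
    (fun x x' y => by rw [hadd, map_add]; rfl)
    (fun c x y => by rw [hsmul, map_smul]; rfl)
    (fun x y y' => by rw [hadd, map_add]; rfl)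
    (fun c x y => by rw [hsmul, map_smul]; rfl)
  let G := wedgeLift β (fun x => wedge_self (K := K) (h x))
  exact ⟨G, fun x y => map_add G x y, fun c x => map_smul G c x,
    fun x y => wedgeLift_wedge β _ x y⟩

theorem eq_of_eq_on_wedge {f g : ⋀[K]^2 V → ⋀[K]^2 V} (hf : ∀ x y, f (x + y) = f x + f y)
    (hg : ∀ x y, g (x + y) = g x + g y) (h : ∀ x y, f (wedge x y) = g (wedge x y))
    (z : ⋀[K]^2 V) : f z = g z := by
  let T := AddMonoidHom.eqLocus (AddMonoidHom.mk' f hf) (AddMonoidHom.mk' g hg)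
  exact wedge_addSubgroup_eq_top T h z

theorem IsSemilinearWith.exists_wedge {τ : K ≃+* K} {h : Equiv.Perm V}
    (hh : IsSemilinearWith τ h) : ∃ g : Equiv.Perm (⋀[K]^2 V), IsSemilinearWith τ g ∧
      ∀ x y, g (wedge x y) = wedge (h x) (h y) := by
  obtain ⟨g, hg1, hg2, hg3⟩ := exists_wedge_semilinear (τ := (τ : K →+* K)) hh.1 hh.2
  obtain ⟨k, hk1, hk2, hk3⟩ := exists_wedge_semilinear (τ := ((τ⁻¹ : K ≃+* K) : K →+* K))
    hh.inv.1 hh.inv.2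
  refine ⟨⟨g, k, fun z => ?_, fun z => ?_⟩, ⟨hg1, hg2⟩, hg3⟩
  · exact eq_of_eq_on_wedge (f := fun z => k (g z)) (g := id) (fun x y => by rw [hg1, hk1])
      (fun _ _ => rfl) (fun x y => by rw [hg3, hk3]; simp) z
  · exact eq_of_eq_on_wedge (f := fun z => g (k z)) (g := id) (fun x y => by rw [hk1, hg1])
      (fun _ _ => rfl) (fun x y => by rw [hk3, hg3]; simp) z

end Wedge

/-! ### Isotropic bivectors -/

section Isotropic

variable {K V : Type*} [Field K] [AddCommGroup V] [Module K V] {σ : K →+* K}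

/-- The bivectors `x ∧ y ≠ 0` of the totally isotropic lines `⟨x, y⟩`. -/
def IsIsotropicBivector (η : V →ₛₗ[σ] V →ₗ[K] K) (z : ⋀[K]^2 V) : Prop :=
  ∃ x y, LinearIndependent K ![x, y] ∧ η x x = 0 ∧ η y y = 0 ∧ η x y = 0 ∧ z = wedge x y

variable {η : V →ₛₗ[σ] V →ₗ[K] K}

theorem IsIsotropicBivector.ne_zero {z : ⋀[K]^2 V} (h : IsIsotropicBivector η z) : z ≠ 0 := by
  obtain ⟨x, y, hl, -, -, -, rfl⟩ := h
  exact wedge_ne_zero_iff.2 hl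

theorem IsIsotropicBivector.smul {z : ⋀[K]^2 V} (h : IsIsotropicBivector η z) {c : K}
    (hc : c ≠ 0) : IsIsotropicBivector η (c • z) := by
  obtain ⟨x, y, hl, hxx, hyy, hxy, rfl⟩ := h
  refine ⟨c • x, y, ?_, by simp [hxx], hyy, by simp [hxy], by simp⟩
  rw [← wedge_ne_zero_iff] at hl ⊢
  simpa [hc] using hl

theorem eta_eq_zero_of_mem_span (hη : η.IsSymm) {x y p q : V} (hxx : η x x = 0) (hyy : η y y = 0)
    (hxy : η x y = 0) (hp : p ∈ Submodule.span K {x, y}) (hq : q ∈ Submodule.span K {x, y}) :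
    η p q = 0 := by
  obtain ⟨a, b, rfl⟩ := Submodule.mem_span_pair.1 hp
  obtain ⟨c, d, rfl⟩ := Submodule.mem_span_pair.1 hq
  have hyx : η y x = 0 := hη.eq_iff.1 hxy
  simp [hxx, hyy, hxy, hyx]

/-- A nonzero decomposable bivector determines its support, so isotropy does not depend on the
factorisation. -/
theorem isIsotropicBivector_wedge (hη : η.IsSymm) {p q : V} :
    IsIsotropicBivector η (wedge p q) ↔
      LinearIndependent K ![p, q] ∧ η p p = 0 ∧ η q q = 0 ∧ η p q = 0 := by
  refine ⟨fun h => ?_, fun ⟨h1, h2, h3, h4⟩ => ⟨p, q, h1, h2, h3, h4, rfl⟩⟩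
  have hl := wedge_ne_zero_iff.1 h.ne_zero
  obtain ⟨x, y, -, hxx, hyy, hxy, he⟩ := h
  have hq := mem_span_pair_of_wedge_eq hl he
  have hp := mem_span_pair_of_wedge_eq' hl he
  exact ⟨hl, eta_eq_zero_of_mem_span hη hxx hyy hxy hp hp,
    eta_eq_zero_of_mem_span hη hxx hyy hxy hq hq, eta_eq_zero_of_mem_span hη hxx hyy hxy hp hq⟩

theorem mk_mem_pluckerImage_iff (hη : η.IsSymm) {z : ⋀[K]^2 V} (hz : z ≠ 0) :
    Projectivization.mk K z hz ∈ pluckerImage η 2 ↔ IsIsotropicBivector η z := by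
  constructor
  · rintro ⟨X, ⟨hX, hiso⟩, v, hv, hP⟩
    rw [Projectivization.submodule_mk, ιMulti_eq_wedge] at hP
    have hr : Set.range v = {v 0, v 1} := by
      ext x; simp [Set.mem_range, Fin.exists_fin_two, eq_comm]
    have h0 : v 0 ∈ X := hv ▸ Submodule.subset_span ⟨0, rfl⟩
    have h1 : v 1 ∈ X := hv ▸ Submodule.subset_span ⟨1, rfl⟩
    have hzm : z ∈ Submodule.span K {wedge (K := K) (v 0) (v 1)} :=
      hP ▸ Submodule.mem_span_singleton_self z
    obtain ⟨c, rfl⟩ := Submodule.mem_span_singleton.1 hzm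
    have hc : c ≠ 0 := by rintro rfl; simp at hz
    have hw : wedge (K := K) (v 0) (v 1) ≠ 0 := by intro h; simp [h] at hz
    exact IsIsotropicBivector.smul ((isIsotropicBivector_wedge hη).2
      ⟨wedge_ne_zero_iff.1 hw, hiso _ h0 _ h0, hiso _ h1 _ h1, hiso _ h0 _ h1⟩) hc
  · rintro ⟨x, y, hl, hxx, hyy, hxy, rfl⟩
    refine ⟨Submodule.span K {x, y}, ⟨?_, fun p hp q hq =>
      eta_eq_zero_of_mem_span hη hxx hyy hxy hp hq⟩, ![x, y], by rw [range_pair], ?_⟩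
    · have := finrank_span_eq_card hl
      rw [range_pair] at this
      simpa using this
    · rw [Projectivization.submodule_mk]; rfl

end Isotropic

/-! ### Collineations of the bivectors that preserve the isotropic lines -/

section Reconstruction

variable {K V : Type*} [Field K] [AddCommGroup V] [Module K V] {σ : K →+* K}
  {η : V →ₛₗ[σ] V →ₗ[K] K}

theorem IsHypPair.frame_induction {e f : V} (h : IsHypPair η e f) (T : Submodule K V)
    (he : e ∈ T) (hf : f ∈ T) (hW : ∀ w, η e w = 0 → η f w = 0 → w ∈ T) (x : V) : x ∈ T := by
  have hw := h.sub_mem (S := ⊤) trivial trivial (x := x) trivial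
  obtain ⟨-, h1, h2⟩ := mem_hypPerp.1 hw
  have hx : x = (x - η f x • e - η e x • f) + η f x • e + η e x • f := by abel
  rw [hx]
  exact T.add_mem (T.add_mem (hW _ h1 h2) (T.smul_mem _ he)) (T.smul_mem _ hf)

/-- A linear map of the bivectors that maps the star `p ∧ pᗮ` of every isotropic `p` into a star
and fixes `e ∧ w` and `f ∧ w` for all `w` orthogonal to the hyperbolic pair `e`, `f`. -/
structure FixesFrame (η : V →ₛₗ[σ] V →ₗ[K] K) (e f : V) (G : ⋀[K]^2 V →ₗ[K] ⋀[K]^2 V) :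
    Prop where
  pair : IsHypPair η e f
  inj : ∀ z, G z = 0 → z = 0
  star : ∀ p, p ≠ 0 → η p p = 0 → ∃ p' ≠ 0, ∀ u, η p u = 0 → ∃ u', G (wedge p u) = wedge p' u'
  fix_left : ∀ w, η e w = 0 → η f w = 0 → G (wedge e w) = wedge e w
  fix_right : ∀ w, η e w = 0 → η f w = 0 → G (wedge f w) = wedge f w

theorem FixesFrame.symm {e f : V} {G : ⋀[K]^2 V →ₗ[K] ⋀[K]^2 V} (h : FixesFrame η e f G) :
    FixesFrame η f e G :=
  ⟨h.pair.symm, h.inj, h.star, fun w h1 h2 => h.fix_right w h2 h1,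
    fun w h1 h2 => h.fix_left w h2 h1⟩

theorem linearIndependent_pair_of_perp {e f w : V} (h : η f e ≠ 0) (hw : η f w = 0)
    (hw0 : w ≠ 0) : LinearIndependent K ![e, w] := by
  rw [LinearIndependent.pair_iff]
  intro s t hst
  have hs : s = 0 := by
    have := congrArg (η f) hst
    simpa [hw, h] using this
  subst hs
  exact ⟨rfl, by simpa [hw0] using hst⟩

theorem LinearIndependent.left_ne_zero {x y : V} (h : LinearIndependent K ![x, y]) : x ≠ 0 := by
  rintro rfl
  have := LinearIndependent.pair_iff.1 h 1 0 (by simp)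
  exact one_ne_zero this.1

namespace FixesFrame

variable (hη : η.IsSymm) {e f : V} {G : ⋀[K]^2 V →ₗ[K] ⋀[K]^2 V}
  (h : FixesFrame η e f G)
include h hη

/-- The centre of the image star lies in the supports of the fixed bivectors w ∧ e and w ∧ f, and
these planes meet in ⟨w⟩. -/
theorem star_self {w : V} (hew : η e w = 0) (hfw : η f w = 0) (hw0 : w ≠ 0) (hww : η w w = 0) :
    ∀ u, η w u = 0 → ∃ u', G (wedge w u) = wedge w u' := by
  obtain ⟨w', hw', hs⟩ := h.star w hw0 hww
  obtain ⟨a, ha⟩ := hs e (hη.eq_iff.1 hew)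
  obtain ⟨b, hb⟩ := hs f (hη.eq_iff.1 hfw)
  rw [wedge_swap, map_neg, h.fix_left w hew hfw, ← wedge_swap] at ha
  rw [wedge_swap, map_neg, h.fix_right w hew hfw, ← wedge_swap] at hb
  have hle : LinearIndependent K ![w, e] :=
    (linearIndependent_pair_of_perp (by simp [h.pair.fe]) hfw hw0).pair_swap
  have hlf : LinearIndependent K ![w, f] :=
    (linearIndependent_pair_of_perp (by simp [h.pair.ef]) hew hw0).pair_swap
  have h1 := mem_span_pair_of_wedge_eq' (wedge_ne_zero_iff.1 (ha ▸ wedge_ne_zero_iff.2 hle)) ha.symm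
  have h2 := mem_span_pair_of_wedge_eq' (wedge_ne_zero_iff.1 (hb ▸ wedge_ne_zero_iff.2 hlf)) hb.symm
  obtain ⟨r, s, hrs⟩ := Submodule.mem_span_pair.1 h1
  obtain ⟨r', s', hrs'⟩ := Submodule.mem_span_pair.1 h2
  have hs0 : s = 0 := by
    have := congrArg (η f) (hrs.trans hrs'.symm)
    simpa [hfw, h.pair.fe, h.pair.ff] using this
  rw [hs0, zero_smul, add_zero] at hrs
  intro u hu
  obtain ⟨u', hu'⟩ := hs u hu
  exact ⟨r • u', by rw [hu', ← hrs]; simp⟩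

/-- As e ∧ w is fixed, the star at e + w goes to a star with some centre αe + βw. For an isotropic u
in the complement orthogonal to w, `star_self` at w and at u gives G(w ∧ u) = l w ∧ u. The support
of (e + l w) ∧ u contains that centre, so l = β/α whatever u is; one such u is needed to know that α
≠ 0. -/
theorem exists_factor [FiniteDimensional K V] {w : V} (hew : η e w = 0) (hfw : η f w = 0)
    (hw0 : w ≠ 0) (hww : η w w = 0)
    (hex : ∃ u, η e u = 0 ∧ η f u = 0 ∧ η u u = 0 ∧ η w u = 0 ∧ LinearIndependent K ![w, u]) :
    ∃ s : K, (∀ u, η e u = 0 → η f u = 0 → η u u = 0 → η w u = 0 → LinearIndependent K ![w, u] →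
      G (wedge w u) = s • wedge w u) ∧
      ∀ u, η (e + w) u = 0 → ∃ u', G (wedge (e + w) u) = wedge (e + s • w) u' := by
  have hp0 : e + w ≠ 0 := by
    intro h0
    have := congrArg (η f) h0
    simp [h.pair.fe, hfw] at this
  have hwe : η w e = 0 := hη.eq_iff.1 hew
  have hpp : η (e + w) (e + w) = 0 := by simp [h.pair.ee, hww, hew, hwe]
  obtain ⟨p', hp', hs⟩ := h.star _ hp0 hpp
  have hlew : LinearIndependent K ![e, w] :=
    linearIndependent_pair_of_perp (by simp [h.pair.fe]) hfw hw0
  obtain ⟨a, ha⟩ := hs w (by simp [hew, hww])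
  rw [map_add, LinearMap.add_apply, wedge_self, add_zero, h.fix_left w hew hfw] at ha
  have h1 := mem_span_pair_of_wedge_eq' (wedge_ne_zero_iff.1 (ha ▸ wedge_ne_zero_iff.2 hlew)) ha.symm
  obtain ⟨α, β, hαβ⟩ := Submodule.mem_span_pair.1 h1
  have key : ∀ u, η e u = 0 → η f u = 0 → η u u = 0 → η w u = 0 → LinearIndependent K ![w, u] →
      α ≠ 0 ∧ G (wedge w u) = (β / α) • wedge w u := by
    intro u heu hfu huu hwu hli
    have hu0 : u ≠ 0 := hli.pair_swap.left_ne_zero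
    obtain ⟨b, hb⟩ := h.star_self hη hew hfw hw0 hww u hwu
    obtain ⟨c, hc⟩ := h.star_self hη heu hfu hu0 huu w (hη.eq_iff.1 hwu)
    rw [wedge_swap, map_neg, neg_eq_iff_eq_neg] at hc
    obtain ⟨l, hl⟩ := exists_smul_wedge (q := u) (b := -c)
      (show wedge (K := K) w b = wedge u (-c) by rw [← hb, hc, map_neg]) hli
    rw [← hb] at hl
    obtain ⟨u', hu'⟩ := hs u (by simp [heu, hwu])
    rw [map_add, LinearMap.add_apply, map_add, h.fix_left u heu hfu, hl,
      ← LinearMap.smul_apply, ← map_smul, ← LinearMap.add_apply, ← map_add] at hu'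
    have hli' : LinearIndependent K ![e + l • w, u] :=
      linearIndependent_pair_of_perp (f := f) (by simp [h.pair.fe, hfw]) hfu hu0
    have h2 := mem_span_pair_of_wedge_eq'
      (wedge_ne_zero_iff.1 (hu' ▸ wedge_ne_zero_iff.2 hli')) hu'.symm
    obtain ⟨r, s, hrs⟩ := Submodule.mem_span_pair.1 h2
    have hr : r = α := by
      have := congrArg (η f) (hrs.trans hαβ.symm)
      simpa [hfw, h.pair.fe, hfu] using this
    subst hr
    have h3 := LinearIndependent.pair_iff.1 hli (r * l - β) s (by
      have := hrs.trans hαβ.symm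
      rw [smul_add, smul_smul, add_assoc, add_right_inj] at this
      rw [sub_smul, sub_add_eq_add_sub, this, sub_self])
    have hr0 : r ≠ 0 := by
      rintro rfl
      have : β = 0 := by have := h3.1; simpa using this.symm
      exact hp' (by rw [← hαβ, this]; simp)
    refine ⟨hr0, ?_⟩
    rw [hl, ← sub_eq_zero.1 h3.1, mul_div_cancel_left₀ _ hr0]
  obtain ⟨u₀, q1, q2, q3, q4, q5⟩ := hex
  have hα : α ≠ 0 := (key u₀ q1 q2 q3 q4 q5).1
  refine ⟨β / α, fun u q1 q2 q3 q4 q5 => (key u q1 q2 q3 q4 q5).2, fun u hu => ?_⟩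
  obtain ⟨u', hu'⟩ := hs u hu
  refine ⟨α • u', ?_⟩
  have : p' = α • (e + (β / α) • w) := by
    rw [smul_add, smul_smul, mul_div_cancel₀ _ hα, hαβ]
  rw [hu', this]
  simp

end FixesFrame

/-- A linear map fixing a frame acts as a scalar `l` on the bivectors orthogonal to the frame and
as `l⁻¹` on the bivector of the frame. -/
theorem FixesFrame.exists_scalar [FiniteDimensional K V] (hσ : IsUnitaryInvolution σ)
    (hη : η.IsSymm) (hnd : NondegOn η ⊤) (h6 : 6 ≤ Module.finrank K V) {e f : V}
    {G : ⋀[K]^2 V →ₗ[K] ⋀[K]^2 V} (h : FixesFrame η e f G) :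
    ∃ l : K, l ≠ 0 ∧ (∀ w u, η e w = 0 → η f w = 0 → η e u = 0 → η f u = 0 →
      G (wedge w u) = l • wedge w u) ∧ G (wedge e f) = l⁻¹ • wedge e f := by
  have hS : NondegOn η (hypPerp η ⊤ e f) := h.pair.nondegOn hη trivial trivial hnd
  have hS4 : 4 ≤ Module.finrank K (hypPerp η ⊤ e f) := by
    have := finrank_le_hypPerp η ⊤ e f
    rw [finrank_top] at this
    omega
  have hmem : ∀ {x}, x ∈ hypPerp η ⊤ e f ↔ η e x = 0 ∧ η f x = 0 := by
    intro x; simp [mem_hypPerp]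
  have hex : ∀ w, η e w = 0 → η f w = 0 → w ≠ 0 → η w w = 0 →
      ∃ u, η e u = 0 ∧ η f u = 0 ∧ η u u = 0 ∧ η w u = 0 ∧ LinearIndependent K ![w, u] := by
    intro w hew hfw hw0 hww
    obtain ⟨v, hv, hwv⟩ := hS.exists_hypPair hσ hη (hmem.2 ⟨hew, hfw⟩) hw0 hww
    obtain ⟨u, hu, huu, hwu, -, hli, -⟩ := exists_common_isotropic hσ hη hS4 hwv.ee hwv.ff
      (by simp [hwv.ef])
    exact ⟨u, (hmem.1 hu).1, (hmem.1 hu).2, huu, hwu, hli⟩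
  choose! s hs hs' using fun w hew hfw hw0 hww =>
    h.exists_factor hη (w := w) hew hfw hw0 hww (hex w hew hfw hw0 hww)
  choose! t ht ht' using fun w hew hfw hw0 hww =>
    h.symm.exists_factor hη (w := w) hfw hew hw0 hww (by
      obtain ⟨u, h1, h2, h3⟩ := hex w hew hfw hw0 hww
      exact ⟨u, h2, h1, h3⟩)
  -- Both factors are read off the same bivector w ∧ u, so the frame vectors e and f yield the same
  -- one.
  have hst : ∀ w, η e w = 0 → η f w = 0 → w ≠ 0 → η w w = 0 → t w = s w := by
    intro w hew hfw hw0 hww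
    obtain ⟨u, h1, h2, h3, h4, h5⟩ := hex w hew hfw hw0 hww
    have := (ht w hew hfw hw0 hww u h2 h1 h3 h4 h5).symm.trans
      (hs w hew hfw hw0 hww u h1 h2 h3 h4 h5)
    exact smul_left_injective K (wedge_ne_zero_iff.2 h5) this
  obtain ⟨w, hw, v, hv, hwv⟩ := hS.exists_pair hσ hη (by omega)
  obtain ⟨hew, hfw⟩ := hmem.1 hw
  obtain ⟨hev, hfv⟩ := hmem.1 hv
  -- On an isotropic line ⟨x, y⟩ the factors of x and y belong to the same bivector, and such lines
  -- connect all isotropic vectors of the complement.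
  have hconst : ∀ x, η e x = 0 → η f x = 0 → x ≠ 0 → η x x = 0 → s x = s w := by
    intro x hex' hfx hx0 hxx
    refine hS.rel_of_line hσ hη hS4 s ?_ (hmem.2 ⟨hex', hfx⟩) hw hxx hwv.ee hx0 hwv.ne_zero
    intro x hx y hy hxx hyy hxy hli
    obtain ⟨hex, hfx⟩ := hmem.1 hx
    obtain ⟨hey, hfy⟩ := hmem.1 hy
    have h1 := hs x hex hfx hli.left_ne_zero hxx y hey hfy hyy hxy hli
    have h2 := hs y hey hfy hli.pair_swap.left_ne_zero hyy x hex hfx hxx (hη.eq_iff.1 hxy)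
      hli.pair_swap
    rw [wedge_swap, map_neg, smul_neg, neg_inj] at h2
    exact smul_left_injective K (wedge_ne_zero_iff.2 hli) (h1.symm.trans h2)
  set l := s w with hl
  have hscal : ∀ x y, η e x = 0 → η f x = 0 → η e y = 0 → η f y = 0 →
      G (wedge x y) = l • wedge x y := by
    intro x y hex hfx hey hfy
    have := hS.alternating_eq_zero hσ hη hS4 (wedge.compr₂ (G - l • LinearMap.id)) (by simp)
      (fun x hx y hy hxx hyy hxy => by
        obtain ⟨hex, hfx⟩ := hmem.1 hx
        obtain ⟨hey, hfy⟩ := hmem.1 hy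
        by_cases hli : LinearIndependent K ![x, y]
        · have h1 := hs x hex hfx hli.left_ne_zero hxx y hey hfy hyy hxy hli
          rw [hconst x hex hfx hli.left_ne_zero hxx] at h1
          simp [h1]
        · have : wedge (K := K) x y = 0 := by
            by_contra h0
            exact hli (wedge_ne_zero_iff.1 h0)
          simp [this]) (hmem.2 ⟨hex, hfx⟩) (hmem.2 ⟨hey, hfy⟩)
    simpa [sub_eq_zero] using this
  have hwe : η w e = 0 := hη.eq_iff.1 hew
  have hwf : η w f = 0 := hη.eq_iff.1 hfw
  have hve : η v e = 0 := hη.eq_iff.1 hev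
  have hvf : η v f = 0 := hη.eq_iff.1 hfv
  have hliwv : LinearIndependent K ![w, v] :=
    linearIndependent_pair_of_perp (f := v) (by simp [hwv.fe]) hwv.ff hwv.ne_zero'
  have hl0 : l ≠ 0 := by
    intro h0
    have h1 := hscal w v hew hfw hev hfv
    rw [h0, zero_smul] at h1
    exact wedge_ne_zero_iff.2 hliwv (h.inj _ h1)
  -- the image of the isotropic line through `e + a w` and `f - σ(a)⁻¹ v`
  have key : ∀ a : K, a ≠ 0 → ∃ k : K, G (wedge e f) = k • wedge e f +
      (k * l - 1) • (-(σ a)⁻¹ • wedge e v + a • wedge w f) -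
      (l * (k * l - 1) * a * (σ a)⁻¹) • wedge w v := by
    intro a ha
    have ha' : σ a ≠ 0 := (map_ne_zero σ).2 ha
    set b : K := -(σ a)⁻¹ with hb
    have hb0 : b ≠ 0 := by simp [hb, ha]
    have haw : a • w ≠ 0 := by simp [ha, hwv.ne_zero]
    have hbv : b • v ≠ 0 := by simp [hb0, hwv.ne_zero']
    -- The value b = -σ(a)⁻¹ makes e + a w and f + b v orthogonal. Their bivector lies in two stars
    -- whose images have centres e + l a w and f + l b v, so its image is a multiple of the bivector
    -- of these centres.
    have h1 := hs' (a • w) (by simp [hew]) (by simp [hfw]) haw (by simp [hwv.ee])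
      (f + b • v) (by simp [h.pair.ef, hev, hwf, hwv.ef, hb, ha'])
    have h2 := ht' (b • v) (by simp [hev]) (by simp [hfv]) hbv (by simp [hwv.ff])
      (e + a • w) (by simp [h.pair.fe, hfw, hve, hwv.fe, hb, ha, hσ.invol])
    rw [hconst _ (by simp [hew]) (by simp [hfw]) haw (by simp [hwv.ee])] at h1
    rw [hst _ (by simp [hev]) (by simp [hfv]) hbv (by simp [hwv.ff]),
      hconst _ (by simp [hev]) (by simp [hfv]) hbv (by simp [hwv.ff])] at h2
    obtain ⟨c, hc⟩ := h1
    obtain ⟨d, hd⟩ := h2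
    rw [wedge_swap, map_neg, neg_eq_iff_eq_neg] at hd
    have hli : LinearIndependent K ![e + l • a • w, f + l • b • v] := by
      rw [LinearIndependent.pair_iff]
      intro x y hxy
      have h3 := congrArg (η f) hxy
      have h4 := congrArg (η e) hxy
      simp [h.pair.fe, h.pair.ff, hfw, hfv] at h3
      simp [h.pair.ee, h.pair.ef, hew, hev] at h4
      exact ⟨h3, h4⟩
    obtain ⟨k, hk⟩ := exists_smul_wedge (b := -d)
      (show wedge (K := K) (e + l • a • w) c = wedge (f + l • b • v) (-d) by
        rw [← hc, hd, map_neg]) hli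
    refine ⟨k, ?_⟩
    rw [← hc] at hk
    simp only [map_add, LinearMap.add_apply, map_smul, LinearMap.smul_apply,
      h.fix_left v hev hfv, hscal w v hew hfw hev hfv] at hk
    have h5 : G (wedge w f) = wedge w f := by
      rw [wedge_swap, map_neg, h.fix_right w hew hfw]
    rw [h5] at hk
    have h6 : (σ a)⁻¹ = -b := by simp [hb]
    rw [h6]
    have h7 : G (wedge e f) = k • (wedge e f + l • a • wedge w f + l • b • (wedge e v +
      l • a • wedge w v)) - (a • wedge w f + b • (wedge e v + a • l • wedge w v)) := by
      rw [← hk]; abel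
    rw [h7]
    module
  obtain ⟨z, hz⟩ := hσ.exists_ne
  have hz0 : z ≠ 0 := by rintro rfl; simp at hz
  obtain ⟨k, hk⟩ := key 1 one_ne_zero
  obtain ⟨k', hk'⟩ := key z hz0
  -- Contraction with η f keeps only the coefficients of e ∧ f and e ∧ v. The first shows that k is
  -- the same for a = 1 and a = z; the second, (k l - 1) σ(a)⁻¹ up to sign, then forces k l = 1.
  have h1 := congrArg (contract (η f)) hk
  have h2 := congrArg (contract (η f)) hk'
  simp only [map_add, map_sub, map_smul, contract_wedge, h.pair.fe, h.pair.ff, hfv, hfw, one_smul,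
    zero_smul, sub_zero, smul_zero, add_zero] at h1 h2
  have h3 := h1.symm.trans h2
  have hkk : k = k' := by
    have := congrArg (η e) h3
    simpa [h.pair.ef, hev] using this
  subst hkk
  have h4 : (k * l - 1) * (1 - (σ z)⁻¹) = 0 := by
    have := congrArg (η w) h3
    simp [hwf, hwv.ef] at this
    linear_combination -this
  have hkl : k * l - 1 = 0 := by
    refine (mul_eq_zero.1 h4).resolve_right fun h5 => hz ?_
    have h6 : σ z = 1 := inv_eq_one.1 (sub_eq_zero.1 h5).symm
    have h7 := congrArg σ h6
    rw [hσ.invol, map_one] at h7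
    rw [h6, h7]
  refine ⟨l, hl0, fun w u a b c d => hscal w u a b c d, ?_⟩
  rw [hk, hkl]
  have : k = l⁻¹ := eq_inv_of_mul_eq_one_left (sub_eq_zero.1 hkl)
  simp [this]

end Reconstruction

/-! ### Images of the stars of isotropic points -/

section Stars

variable {K V : Type*} [Field K] [AddCommGroup V] [Module K V] {σ : K →+* K}

theorem perm_inv_apply {M : Type*} (f : Equiv.Perm M) (x : M) : f⁻¹ (f x) = x :=
  f.symm_apply_apply x

theorem IsSemilinearWith.map_zero {M : Type*} [AddCommGroup M] [Module K M] {τ : K ≃+* K}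
    {g : Equiv.Perm M} (hg : IsSemilinearWith τ g) : g 0 = 0 := by
  have := hg.2 0 0
  simpa using this

theorem IsSemilinearWith.map_neg {M : Type*} [AddCommGroup M] [Module K M] {τ : K ≃+* K}
    {g : Equiv.Perm M} (hg : IsSemilinearWith τ g) (x : M) : g (-x) = -g x := by
  have := hg.2 (-1) x
  simpa using this

/-- `g` is a semilinear bijection of the bivectors that preserves the totally isotropic lines. -/
structure PreservesIsotropic (η : V →ₛₗ[σ] V →ₗ[K] K) (τ : K ≃+* K)
    (g : Equiv.Perm (⋀[K]^2 V)) : Prop where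
  semilin : IsSemilinearWith τ g
  iff : ∀ z, IsIsotropicBivector η (g z) ↔ IsIsotropicBivector η z

/-- `g` maps the bivectors `p ∧ u`, `u ∈ pᗮ`, to bivectors of the same kind at `p'`. -/
structure MapsStar (η : V →ₛₗ[σ] V →ₗ[K] K) (g : Equiv.Perm (⋀[K]^2 V)) (p p' : V) : Prop where
  ne_zero : p' ≠ 0
  isotropic : η p' p' = 0
  exists_eq : ∀ u, η p u = 0 → ∃ u', η p' u' = 0 ∧ g (wedge p u) = wedge p' u'

variable {η : V →ₛₗ[σ] V →ₗ[K] K} {τ : K ≃+* K} {g : Equiv.Perm (⋀[K]^2 V)}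

theorem MapsStar.smul {p p' : V} (h : MapsStar η g p p') {c : K} (hc : c ≠ 0) :
    MapsStar η g p (c • p') := by
  refine ⟨by simp [hc, h.ne_zero], by simp [h.isotropic], fun u hu => ?_⟩
  obtain ⟨u', h1, h2⟩ := h.exists_eq u hu
  exact ⟨c⁻¹ • u', by simp [h1], by simp [h2, smul_smul, hc]⟩

theorem PreservesIsotropic.inv (h : PreservesIsotropic η τ g) : PreservesIsotropic η τ⁻¹ g⁻¹ :=
  ⟨h.semilin.inv, fun z => by rw [← h.iff, perm_apply_inv]⟩

namespace PreservesIsotropic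

variable (h : PreservesIsotropic η τ g) (hη : η.IsSymm) (hσ : IsUnitaryInvolution σ)
include h hη hσ

/-- The images of two isotropic lines through a common point meet. -/
theorem exists_mem_inter {p u t : V} (hpp : η p p = 0) (hpu : η p u = 0) (hpt : η p t = 0)
    (huu : η u u = 0) (htt : η t t = 0) (hu : LinearIndependent K ![p, u])
    (ht : LinearIndependent K ![p, t]) {a b c d : V} (h1 : g (wedge p u) = wedge a b)
    (h2 : g (wedge p t) = wedge c d) :
    ∃ q ≠ 0, q ∈ Submodule.span K {a, b} ∧ q ∈ Submodule.span K {c, d} := by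
  -- The choice of r makes u + r t isotropic: r η(u, t) has to be skew.
  obtain ⟨r, hr0, hr⟩ : ∃ r : K, r ≠ 0 ∧ r * η u t + σ (r * η u t) = 0 := by
    by_cases h0 : η u t = 0
    · exact ⟨1, one_ne_zero, by simp [h0]⟩
    · obtain ⟨d, hd0, hd⟩ := hσ.exists_skew
      exact ⟨d / η u t, div_ne_zero hd0 h0, by rw [div_mul_cancel₀ _ h0, hd, add_neg_cancel]⟩
  have hab : LinearIndependent K ![a, b] := by
    rw [← wedge_ne_zero_iff, ← h1]
    intro h0
    exact wedge_ne_zero_iff.2 hu (g.injective (h0.trans h.semilin.map_zero.symm))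
  have hcd : LinearIndependent K ![c, d] := by
    rw [← wedge_ne_zero_iff, ← h2]
    intro h0
    exact wedge_ne_zero_iff.2 ht (g.injective (h0.trans h.semilin.map_zero.symm))
  have hsum : g (wedge p (u + r • t)) = wedge a b + wedge (τ r • c) d := by
    rw [_root_.map_add, map_smul, h.semilin.1, h.semilin.2, h1, h2]; simp
  have hτr : τ r ≠ 0 := by simpa using hr0
  -- The combination vanishes only if the two lines coincide, and then so do their images.
  by_cases h0 : wedge (K := K) p (u + r • t) = 0
  · rw [h0, h.semilin.map_zero] at hsum
    have h3 : wedge (K := K) a b = wedge (-(τ r) • c) d := by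
      rw [neg_smul, _root_.map_neg, LinearMap.neg_apply]
      exact eq_neg_of_add_eq_zero_left hsum.symm
    refine ⟨a, hab.left_ne_zero, Submodule.subset_span (by simp), ?_⟩
    have h4 := mem_span_pair_of_wedge_eq' hab h3
    obtain ⟨x, y, hxy⟩ := Submodule.mem_span_pair.1 h4
    exact Submodule.mem_span_pair.2 ⟨x * -(τ r), y, by rw [← hxy, smul_smul]⟩
  · have hiso : IsIsotropicBivector η (wedge p (u + r • t)) := by
      refine (isIsotropicBivector_wedge hη).2 ⟨wedge_ne_zero_iff.1 h0, hpp, ?_, by simp [hpu, hpt]⟩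
      have htu : η t u = σ (η u t) := (hη.eq u t).symm
      simp only [_root_.map_add, LinearMap.map_smulₛₗ, LinearMap.add_apply, LinearMap.smul_apply,
        huu, htt, htu, smul_eq_mul, RingHom.id_apply]
      rw [map_mul] at hr
      linear_combination hr
    obtain ⟨x, y, -, -, -, -, hxy⟩ := (h.iff _).2 hiso
    rw [hsum] at hxy
    have hcd' : LinearIndependent K ![τ r • c, d] := by
      rw [← wedge_ne_zero_iff] at hcd ⊢
      simpa [hr0] using hcd
    obtain ⟨q, hq0, hq1, hq2⟩ := exists_mem_inter_of_wedge_add hab hcd' hxy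
    refine ⟨q, hq0, hq1, ?_⟩
    obtain ⟨x, y, hxy⟩ := Submodule.mem_span_pair.1 hq2
    exact Submodule.mem_span_pair.2 ⟨x * τ r, y, by rw [← hxy, smul_smul]⟩

variable [FiniteDimensional K V] (hnd : NondegOn η ⊤) (h4 : 4 ≤ Module.finrank K V)
include hnd h4

/-- For a hyperbolic pair u, v in a complement of p inside pᗮ, the images of the lines ⟨p, u⟩ and
⟨p, v⟩ meet in a point p'. The image of any other isotropic line on p meets both, and total isotropy
forces it through p'. Additivity then covers all of pᗮ. -/
theorem exists_mapsStar {p : V} (hp0 : p ≠ 0) (hpp : η p p = 0) :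
    ∃ p', MapsStar η g p p' := by
  obtain ⟨f, -, hpf⟩ := hnd.exists_hypPair hσ hη trivial hp0 hpp
  have hS := hpf.nondegOn hη (S := ⊤) trivial trivial hnd
  have hS2 : 2 ≤ Module.finrank K (hypPerp η ⊤ p f) := by
    have := finrank_le_hypPerp η ⊤ p f
    rw [finrank_top] at this
    omega
  obtain ⟨u, hu, v, hv, huv⟩ := hS.exists_pair hσ hη hS2
  obtain ⟨-, hpu, hfu⟩ := mem_hypPerp.1 hu
  obtain ⟨-, hpv, hfv⟩ := mem_hypPerp.1 hv
  have hli : ∀ {x}, η f x = 0 → x ≠ 0 → LinearIndependent K ![p, x] := fun h1 h2 =>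
    linearIndependent_pair_of_perp (by simp [hpf.fe]) h1 h2
  have hlu := hli hfu huv.ne_zero
  have hlv := hli hfv huv.ne_zero'
  have hiu : IsIsotropicBivector η (g (wedge p u)) :=
    (h.iff _).2 ((isIsotropicBivector_wedge hη).2 ⟨hlu, hpp, huv.ee, hpu⟩)
  have hiv : IsIsotropicBivector η (g (wedge p v)) :=
    (h.iff _).2 ((isIsotropicBivector_wedge hη).2 ⟨hlv, hpp, huv.ff, hpv⟩)
  obtain ⟨x, y, hxy⟩ := id hiu
  obtain ⟨z, w, hzw⟩ := id hiv
  obtain ⟨p', hp', hm1, hm2⟩ := h.exists_mem_inter hη hσ hpp hpu hpv huv.ee huv.ff hlu hlv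
    hxy.2.2.2.2 hzw.2.2.2.2
  obtain ⟨a, -, ha⟩ := exists_wedge_eq_of_mem hp' hm1
  obtain ⟨b, -, hb⟩ := exists_wedge_eq_of_mem hp' hm2
  have hga : g (wedge p u) = wedge p' a := hxy.2.2.2.2.trans ha
  have hgb : g (wedge p v) = wedge p' b := hzw.2.2.2.2.trans hb
  rw [hga, isIsotropicBivector_wedge hη] at hiu
  rw [hgb, isIsotropicBivector_wedge hη] at hiv
  obtain ⟨hla, hpp', haa, hpa⟩ := hiu
  obtain ⟨hlb, -, hbb, hpb⟩ := hiv
  -- Otherwise every p' ∧ (a + x b) would be isotropic, whereas u + c v takes the value c + σ(c) = 1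
  -- for c of trace one.
  have hab : η a b ≠ 0 := by
    intro hab
    have hba : η b a = 0 := hη.eq_iff.1 hab
    obtain ⟨c, hc⟩ := hσ.exists_trace_one
    have hne : u + c • v ≠ 0 := by
      intro h0
      have := congrArg (η v) h0
      simp [huv.fe, huv.ff] at this
    have hl := hli (x := u + c • v) (by simp [hfu, hfv]) hne
    have h1 : g (wedge p (u + c • v)) = wedge p' (a + τ c • b) := by
      rw [_root_.map_add, map_smul, h.semilin.1, h.semilin.2, hga, hgb]; simp
    have h2 : IsIsotropicBivector η (g (wedge p (u + c • v))) := by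
      rw [h1]
      refine (isIsotropicBivector_wedge hη).2 ⟨?_, hpp', ?_, by simp [hpa, hpb]⟩
      · rw [← wedge_ne_zero_iff, ← h1]
        intro h0
        exact wedge_ne_zero_iff.2 hl (g.injective (h0.trans h.semilin.map_zero.symm))
      · simp [haa, hbb, hab, hba]
    have h3 := ((isIsotropicBivector_wedge hη).1 ((h.iff _).1 h2)).2.2.1
    simp [huv.ee, huv.ff, huv.ef, huv.fe] at h3
    rw [h3] at hc
    exact zero_ne_one hc
  have hmain : ∀ t, η p t = 0 → η t t = 0 → ∃ t', η p' t' = 0 ∧ g (wedge p t) = wedge p' t' := by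
    intro t hpt htt
    by_cases h0 : wedge (K := K) p t = 0
    · exact ⟨0, by simp, by rw [h0, h.semilin.map_zero]; simp⟩
    have hlt := wedge_ne_zero_iff.1 h0
    have hit : IsIsotropicBivector η (g (wedge p t)) :=
      (h.iff _).2 ((isIsotropicBivector_wedge hη).2 ⟨hlt, hpp, htt, hpt⟩)
    obtain ⟨x, y, hl, hxx, hyy, hxy, hgt⟩ := id hit
    by_cases hm : p' ∈ Submodule.span K {x, y}
    · obtain ⟨q, -, hq⟩ := exists_wedge_eq_of_mem hp' hm
      refine ⟨q, ?_, hgt.trans hq⟩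
      rw [hgt, hq] at hit
      exact ((isIsotropicBivector_wedge hη).1 hit).2.2.2
    -- A line missing p' would meet ⟨p', a⟩ and ⟨p', b⟩ in points with nonzero a- and b-components,
    -- and these are not orthogonal.
    · exfalso
      obtain ⟨r, hr0, hr1, hr2⟩ := h.exists_mem_inter hη hσ hpp hpu hpt huv.ee htt hlu hlt hga hgt
      obtain ⟨s, hs0, hs1, hs2⟩ := h.exists_mem_inter hη hσ hpp hpv hpt huv.ff htt hlv hlt hgb hgt
      have hrs := eta_eq_zero_of_mem_span hη hxx hyy hxy hr2 hs2
      obtain ⟨α, β, rfl⟩ := Submodule.mem_span_pair.1 hr1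
      obtain ⟨γ, δ, rfl⟩ := Submodule.mem_span_pair.1 hs1
      have hap : η a p' = 0 := hη.eq_iff.1 hpa
      simp [hpp', hpb, hap, hab] at hrs
      rcases hrs with rfl | rfl
      · have hα : α ≠ 0 := by rintro rfl; simp at hr0
        exact hm ((Submodule.smul_mem_iff _ hα).1 (by simpa using hr2))
      · have hγ : γ ≠ 0 := by rintro rfl; simp at hs0
        exact hm ((Submodule.smul_mem_iff _ hγ).1 (by simpa using hs2))
  refine ⟨p', hp', hpp', fun t hpt => ?_⟩
  let T : AddSubgroup V :=
    { carrier := {t | ∃ t', η p' t' = 0 ∧ g (wedge p t) = wedge p' t'}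
      add_mem' := by
        rintro x y ⟨x', h1, h2⟩ ⟨y', h3, h4⟩
        exact ⟨x' + y', by simp [h1, h3], by rw [_root_.map_add, h.semilin.1, h2, h4, _root_.map_add]⟩
      zero_mem' := ⟨0, by simp, by simp [h.semilin.map_zero]⟩
      neg_mem' := by
        rintro x ⟨x', h1, h2⟩
        exact ⟨-x', by simp [h1], by rw [_root_.map_neg, h.semilin.map_neg, h2, _root_.map_neg]⟩ }
  have h1 := hpf.sub_mem (S := ⊤) trivial trivial (x := t) trivial
  have h2 := hS.le_of_isotropic_mem hσ hη hS2 T (fun x hx hxx =>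
    hmain x (mem_hypPerp.1 hx).2.1 hxx) h1
  have h3 := T.add_mem h2 (show η f t • p ∈ T from ⟨0, by simp, by simp [h.semilin.map_zero]⟩)
  have h5 : t ∈ T := by simpa [hpt] using h3
  exact h5

/-- The centre p'' that g⁻¹ assigns to p' lies on ⟨p, x⟩ for every nonzero x orthogonal to p and f;
two independent choices of x leave only ⟨p⟩. -/
theorem mapsStar_inv {p p' : V} (hp0 : p ≠ 0) (hpp : η p p = 0) (hs : MapsStar η g p p') :
    MapsStar η g⁻¹ p' p := by
  obtain ⟨p'', hs'⟩ := h.inv.exists_mapsStar hη hσ hnd h4 hs.ne_zero hs.isotropic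
  obtain ⟨f, -, hpf⟩ := hnd.exists_hypPair hσ hη trivial hp0 hpp
  have hS := hpf.nondegOn hη (S := ⊤) trivial trivial hnd
  obtain ⟨u, hu, v, hv, huv⟩ := hS.exists_pair hσ hη (by
    have := finrank_le_hypPerp η ⊤ p f
    rw [finrank_top] at this
    omega)
  obtain ⟨-, hpu, hfu⟩ := mem_hypPerp.1 hu
  obtain ⟨-, hpv, hfv⟩ := mem_hypPerp.1 hv
  have hmem : ∀ x, η p x = 0 → η f x = 0 → x ≠ 0 → p'' ∈ Submodule.span K {p, x} := by
    intro x hpx hfx hx0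
    obtain ⟨x', h1, h2⟩ := hs.exists_eq x hpx
    obtain ⟨x'', h3, h4⟩ := hs'.exists_eq x' h1
    rw [← h2, perm_inv_apply] at h4
    have hl : LinearIndependent K ![p, x] :=
      linearIndependent_pair_of_perp (by simp [hpf.fe]) hfx hx0
    exact mem_span_pair_of_wedge_eq' (wedge_ne_zero_iff.1 (h4 ▸ wedge_ne_zero_iff.2 hl)) h4.symm
  obtain ⟨α, β, h1⟩ := Submodule.mem_span_pair.1 (hmem u hpu hfu huv.ne_zero)
  obtain ⟨γ, δ, h2⟩ := Submodule.mem_span_pair.1 (hmem v hpv hfv huv.ne_zero')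
  have hβ : β = 0 := by
    have h3 := congrArg (η v) (h1.trans h2.symm)
    have hvp : η v p = 0 := hη.eq_iff.1 hpv
    simpa [huv.fe, huv.ff, hvp] using h3
  subst hβ
  have hα : α ≠ 0 := by
    rintro rfl
    exact hs'.ne_zero (by rw [← h1]; simp)
  have h3 := hs'.smul (inv_ne_zero hα)
  rw [← h1] at h3
  simpa [smul_smul, hα] using h3

/-- If e' and f' were orthogonal and independent, the preimage of e' ∧ f' would be in the stars at
both e and f, placing f in a plane inside eᗮ. If they were proportional, the image of some e ∧ u
would give the same contradiction. -/
theorem mapsStar_not_orthogonal {e f e' f' : V} (hef : IsHypPair η e f) (he : MapsStar η g e e')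
    (hf : MapsStar η g f f') : η e' f' ≠ 0 := by
  intro h0
  have he2 := h.mapsStar_inv hη hσ hnd h4 hef.ne_zero hef.ee he
  have hf2 := h.mapsStar_inv hη hσ hnd h4 hef.ne_zero' hef.ff hf
  have hcontra : ∀ a b : V, η e a = 0 → wedge (K := K) e a = wedge f b → wedge (K := K) e a ≠ 0 →
      False := by
    intro a b ha hab hne
    have h1 := mem_span_pair_of_wedge_eq' (wedge_ne_zero_iff.1 (hab ▸ hne)) hab.symm
    obtain ⟨r, s, hrs⟩ := Submodule.mem_span_pair.1 h1
    have h2 := congrArg (η e) hrs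
    simp [hef.ee, hef.ef, ha] at h2
  have hg0 : ∀ z, g⁻¹ z = 0 → z = 0 := fun z hz =>
    g⁻¹.injective (hz.trans h.inv.semilin.map_zero.symm)
  by_cases hli : LinearIndependent K ![e', f']
  · obtain ⟨a, ha, h1⟩ := he2.exists_eq f' h0
    obtain ⟨b, -, h2⟩ := hf2.exists_eq e' (hη.eq_iff.1 h0)
    rw [wedge_swap, h.inv.semilin.map_neg, neg_eq_iff_eq_neg, ← _root_.map_neg, h1] at h2
    exact hcontra a (-b) ha h2 (fun hz => wedge_ne_zero_iff.2 hli (hg0 _ (h1.trans hz)))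
  · obtain ⟨c, hc⟩ : ∃ c : K, c • e' = f' := by
      by_contra! hne
      exact hli ((LinearIndependent.pair_iff' he.ne_zero).2 hne)
    have hc0 : c ≠ 0 := by rintro rfl; exact hf.ne_zero (by rw [← hc]; simp)
    obtain ⟨u, hu, hu0⟩ := exists_mem_ne_zero_of_finrank_pos (S := hypPerp η ⊤ e f) (by
      have := finrank_le_hypPerp η ⊤ e f
      rw [finrank_top] at this
      omega)
    obtain ⟨-, heu, hfu⟩ := mem_hypPerp.1 hu
    obtain ⟨u', h1, h2⟩ := he.exists_eq u heu
    obtain ⟨b, -, h3⟩ := hf2.exists_eq u' (by rw [← hc]; simp [h1])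
    have hl : LinearIndependent K ![e, u] :=
      linearIndependent_pair_of_perp (by simp [hef.fe]) hfu hu0
    rw [← hc, map_smul, LinearMap.smul_apply, h.inv.semilin.2, ← h2,
      perm_inv_apply] at h3
    have hτ : (τ⁻¹ : K ≃+* K) c ≠ 0 := by simpa using hc0
    refine hcontra u (((τ⁻¹ : K ≃+* K) c)⁻¹ • b) heu ?_ (wedge_ne_zero_iff.2 hl)
    rw [map_smul, ← h3, smul_smul, inv_mul_cancel₀ hτ, one_smul]

end PreservesIsotropic

end Stars

/-! ### Recovering a semilinear map of V from a collineation of bivectors -/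

section Core

variable {K V : Type*} [Field K] [AddCommGroup V] [Module K V] {σ : K →+* K}
  {η : V →ₛₗ[σ] V →ₗ[K] K} {τ : K ≃+* K} {g : Equiv.Perm (⋀[K]^2 V)}

/-- A semilinear bijection with prescribed values on a hyperbolic pair and its complement. -/
theorem IsHypPair.exists_perm [Finite V] {e f : V} (h : IsHypPair η e f) (hη : η.IsSymm)
    {A : V → V}
    (hadd : ∀ x y, A (x + y) = A x + A y) (hsmul : ∀ (c : K) x, A (c • x) = τ c • A x)
    (hinj : ∀ w, η e w = 0 → η f w = 0 → A w = 0 → w = 0) {e' f' : V} (hee : η e' e' = 0)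
    (hff : η f' f' = 0) (hef : η e' f' ≠ 0)
    (hA : ∀ w, η e w = 0 → η f w = 0 → η e' (A w) = 0 ∧ η f' (A w) = 0) :
    ∃ k : Equiv.Perm V, IsSemilinearWith τ k ∧ k e = e' ∧ k f = f' ∧
      ∀ w, η e w = 0 → η f w = 0 → k w = A w := by
  let k : V → V := fun x =>
    τ (η f x) • e' + τ (η e x) • f' + A (x - η f x • e - η e x • f)
  have kadd : ∀ x y, k (x + y) = k x + k y := by
    intro x y
    have h1 : x + y - η f (x + y) • e - η e (x + y) • f =
      (x - η f x • e - η e x • f) + (y - η f y • e - η e y • f) := by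
      simp only [map_add, add_smul]; abel
    simp only [k, h1, hadd]
    simp only [map_add, add_smul]; abel
  have ksmul : ∀ (c : K) x, k (c • x) = τ c • k x := by
    intro c x
    have h1 : c • x - η f (c • x) • e - η e (c • x) • f =
      c • (x - η f x • e - η e x • f) := by
      simp only [map_smul, smul_sub, smul_smul, smul_eq_mul]
    simp only [k, h1, hsmul]
    simp only [map_smul, smul_eq_mul, map_mul, smul_add, smul_smul]
  have hfe : η f' e' ≠ 0 := fun h0 => hef (hη.eq_iff.1 h0)
  have hA0 : A 0 = 0 := by have := hadd 0 0; simpa using this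
  have kinj : ∀ x, k x = 0 → x = 0 := by
    intro x hx
    have hw := h.sub_mem (S := ⊤) trivial trivial (x := x) trivial
    obtain ⟨-, h1, h2⟩ := mem_hypPerp.1 hw
    obtain ⟨h3, h4⟩ := hA _ h1 h2
    have h5 := congrArg (η e') hx
    have h6 := congrArg (η f') hx
    simp only [k, map_add, map_smul, hee, h3, smul_eq_mul, mul_zero, zero_add, add_zero, map_zero,
      mul_eq_zero, hef, or_false, map_eq_zero_iff τ τ.injective] at h5
    simp only [k, map_add, map_smul, hff, h4, smul_eq_mul, mul_zero, add_zero, map_zero,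
      mul_eq_zero, hfe, or_false, map_eq_zero_iff τ τ.injective] at h6
    simp only [k, h5, h6, map_zero, zero_smul, zero_add, sub_zero] at hx
    exact hinj x h5 h6 hx
  have kinj' : Function.Injective k := by
    intro x y hxy
    have h1 : k (x - y) = 0 := by
      have h2 := kadd (x - y) y
      rw [sub_add_cancel, hxy] at h2
      simpa using h2
    exact sub_eq_zero.1 (kinj _ h1)
  refine ⟨Equiv.ofBijective k ⟨kinj', Finite.surjective_of_injective kinj'⟩, ⟨kadd, ksmul⟩,
    ?_, ?_, fun w h1 h2 => ?_⟩
  · change k e = e'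
    simp [k, h.fe, h.ee, hA0]
  · change k f = f'
    simp [k, h.ff, h.ef, hA0]
  · change k w = A w
    simp [k, h1, h2]

/-- The images of the stars at e and f prescribe a map of V up to scalars on e, on f and on their
complement. `FixesFrame.exists_scalar` controls the one remaining parameter. -/
theorem PreservesIsotropic.exists_wedge_eq [Finite V] (h : PreservesIsotropic η τ g)
    (hη : η.IsSymm) (hσ : IsUnitaryInvolution σ) (hnd : NondegOn η ⊤)
    (h6 : 6 ≤ Module.finrank K V) :
    ∃ k : Equiv.Perm V, IsSemilinearWith τ k ∧ ∃ c : K, c ≠ 0 ∧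
      ∀ x y, g (wedge x y) = c • wedge (k x) (k y) := by
  have hfd : FiniteDimensional K V := Module.Finite.of_finite
  obtain ⟨e, -, f, -, hef⟩ := hnd.exists_pair hσ hη (by rw [finrank_top]; omega)
  have hS : NondegOn η (hypPerp η ⊤ e f) := hef.nondegOn hη trivial trivial hnd
  have hS4 : 4 ≤ Module.finrank K (hypPerp η ⊤ e f) := by
    have := finrank_le_hypPerp η ⊤ e f
    rw [finrank_top] at this
    omega
  have hmem : ∀ {x}, x ∈ hypPerp η ⊤ e f ↔ η e x = 0 ∧ η f x = 0 := by
    intro x; simp [mem_hypPerp]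
  obtain ⟨e', he'⟩ := h.exists_mapsStar hη hσ hnd (by omega) hef.ne_zero hef.ee
  obtain ⟨f₀, hf₀⟩ := h.exists_mapsStar hη hσ hnd (by omega) hef.ne_zero' hef.ff
  have hne := h.mapsStar_not_orthogonal hη hσ hnd (by omega) hef he' hf₀
  obtain ⟨f', hf', hef'⟩ : ∃ f', MapsStar η g f f' ∧ IsHypPair η e' f' :=
    ⟨_, hf₀.smul (inv_ne_zero hne), hypPair_of_ne_zero hη he'.isotropic hf₀.isotropic hne⟩
  -- the semilinear maps induced on the stars of `e` and `f`
  have hstar : ∀ {e f e' f' : V}, IsHypPair η e' f' → MapsStar η g e e' → ∀ w, η e w = 0 →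
      g (wedge e w) = wedge e' (contract (η f') (g (wedge e w))) ∧
      η e' (contract (η f') (g (wedge e w))) = 0 ∧ η f' (contract (η f') (g (wedge e w))) = 0 := by
    intro e f e' f' hp hs w hw
    obtain ⟨u, hu, hgu⟩ := hs.exists_eq w hw
    rw [hgu, contract_wedge, hp.fe, one_smul]
    refine ⟨by simp, by simp [hu, hp.ee], by simp [hp.fe]⟩
  have hli : ∀ {w}, η f w = 0 → w ≠ 0 → LinearIndependent K ![e, w] := fun h1 h2 =>
    linearIndependent_pair_of_perp (by simp [hef.fe]) h1 h2
  have hlif : ∀ {w}, η e w = 0 → w ≠ 0 → LinearIndependent K ![f, w] := fun h1 h2 =>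
    linearIndependent_pair_of_perp (by simp [hef.ef]) h1 h2
  have hg0 : ∀ z, g z = 0 → z = 0 := fun z hz =>
    g.injective (hz.trans h.semilin.map_zero.symm)
  -- Contraction with η f', which is 1 on e', recovers the second factor of e' ∧ u' normalised to be
  -- orthogonal to e' and f'.
  set A : V → V := fun x => contract (η f') (g (wedge e x)) with hAdef
  set B : V → V := fun x => contract (η e') (g (wedge f x)) with hBdef
  have hAadd : ∀ x y, A (x + y) = A x + A y := fun x y => by
    simp only [hAdef, map_add, h.semilin.1]
  have hAsmul : ∀ (c : K) x, A (c • x) = τ c • A x := fun c x => by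
    simp only [hAdef, map_smul, h.semilin.2]
  have hBadd : ∀ x y, B (x + y) = B x + B y := fun x y => by
    simp only [hBdef, map_add, h.semilin.1]
  have hA : ∀ w, η e w = 0 → g (wedge e w) = wedge e' (A w) ∧ η e' (A w) = 0 ∧ η f' (A w) = 0 :=
    fun w hw => hstar (f := f) hef' he' w hw
  have hB : ∀ w, η f w = 0 → g (wedge f w) = wedge f' (B w) ∧ η f' (B w) = 0 ∧ η e' (B w) = 0 :=
    fun w hw => hstar (f := e) hef'.symm hf' w hw
  have hAinj : ∀ w, η e w = 0 → η f w = 0 → A w = 0 → w = 0 := by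
    intro w h1 h2 h3
    by_contra hw
    have h4 := (hA w h1).1
    rw [h3, map_zero] at h4
    exact wedge_ne_zero_iff.2 (hli h2 hw) (hg0 _ h4)
  -- The centre w' of the image of the star at w lies both in ⟨A w, e'⟩ and in ⟨B w, f'⟩;
  -- orthogonality to e' and f' removes the frame components, leaving A w and B w proportional.
  have hAB : ∀ w ∈ hypPerp η ⊤ e f, η w w = 0 → ∃ c : K, B w = c • A w := by
    intro w hw hww
    obtain ⟨hew, hfw⟩ := hmem.1 hw
    by_cases hw0 : w = 0
    · refine ⟨0, ?_⟩
      rw [hw0, zero_smul]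
      have := hBadd 0 0
      simpa using this
    obtain ⟨w', hw'⟩ := h.exists_mapsStar hη hσ hnd (by omega) hw0 hww
    obtain ⟨a, -, ha⟩ := hw'.exists_eq e (hη.eq_iff.1 hew)
    obtain ⟨b, -, hb⟩ := hw'.exists_eq f (hη.eq_iff.1 hfw)
    have hna : wedge (K := K) w' a ≠ 0 := fun h0 =>
      wedge_ne_zero_iff.2 (hli hfw hw0).pair_swap (hg0 _ (ha.trans h0))
    have hnb : wedge (K := K) w' b ≠ 0 := fun h0 =>
      wedge_ne_zero_iff.2 (hlif hew hw0).pair_swap (hg0 _ (hb.trans h0))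
    rw [wedge_swap, h.semilin.map_neg, (hA w hew).1, ← wedge_swap] at ha
    rw [wedge_swap, h.semilin.map_neg, (hB w hfw).1, ← wedge_swap] at hb
    obtain ⟨r, s, hrs⟩ := Submodule.mem_span_pair.1
      (mem_span_pair_of_wedge_eq' (wedge_ne_zero_iff.1 hna) ha.symm)
    obtain ⟨r', s', hrs'⟩ := Submodule.mem_span_pair.1
      (mem_span_pair_of_wedge_eq' (wedge_ne_zero_iff.1 hnb) hb.symm)
    have hs : s = 0 := by
      have := congrArg (η f') (hrs.trans hrs'.symm)
      simpa [(hA w hew).2.2, (hB w hfw).2.1, hef'.fe, hef'.ff] using this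
    have hs' : s' = 0 := by
      have := congrArg (η e') (hrs.trans hrs'.symm)
      simpa [(hA w hew).2.1, (hB w hfw).2.2, hef'.ee, hef'.ef, hs] using this.symm
    have hr' : r' ≠ 0 := by
      rintro rfl
      exact hw'.ne_zero (by rw [← hrs', hs']; simp)
    refine ⟨r'⁻¹ * r, ?_⟩
    rw [hs, zero_smul, add_zero] at hrs
    rw [hs', zero_smul, add_zero] at hrs'
    rw [mul_smul, hrs, ← hrs', smul_smul, inv_mul_cancel₀ hr', one_smul]
  obtain ⟨c, hc⟩ := hS.proportional hσ hη hS4 hAadd hAsmul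
    (fun x hx => hAinj x (hmem.1 hx).1 (hmem.1 hx).2) hBadd hAB
  have hc0 : c ≠ 0 := by
    rintro rfl
    obtain ⟨w, hw, hw0⟩ := exists_mem_ne_zero_of_finrank_pos (S := hypPerp η ⊤ e f) (by omega)
    obtain ⟨hew, hfw⟩ := hmem.1 hw
    have h1 := (hB w hfw).1
    rw [hc w hw, zero_smul, map_zero] at h1
    exact wedge_ne_zero_iff.2 (hlif hew hw0) (hg0 _ h1)
  have hfA : ∀ w, η e w = 0 → η f w = 0 → g (wedge f w) = wedge (c • f') (A w) := by
    intro w h1 h2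
    rw [(hB w h2).1, hc w (hmem.2 ⟨h1, h2⟩)]
    simp
  -- Sending f to c f' absorbs the ratio c of B to A, so the exterior square of k agrees with g on
  -- all e ∧ w and f ∧ w.
  obtain ⟨k, hk, hke, hkf, hkw⟩ := hef.exists_perm hη hAadd hAsmul hAinj (e' := e') (f' := c • f')
    hef'.ee (by simp [hef'.ff]) (by simp [hef'.ef, hc0])
    (fun w h1 h2 => ⟨(hA w h1).2.1, by simp [(hA w h1).2.2]⟩)
  obtain ⟨q, hq, hqw⟩ := hk.exists_wedge
  have hlin : IsSemilinearWith (1 : K ≃+* K) (q⁻¹ * g) := by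
    have := hq.inv.mul h.semilin
    rwa [inv_mul_cancel] at this
  let G : ⋀[K]^2 V →ₗ[K] ⋀[K]^2 V :=
    { toFun := fun z => q⁻¹ (g z)
      map_add' := hlin.1
      map_smul' := fun c z => by simpa using hlin.2 c z }
  have hGq : ∀ z, q (G z) = g z := fun z => perm_apply_inv q (g z)
  have hqk : ∀ x y, q⁻¹ (wedge x y) = wedge (k⁻¹ x) (k⁻¹ y) := fun x y => by
    apply q.injective
    rw [perm_apply_inv, hqw, perm_apply_inv, perm_apply_inv]
  have hframe : FixesFrame η e f G :=
    { pair := hef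
      inj := fun z hz => hg0 z (by rw [← hGq, hz, hq.map_zero])
      star := fun p hp0 hpp => by
        obtain ⟨p', hp'⟩ := h.exists_mapsStar hη hσ hnd (by omega) hp0 hpp
        refine ⟨k⁻¹ p', fun h0 => hp'.ne_zero ?_, fun u hu => ?_⟩
        · rw [← perm_apply_inv k p', h0, hk.map_zero]
        · obtain ⟨u', -, hu'⟩ := hp'.exists_eq u hu
          exact ⟨k⁻¹ u', by change q⁻¹ (g _) = _; rw [hu', hqk]⟩
      fix_left := fun w h1 h2 => by
        apply q.injective
        rw [hGq, hqw, hke, hkw w h1 h2, (hA w h1).1]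
      fix_right := fun w h1 h2 => by
        apply q.injective
        rw [hGq, hqw, hkf, hkw w h1 h2, hfA w h1 h2] }
  obtain ⟨l, hl0, hlw, hlef⟩ := hframe.exists_scalar hσ hη hnd h6
  have hτl : τ l ≠ 0 := by simpa using hl0
  -- Relative to the exterior square of k, g has factor 1 on mixed bivectors, τ(l) on the complement
  -- and τ(l)⁻¹ on e ∧ f. Scaling both frame images by τ(l)⁻¹ leaves the uniform factor τ(l).
  obtain ⟨k', hk', hke', hkf', hkw'⟩ := hef.exists_perm hη hAadd hAsmul hAinj
    (e' := (τ l)⁻¹ • e') (f' := (τ l)⁻¹ • c • f')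
    (by simp [hef'.ee]) (by simp [hef'.ff]) (by simp [hef'.ef, hc0, hl0])
    (fun w h1 h2 => ⟨by simp [(hA w h1).2.1], by simp [(hA w h1).2.2]⟩)
  have hsymm : ∀ x y, g (wedge x y) = τ l • wedge (k' x) (k' y) →
      g (wedge y x) = τ l • wedge (k' y) (k' x) := by
    intro x y hxy
    rw [wedge_swap, h.semilin.map_neg, hxy, wedge_swap (k' y), smul_neg]
  have hew : ∀ w, η e w = 0 → η f w = 0 → g (wedge e w) = τ l • wedge (k' e) (k' w) := by
    intro w h1 h2
    rw [(hA w h1).1, hke', hkw' w h1 h2]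
    simp only [map_smul, LinearMap.smul_apply]
    rw [smul_inv_smul₀ hτl]
  have hfw : ∀ w, η e w = 0 → η f w = 0 → g (wedge f w) = τ l • wedge (k' f) (k' w) := by
    intro w h1 h2
    rw [hfA w h1 h2, hkf', hkw' w h1 h2]
    simp only [map_smul, LinearMap.smul_apply]
    rw [smul_inv_smul₀ hτl]
  have hgef : g (wedge e f) = τ l • wedge (k' e) (k' f) := by
    rw [← hGq, hlef, hq.2, hqw, hke, hkf, hke', hkf']
    simp only [map_smul, LinearMap.smul_apply, map_inv₀]
    rw [smul_inv_smul₀ hτl, smul_comm]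
  have hself : ∀ x, g (wedge x x) = τ l • wedge (k' x) (k' x) := fun x => by
    simp [h.semilin.map_zero]
  have hww : ∀ w u, η e w = 0 → η f w = 0 → η e u = 0 → η f u = 0 →
      g (wedge w u) = τ l • wedge (k' w) (k' u) := by
    intro w u h1 h2 h3 h4
    rw [← hGq, hlw w u h1 h2 h3 h4, hq.2, hqw, hkw w h1 h2, hkw u h3 h4, hkw' w h1 h2, hkw' u h3 h4]
  let T : V → Submodule K V := fun x =>
    { carrier := {y | g (wedge x y) = τ l • wedge (k' x) (k' y)}
      add_mem' := fun {y z} hy hz => by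
        change g _ = _
        rw [map_add, h.semilin.1, show g _ = _ from hy, show g _ = _ from hz, hk'.1, map_add,
          smul_add]
      zero_mem' := by
        change g _ = _
        rw [hk'.map_zero]; simp [h.semilin.map_zero]
      smul_mem' := fun c y hy => by
        change g _ = _
        rw [map_smul, h.semilin.2, show g _ = _ from hy, hk'.2, map_smul, smul_comm] }
  refine ⟨k', hk', τ l, hτl, fun x y => ?_⟩
  refine hef.frame_induction (T x) (hsymm _ _ ?_) (hsymm _ _ ?_) (fun w h1 h2 => hsymm _ _ ?_) y
  · exact hef.frame_induction (T e) (hself e) hgef hew x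
  · exact hef.frame_induction (T f) (hsymm _ _ hgef) (hself f) hfw x
  · exact hef.frame_induction (T w) (hsymm _ _ (hew w h1 h2)) (hsymm _ _ (hfw w h1 h2))
      (fun u h3 h4 => hww w u h1 h2 h3 h4) x

/-- A semilinear bijection that preserves isotropic vectors is a semilinear similitude. -/
theorem mem_GammaU_of_isotropic (hη : η.IsSymm) (hσ : IsUnitaryInvolution σ) {e f : V}
    (hef : IsHypPair η e f) (hnd : NondegOn η ⊤) (hcomm : ∀ x, τ (σ x) = σ (τ x))
    {k : Equiv.Perm V} (hk : IsSemilinearWith τ k) (hiso : ∀ x, η x x = 0 → η (k x) (k x) = 0) :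
    k ∈ GammaU η := by
  -- Pulling η back along k and untwisting by τ⁻¹ gives a form that is again σ-Hermitian, because τ
  -- commutes with σ.
  let η' : V →ₛₗ[σ] V →ₗ[K] K := LinearMap.mk₂'ₛₗ σ (RingHom.id K)
    (fun x y => τ.symm (η (k x) (k y)))
    (fun x x' y => by simp [hk.1])
    (fun c x y => by
      apply τ.injective
      simp [hk.2, hcomm])
    (fun x y y' => by simp [hk.1])
    (fun c x y => by simp [hk.2])
  have hη' : η'.IsSymm := ⟨fun x y => by
    apply τ.injective
    change τ (σ (τ.symm (η (k x) (k y)))) = τ (τ.symm (η (k y) (k x)))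
    rw [hcomm, τ.apply_symm_apply, τ.apply_symm_apply, hη.eq]⟩
  obtain ⟨c, hc⟩ := hef.form_unique hσ hη hη' (fun x hx => by
    change τ.symm (η (k x) (k x)) = 0
    rw [hiso x hx, map_zero])
  have hc' : ∀ x y, η (k x) (k y) = τ c * τ (η x y) := by
    intro x y
    rw [← map_mul, ← hc]
    exact (τ.apply_symm_apply _).symm
  have hc0 : τ c ≠ 0 := by
    intro h0
    have h1 := hnd (k e) trivial (fun y _ => by
      rw [← perm_apply_inv k y, hc', h0, zero_mul])
    exact hef.ne_zero (k.injective (h1.trans hk.map_zero.symm))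
  exact ⟨τ, Units.mk0 _ hc0, hk, hc'⟩

/-- In dimension at least six, a semilinear bijection of the bivectors that preserves the totally
isotropic lines is induced by a semilinear similitude. -/
theorem PreservesIsotropic.exists_similitude [Finite V] (h : PreservesIsotropic η τ g)
    (hη : η.IsSymm) (hσ : IsUnitaryInvolution σ) (hnd : NondegOn η ⊤)
    (h6 : 6 ≤ Module.finrank K V) (hcomm : ∀ x, τ (σ x) = σ (τ x)) :
    ∃ k ∈ GammaU η, IsSemilinearWith τ k ∧ ∃ c : K, c ≠ 0 ∧
      ∀ x y, g (wedge x y) = c • wedge (k x) (k y) := by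
  have hfd : FiniteDimensional K V := Module.Finite.of_finite
  obtain ⟨k, hk, c, hc0, hg⟩ := h.exists_wedge_eq hη hσ hnd h6
  obtain ⟨e, -, f, -, hef⟩ := hnd.exists_pair hσ hη (by rw [finrank_top]; omega)
  refine ⟨k, mem_GammaU_of_isotropic hη hσ hef hnd hcomm hk fun x hxx => ?_, hk, c, hc0, hg⟩
  by_cases hx0 : x = 0
  · rw [hx0, hk.map_zero, map_zero]
  obtain ⟨y, -, hxy⟩ := hnd.exists_hypPair hσ hη trivial hx0 hxx
  -- Every nonzero isotropic x lies on a totally isotropic line, whose image under g is isotropic;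
  -- this passes isotropy to k x.
  obtain ⟨u, -, huu, hxu, -, hli, -⟩ := exists_common_isotropic (S := (⊤ : Submodule K V)) hσ hη
    (by rw [finrank_top]; omega) hxx hxy.ff (by simp [hxy.ef])
  have h1 := (h.iff _).2 ((isIsotropicBivector_wedge hη).2 ⟨hli, hxx, huu, hxu⟩)
  rw [hg, ← LinearMap.smul_apply, ← map_smul] at h1
  have h2 := ((isIsotropicBivector_wedge hη).1 h1).2.1
  simpa [hc0] using h2

end Core

/-! ### Isomorphisms from relations -/

section Relation

/-- A subgroup of a direct product that projects onto `A` and `B` identifies the images of `A` and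
`B` under homomorphisms with corresponding kernels. -/
theorem nonempty_mulEquiv_of_relation {G H X Y : Type*} [Group G] [Group H] [Group X] [Group Y]
    (R : Subgroup (G × H)) {A : Subgroup G} {B : Subgroup H} (α : G →* X) (β : H →* Y)
    (hA : ∀ a, a ∈ A ↔ ∃ b, (a, b) ∈ R) (hB : ∀ b, b ∈ B ↔ ∃ a, (a, b) ∈ R)
    (hker : ∀ a b, (a, b) ∈ R → (α a = 1 ↔ β b = 1)) :
    Nonempty (A.map α ≃* B.map β) := by
  let φ : R →* X := (α.comp (MonoidHom.fst G H)).comp R.subtype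
  let ψ : R →* Y := (β.comp (MonoidHom.snd G H)).comp R.subtype
  have hφ : φ.range = A.map α := by
    ext x
    constructor
    · rintro ⟨⟨⟨a, b⟩, hab⟩, rfl⟩
      exact ⟨a, (hA a).2 ⟨b, hab⟩, rfl⟩
    · rintro ⟨a, ha, rfl⟩
      obtain ⟨b, hab⟩ := (hA a).1 ha
      exact ⟨⟨(a, b), hab⟩, rfl⟩
  have hψ : ψ.range = B.map β := by
    ext x
    constructor
    · rintro ⟨⟨⟨a, b⟩, hab⟩, rfl⟩
      exact ⟨b, (hB b).2 ⟨a, hab⟩, rfl⟩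
    · rintro ⟨b, hb, rfl⟩
      obtain ⟨a, hab⟩ := (hB b).1 hb
      exact ⟨⟨(a, b), hab⟩, rfl⟩
  -- Both images are thus quotients of R by the same kernel.
  have hk : φ.ker = ψ.ker := by
    ext ⟨⟨a, b⟩, hab⟩
    exact hker a b hab
  exact ⟨(MulEquiv.subgroupCongr hφ).symm.trans
    ((QuotientGroup.quotientKerEquivRange φ).symm.trans
      ((QuotientGroup.quotientMulEquivOfEq hk).trans
        ((QuotientGroup.quotientKerEquivRange ψ).trans (MulEquiv.subgroupCongr hψ))))⟩

theorem mk'_scalarMaps_eq_one {K M : Type*} [Field K] [AddCommGroup M] [Module K M]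
    (f : GammaL K M) : QuotientGroup.mk' (scalarMaps K M) f = 1 ↔
      ∃ c : Kˣ, ∀ x : M, (f : Equiv.Perm M) x = c • x := by
  rw [QuotientGroup.mk'_apply, QuotientGroup.eq_one_iff]
  rfl

/-- Version of `nonempty_mulEquiv_of_relation` for groups of semilinear maps modulo scalars. -/
theorem nonempty_projGroup_mulEquiv {K L M N : Type*} [Field K] [AddCommGroup M] [Module K M]
    [Field L] [AddCommGroup N] [Module L N] (R : Subgroup (Equiv.Perm M × Equiv.Perm N))
    {A : Subgroup (Equiv.Perm M)} {B : Subgroup (Equiv.Perm N)}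
    (hAΓ : A ≤ GammaL K M) (hBΓ : B ≤ GammaL L N) (hA : ∀ a, a ∈ A ↔ ∃ b, (a, b) ∈ R)
    (hB : ∀ b, b ∈ B ↔ ∃ a, (a, b) ∈ R)
    (hker : ∀ a b, (a, b) ∈ R →
      ((∃ c : Kˣ, ∀ x, a x = c • x) ↔ ∃ c : Lˣ, ∀ x, b x = c • x)) :
    Nonempty (projGroup K A ≃* projGroup L B) := by
  refine nonempty_mulEquiv_of_relation (R.comap (MonoidHom.prodMap (GammaL K M).subtype
    (GammaL L N).subtype)) _ _ (fun a => ?_) (fun b => ?_) (fun a b hab => ?_)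
  · rw [Subgroup.mem_subgroupOf, hA]
    exact ⟨fun ⟨b, hb⟩ => ⟨⟨b, hBΓ ((hB b).2 ⟨_, hb⟩)⟩, hb⟩, fun ⟨b, hb⟩ => ⟨b, hb⟩⟩
  · rw [Subgroup.mem_subgroupOf, hB]
    exact ⟨fun ⟨a, ha⟩ => ⟨⟨a, hAΓ ((hA a).2 ⟨_, ha⟩)⟩, ha⟩, fun ⟨a, ha⟩ => ⟨a, ha⟩⟩
  · rw [mk'_scalarMaps_eq_one, mk'_scalarMaps_eq_one]
    exact hker _ _ hab

/-- Version of `nonempty_mulEquiv_of_relation` for a permutation group and a group of semilinear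
maps modulo scalars. -/
theorem nonempty_perm_mulEquiv_projGroup {ι L N : Type*}
    [Field L] [AddCommGroup N] [Module L N] (R : Subgroup (Equiv.Perm ι × Equiv.Perm N))
    {A : Subgroup (Equiv.Perm ι)} {B : Subgroup (Equiv.Perm N)}
    (hBΓ : B ≤ GammaL L N) (hA : ∀ a, a ∈ A ↔ ∃ b, (a, b) ∈ R)
    (hB : ∀ b, b ∈ B ↔ ∃ a, (a, b) ∈ R)
    (hker : ∀ a b, (a, b) ∈ R → (a = 1 ↔ ∃ c : Lˣ, ∀ x, b x = c • x)) :
    Nonempty (A ≃* projGroup L B) := by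
  have := nonempty_mulEquiv_of_relation (R.comap (MonoidHom.prodMap (MonoidHom.id _)
    (GammaL L N).subtype)) (A := A) (B := B.subgroupOf (GammaL L N)) (MonoidHom.id _)
    (QuotientGroup.mk' (scalarMaps L N)) (fun a => ?_) (fun b => ?_) (fun a b hab => ?_)
  · rwa [Subgroup.map_id] at this
  · rw [hA]
    exact ⟨fun ⟨b, hb⟩ => ⟨⟨b, hBΓ ((hB b).2 ⟨_, hb⟩)⟩, hb⟩, fun ⟨b, hb⟩ => ⟨b, hb⟩⟩
  · rw [Subgroup.mem_subgroupOf, hB]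
    exact ⟨fun ⟨a, ha⟩ => ⟨a, ha⟩, fun ⟨a, ha⟩ => ⟨a, ha⟩⟩
  · rw [mk'_scalarMaps_eq_one]
    exact hker _ _ hab

end Relation

/-! ### Monomial automorphisms and collineations -/

section Code

variable {K W ι : Type*} [Field K] [AddCommGroup W] [Module K W] {ω : ι → W}

/-- The semilinear map `g` permutes the points `ω i` in the way described by `π` and `d`. -/
def Permutes (ω : ι → W) (π : Equiv.Perm ι) (d : ι → Kˣ) (g : Equiv.Perm W) : Prop :=
  ∀ i, g (ω i) = (d i)⁻¹ • ω (π i)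

theorem Permutes.one : Permutes ω (1 : Equiv.Perm ι) (fun _ => (1 : Kˣ)) 1 := fun i => by simp

theorem Permutes.mul {π ρ : Equiv.Perm ι} {d e : ι → Kˣ} {τ : K ≃+* K} {g k : Equiv.Perm W}
    (hτ : IsSemilinearWith τ g) (hg : Permutes ω π d g) (hk : Permutes ω ρ e k) :
    Permutes ω (π * ρ) (fun i => d (ρ i) * Units.map (τ : K →* K) (e i)) (g * k) := fun i => by
  rw [Equiv.Perm.mul_apply, hk, Units.smul_def, hτ.2, hg, mul_inv_rev, mul_smul]
  simp [Units.smul_def]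

theorem Permutes.inv {π : Equiv.Perm ι} {d : ι → Kˣ} {τ : K ≃+* K} {g : Equiv.Perm W}
    (hτ : IsSemilinearWith τ g) (hg : Permutes ω π d g) :
    Permutes ω π⁻¹ (fun i => Units.map ((τ⁻¹ : K ≃+* K) : K →* K) (d (π⁻¹ i))⁻¹) g⁻¹ := fun i => by
  apply g.injective
  have h := hg (π⁻¹ i)
  rw [perm_apply_inv] at h
  have h2 := ringAut_apply_inv τ (d (π⁻¹ i) : K)
  rw [perm_apply_inv, Units.smul_def, hτ.2, h]
  simp [Units.smul_def, smul_smul]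

theorem exists_isMonomialWith (π : Equiv.Perm ι) (d : ι → Kˣ) (τ : K ≃+* K) :
    ∃ f : Equiv.Perm (ι → K), IsMonomialWith π d τ f := by
  refine ⟨⟨fun x j => d (π⁻¹ j) * τ (x (π⁻¹ j)), fun y i => τ⁻¹ ((d i)⁻¹ * y (π i)), ?_, ?_⟩, ?_⟩
  · intro x
    ext i
    simp
  · intro y
    ext i
    simp
  · intro x i
    simp

/-- On functionals, f acts as φ ↦ τ ∘ φ ∘ g⁻¹; dualising is what turns the entries of f into their
inverses in `Permutes`. -/
theorem Permutes.map_mem_code {π : Equiv.Perm ι} {d : ι → Kˣ} {τ : K ≃+* K} {g : Equiv.Perm W}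
    {f : Equiv.Perm (ι → K)} (hτ : IsSemilinearWith τ g) (hg : Permutes ω π d g)
    (hf : IsMonomialWith π d τ f) {x : ι → K} (hx : x ∈ codeOf (K := K) ω) :
    f x ∈ codeOf (K := K) ω := by
  obtain ⟨φ, rfl⟩ := hx
  refine ⟨{ toFun := fun w => τ (φ (g⁻¹ w)), map_add' := fun a b => ?_, map_smul' := fun c a => ?_ },
    ?_⟩
  · rw [hτ.inv.1, _root_.map_add, _root_.map_add]
  · rw [hτ.inv.2, map_smul, smul_eq_mul, map_mul, ringAut_apply_inv]
    rfl
  · ext j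
    obtain ⟨i, rfl⟩ := π.surjective j
    rw [hf]
    change τ (φ (g⁻¹ (ω (π i)))) = d i * τ (φ (ω i))
    have h1 : ω (π i) = d i • g (ω i) := by rw [hg, smul_inv_smul]
    rw [h1, Units.smul_def, hτ.inv.2, perm_inv_apply, map_smul, smul_eq_mul, map_mul,
      ringAut_apply_inv]

theorem Permutes.mem_monomialAut {π : Equiv.Perm ι} {d : ι → Kˣ} {τ : K ≃+* K} {g : Equiv.Perm W}
    {f : Equiv.Perm (ι → K)} (hτ : IsSemilinearWith τ g) (hg : Permutes ω π d g)
    (hf : IsMonomialWith π d τ f) : f ∈ monomialAut (codeOf (K := K) ω) := by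
  refine ⟨⟨_, _, _, hf⟩, fun x => ⟨fun hx => ?_, hg.map_mem_code hτ hf⟩⟩
  have := (hg.inv hτ).map_mem_code hτ.inv hf.inv hx
  rwa [perm_inv_apply] at this

/-- A monomial automorphism comes from a collineation that permutes the points. -/
theorem exists_permutes [Finite W] (hspan : Submodule.span K (Set.range ω) = ⊤)
    {f : Equiv.Perm (ι → K)} (hfC : f ∈ monomialAut (codeOf (K := K) ω)) {π : Equiv.Perm ι}
    {d : ι → Kˣ} {τ : K ≃+* K} (hf : IsMonomialWith π d τ f) :
    ∃ g : Equiv.Perm W, IsSemilinearWith τ g ∧ Permutes ω π d g := by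
  -- The action of f on code words, read as a correspondence of functionals; g is its transpose.
  let Rel : Module.Dual K W → Module.Dual K W → Prop := fun φ φ' =>
    ∀ i, φ' (ω (π i)) = d i * τ (φ (ω i))
  have hex : ∀ φ, ∃ φ', Rel φ φ' := by
    intro φ
    obtain ⟨φ', h⟩ := (hfC.2 (fun i => φ (ω i))).2 ⟨φ, rfl⟩
    refine ⟨φ', fun i => ?_⟩
    have := congrFun h (π i)
    rw [hf] at this
    exact this
  have hex' : ∀ φ', ∃ φ, Rel φ φ' := by
    intro φ'
    obtain ⟨φ, h⟩ := (hfC.2 (f⁻¹ (fun i => φ' (ω i)))).1 (by rw [perm_apply_inv]; exact ⟨φ', rfl⟩)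
    refine ⟨φ, fun i => ?_⟩
    have h1 := hf (f⁻¹ (fun i => φ' (ω i))) i
    rw [perm_apply_inv, ← h] at h1
    exact h1
  -- The candidate for g w is pinned down by φ'(g w) = τ(φ w). At w = ω i a solution is visible, and
  -- solutions add and scale, so the span suffices.
  have key : ∀ w, ∃ v, ∀ φ φ', Rel φ φ' → φ' v = τ (φ w) := by
    intro w
    have hw : w ∈ Submodule.span K (Set.range ω) := hspan ▸ trivial
    induction hw using Submodule.span_induction with
    | mem x hx =>
      obtain ⟨i, rfl⟩ := hx
      refine ⟨(d i)⁻¹ • ω (π i), fun φ φ' h => ?_⟩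
      rw [Units.smul_def, map_smul, h i, smul_eq_mul, ← mul_assoc]
      simp
    | zero => exact ⟨0, fun φ φ' _ => by simp⟩
    | add x y _ _ hx hy =>
      obtain ⟨a, ha⟩ := hx
      obtain ⟨b, hb⟩ := hy
      exact ⟨a + b, fun φ φ' h => by simp [ha φ φ' h, hb φ φ' h]⟩
    | smul c x _ hx =>
      obtain ⟨a, ha⟩ := hx
      exact ⟨τ c • a, fun φ φ' h => by simp [ha φ φ' h]⟩
  choose g hg using key
  have hsep : ∀ v v' : W, (∀ φ φ', Rel φ φ' → φ' v = φ' v') → v = v' := by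
    intro v v' h
    rw [← sub_eq_zero, ← Module.forall_dual_apply_eq_zero_iff K]
    intro φ'
    obtain ⟨φ, hφ⟩ := hex' φ'
    rw [map_sub, h φ φ' hφ, sub_self]
  have hinj : Function.Injective g := by
    intro a b hab
    rw [← sub_eq_zero, ← Module.forall_dual_apply_eq_zero_iff K]
    intro φ
    obtain ⟨φ', hφ⟩ := hex φ
    have h1 := hg a φ φ' hφ
    rw [hab, hg b φ φ' hφ] at h1
    rw [map_sub, τ.injective h1, sub_self]
  refine ⟨Equiv.ofBijective g ⟨hinj, Finite.surjective_of_injective hinj⟩, ⟨fun a b => ?_,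
    fun c a => ?_⟩, fun i => ?_⟩
  · refine hsep _ _ fun φ φ' h => ?_
    change φ' (g (a + b)) = φ' (g a + g b)
    simp [hg _ φ φ' h]
  · refine hsep _ _ fun φ φ' h => ?_
    change φ' (g (c • a)) = φ' (τ c • g a)
    simp [hg _ φ φ' h]
  · refine hsep _ _ fun φ φ' h => ?_
    change φ' (g (ω i)) = _
    rw [hg _ φ φ' h, Units.smul_def, map_smul, h i, smul_eq_mul, ← mul_assoc]
    simp

theorem isSemilinearWith_one_of_scalar [Nontrivial W] {τ : K ≃+* K} {g : Equiv.Perm W}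
    (hτ : IsSemilinearWith τ g) {c : Kˣ} (hc : ∀ x, g x = c • x) : τ = 1 := by
  obtain ⟨x, hx⟩ := exists_ne (0 : W)
  ext a
  have h1 := hτ.2 a x
  rw [hc, hc, smul_comm] at h1
  exact (smul_left_injective K (by simpa [Units.smul_def] using hx) h1).symm

theorem eq_smul_of_span {τ : K ≃+* K} {g : Equiv.Perm W} (hτ : IsSemilinearWith τ g) (h1 : τ = 1)
    (hspan : Submodule.span K (Set.range ω) = ⊤) {c : Kˣ} (h : ∀ i, g (ω i) = c • ω i) (x : W) :
    g x = c • x := by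
  have hx : x ∈ Submodule.span K (Set.range ω) := hspan ▸ trivial
  induction hx using Submodule.span_induction with
  | mem x hx =>
    obtain ⟨i, rfl⟩ := hx
    exact h i
  | zero => rw [hτ.map_zero, smul_zero]
  | add x y _ _ hx hy => rw [hτ.1, hx, hy, smul_add]
  | smul a x _ hx => rw [hτ.2, hx, h1, smul_comm]; rfl

/-- The vectors `ω i` span `W` and represent distinct points. -/
structure IsProjectiveSystem (K : Type*) {W ι : Type*} [Field K] [AddCommGroup W] [Module K W]
    (ω : ι → W) : Prop where
  span : Submodule.span K (Set.range ω) = ⊤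
  ne_zero : ∀ i, ω i ≠ 0
  eq_of_smul : ∀ i j (c : K), ω i = c • ω j → i = j

theorem IsProjectiveSystem.perm_eq_one (hω : IsProjectiveSystem K ω) {π : Equiv.Perm ι}
    {d : ι → Kˣ} {g : Equiv.Perm W} (hg : Permutes ω π d g) {e : ι → K}
    (h : ∀ i, g (ω i) = e i • ω i) : π = 1 := by
  ext i
  refine hω.eq_of_smul _ _ (d i * e i) ?_
  rw [Equiv.Perm.one_apply, mul_smul, ← h, hg, Units.smul_def, smul_smul]
  simp

/-- Testing a scalar f on unit vectors forces π = 1, constant d and τ = 1, so g is the inverse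
scalar on a spanning set. Conversely a scalar g fixes every point, and distinctness of the points
gives π = 1. -/
theorem IsProjectiveSystem.scalar_iff [Nontrivial W] (hω : IsProjectiveSystem K ω)
    {π : Equiv.Perm ι} {d : ι → Kˣ} {τ : K ≃+* K} {g : Equiv.Perm W} {f : Equiv.Perm (ι → K)}
    (hτ : IsSemilinearWith τ g) (hg : Permutes ω π d g) (hf : IsMonomialWith π d τ f) :
    (∃ c : Kˣ, ∀ x, f x = c • x) ↔ ∃ c : Kˣ, ∀ x, g x = c • x := by
  classical
  constructor
  · rintro ⟨c, hc⟩
    have hπ : π = 1 := by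
      ext i
      by_contra hne
      rw [Equiv.Perm.one_apply] at hne
      have h1 := hf (Pi.single i 1) i
      rw [hc, Pi.smul_apply, Pi.single_eq_of_ne hne] at h1
      simp at h1
      exact (d i).ne_zero h1.symm
    have hd : ∀ i, d i = c := by
      intro i
      have h1 := hf (Pi.single i 1) i
      rw [hc, hπ] at h1
      ext
      simpa [Units.smul_def] using h1.symm
    have hne : Nonempty ι := by
      by_contra h0
      rw [not_nonempty_iff] at h0
      have := hω.span
      rw [Set.range_eq_empty, Submodule.span_empty] at this
      exact bot_ne_top this
    have h1 : τ = 1 := by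
      ext a
      obtain ⟨i⟩ := hne
      have h1 := hf (Pi.single i a) i
      rw [hc, hπ, hd] at h1
      simpa [Units.smul_def] using h1.symm
    exact ⟨c⁻¹, eq_smul_of_span hτ h1 hω.span fun i => by rw [hg, hπ, hd]; rfl⟩
  · rintro ⟨c, hc⟩
    have h1 := isSemilinearWith_one_of_scalar hτ hc
    have hπ := hω.perm_eq_one hg (e := fun _ => c) (fun i => hc _)
    refine ⟨c⁻¹, fun x => ?_⟩
    ext i
    have h2 := hf x i
    have h3 := hg i
    rw [hc, hπ, Units.smul_def, Units.smul_def] at h3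
    have h4 := smul_left_injective K (hω.ne_zero i) h3
    rw [hπ, h1] at h2
    have h5 : d i = c⁻¹ := by rw [Units.ext h4, inv_inv]
    rw [h5] at h2
    exact h2

theorem monomialAut_le_GammaL (C : Submodule K (ι → K)) :
    monomialAut C ≤ GammaL K (ι → K) := by
  rintro f ⟨⟨π, d, τ, hf⟩, -⟩
  refine ⟨τ, fun x y => ?_, fun c x => ?_⟩ <;> ext j <;> obtain ⟨i, rfl⟩ := π.surjective j
  · rw [Pi.add_apply, hf, hf, hf, Pi.add_apply, map_add, mul_add]
  · rw [Pi.smul_apply, hf, hf, Pi.smul_apply, smul_eq_mul, smul_eq_mul, map_mul, mul_left_comm]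

theorem isMonomialWith_linear_iff [Nonempty ι] {π : Equiv.Perm ι} {d : ι → Kˣ} {τ : K ≃+* K}
    {f : Equiv.Perm (ι → K)} (hf : IsMonomialWith π d τ f) :
    f ∈ linearMaps K (ι → K) ↔ τ = 1 := by
  constructor
  · intro h
    obtain ⟨i⟩ := ‹Nonempty ι›
    ext a
    have h1 := congrFun (h.2 a (fun _ => 1)) (π i)
    rw [Pi.smul_apply, hf, hf] at h1
    simpa [mul_comm a] using h1
  · rintro rfl
    refine ⟨fun x y => ?_, fun c x => ?_⟩ <;> ext j <;> obtain ⟨i, rfl⟩ := π.surjective j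
    · rw [Pi.add_apply, hf, hf, hf, Pi.add_apply, map_add, mul_add]
    · rw [Pi.smul_apply, hf, hf, Pi.smul_apply, smul_eq_mul, smul_eq_mul, map_mul, mul_left_comm]

/-- The groups of monomial automorphisms whose field automorphism lies in `T`, in terms of a group
`S` that relates the collineations permuting the points `ω i` with semilinear maps of `N`. -/
theorem IsProjectiveSystem.nonempty_projGroup_mulEquiv [Finite W] [Nontrivial W]
    (hω : IsProjectiveSystem K ω) {L N : Type*} [Field L] [AddCommGroup N] [Module L N]
    (S : Subgroup (Equiv.Perm W × Equiv.Perm N)) {A : Subgroup (Equiv.Perm (ι → K))}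
    {B : Subgroup (Equiv.Perm N)} (T : Subgroup (K ≃+* K)) (hBΓ : B ≤ GammaL L N)
    (hA : ∀ f, f ∈ A ↔ f ∈ monomialAut (codeOf (K := K) ω) ∧
      ∃ π d, ∃ τ ∈ T, IsMonomialWith π d τ f)
    (hfwd : ∀ g π d, ∀ τ ∈ T, IsSemilinearWith (K := K) τ g → Permutes (K := K) ω π d g → ∃ h, (g, h) ∈ S)
    (hback : ∀ h ∈ B, ∃ g π d, ∃ τ ∈ T, IsSemilinearWith (K := K) τ g ∧ Permutes (K := K) ω π d g ∧
      (g, h) ∈ S)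
    (hB : ∀ g h, ∀ τ ∈ T, IsSemilinearWith (K := K) τ g → (g, h) ∈ S → h ∈ B)
    (hker : ∀ g h, ∀ τ ∈ T, IsSemilinearWith (K := K) τ g → (g, h) ∈ S →
      ((∃ c : Kˣ, ∀ x, g x = c • x) ↔ ∃ c : Lˣ, ∀ x, h x = c • x)) :
    Nonempty (projGroup K A ≃* projGroup L B) := by
  -- f and h are related when a collineation g with the same π, d, τ as f is paired with h in S.
  let R : Subgroup (Equiv.Perm (ι → K) × Equiv.Perm N) :=
    { carrier := {p | ∃ g π d, ∃ τ ∈ T, IsMonomialWith π d τ p.1 ∧ IsSemilinearWith τ g ∧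
        Permutes ω π d g ∧ (g, p.2) ∈ S}
      one_mem' := ⟨1, _, _, 1, T.one_mem, .one, .one, .one, S.one_mem⟩
      mul_mem' := by
        rintro _ _ ⟨g, π, d, τ, h1, h2, h3, h4, h5⟩ ⟨g', π', d', τ', h1', h2', h3', h4', h5'⟩
        exact ⟨g * g', _, _, _, T.mul_mem h1 h1', h2.mul h2', h3.mul h3', h4.mul h3 h4',
          S.mul_mem h5 h5'⟩
      inv_mem' := by
        rintro _ ⟨g, π, d, τ, h1, h2, h3, h4, h5⟩
        exact ⟨g⁻¹, _, _, _, T.inv_mem h1, h2.inv, h3.inv, h4.inv h3, S.inv_mem h5⟩ }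
  refine _root_.nonempty_projGroup_mulEquiv R
    (fun f hf => monomialAut_le_GammaL _ ((hA f).1 hf).1) hBΓ
    (fun f => ?_) (fun h => ?_) ?_
  · rw [hA]
    constructor
    · rintro ⟨hf, π, d, τ, hτ, hm⟩
      obtain ⟨g, hg, hp⟩ := exists_permutes hω.span hf hm
      obtain ⟨h, hh⟩ := hfwd g π d τ hτ hg hp
      exact ⟨h, g, π, d, τ, hτ, hm, hg, hp, hh⟩
    · rintro ⟨h, g, π, d, τ, hτ, hm, hg, hp, -⟩
      exact ⟨hp.mem_monomialAut hg hm, π, d, τ, hτ, hm⟩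
  · constructor
    · intro hh
      obtain ⟨g, π, d, τ, hτ, hg, hp, hS⟩ := hback h hh
      obtain ⟨f, hf⟩ := exists_isMonomialWith π d τ
      exact ⟨f, g, π, d, τ, hτ, hf, hg, hp, hS⟩
    · rintro ⟨f, g, π, d, τ, hτ, hm, hg, hp, hS⟩
      exact hB g h τ hτ hg hS
  · rintro f h ⟨g, π, d, τ, hτ, hm, hg, hp, hS⟩
    rw [hω.scalar_iff hg hp hm, hker g h τ hτ hg hS]

/-- The analogue of `IsProjectiveSystem.nonempty_projGroup_mulEquiv` for permutations of the
coordinates. -/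
theorem IsProjectiveSystem.nonempty_monomialPerm_mulEquiv [Finite W]
    (hω : IsProjectiveSystem K ω) {L N : Type*} [Field L] [AddCommGroup N] [Module L N]
    (S : Subgroup (Equiv.Perm W × Equiv.Perm N)) {B : Subgroup (Equiv.Perm N)}
    (hBΓ : B ≤ GammaL L N)
    (hfwd : ∀ g π d τ, IsSemilinearWith (K := K) τ g → Permutes (K := K) ω π d g → ∃ h, (g, h) ∈ S)
    (hback : ∀ h ∈ B, ∃ g π d τ, IsSemilinearWith (K := K) τ g ∧ Permutes (K := K) ω π d g ∧ (g, h) ∈ S)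
    (hB : ∀ g h, (g, h) ∈ S → h ∈ B)
    (hker : ∀ g h τ, IsSemilinearWith (K := K) τ g → (g, h) ∈ S →
      ((∀ i, ∃ c : K, g (ω i) = c • ω i) ↔ ∃ c : Lˣ, ∀ x, h x = c • x)) :
    Nonempty (monomialPerm (codeOf (K := K) ω) ≃* projGroup L B) := by
  let R : Subgroup (Equiv.Perm ι × Equiv.Perm N) :=
    { carrier := {p | ∃ (g : Equiv.Perm W) (d : ι → Kˣ) (τ : K ≃+* K), IsSemilinearWith τ g ∧
        Permutes ω p.1 d g ∧ (g, p.2) ∈ S}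
      one_mem' := ⟨1, _, _, .one, .one, S.one_mem⟩
      mul_mem' := by
        rintro _ _ ⟨g, d, τ, h3, h4, h5⟩ ⟨g', d', τ', h3', h4', h5'⟩
        exact ⟨g * g', _, _, h3.mul h3', h4.mul h3 h4', S.mul_mem h5 h5'⟩
      inv_mem' := by
        rintro _ ⟨g, d, τ, h3, h4, h5⟩
        exact ⟨g⁻¹, _, _, h3.inv, h4.inv h3, S.inv_mem h5⟩ }
  refine nonempty_perm_mulEquiv_projGroup R hBΓ (fun π => ?_) (fun h => ?_) ?_
  · constructor
    · rintro ⟨f, hf, d, τ, hm⟩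
      obtain ⟨g, hg, hp⟩ := exists_permutes hω.span hf hm
      obtain ⟨h, hh⟩ := hfwd g π d τ hg hp
      exact ⟨h, g, d, τ, hg, hp, hh⟩
    · rintro ⟨h, g, d, τ, hg, hp, -⟩
      obtain ⟨f, hf⟩ := exists_isMonomialWith π d τ
      exact ⟨f, hp.mem_monomialAut hg hf, d, τ, hf⟩
  · constructor
    · intro hh
      obtain ⟨g, π, d, τ, hg, hp, hS⟩ := hback h hh
      exact ⟨π, g, d, τ, hg, hp, hS⟩
    · rintro ⟨π, g, d, τ, hg, hp, hS⟩
      exact hB g h hS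
  · rintro π h ⟨g, d, τ, hg, hp, hS⟩
    rw [← hker g h τ hg hS]
    constructor
    · rintro rfl i
      exact ⟨((d i)⁻¹ : Kˣ), hp i⟩
    · intro hfix
      choose e he using hfix
      exact hω.perm_eq_one hp he

end Code

/-! ### The field involution -/

section FieldFacts

variable {F K : Type*} [Field F] [Fintype F] [Field K] [Algebra F K]

theorem conjHom_apply (x : K) : conjHom F K x = x ^ Fintype.card F := rfl

theorem conjHom_algebraMap (a : F) : conjHom F K (algebraMap F K a) = algebraMap F K a :=
  (FiniteField.frobeniusAlgHom F K).commutes a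

theorem ringEquiv_conjHom (τ : K ≃+* K) (x : K) : τ (conjHom F K x) = conjHom F K (τ x) := by
  rw [conjHom_apply, conjHom_apply, map_pow]

theorem finite_of_finrank_eq_two (hK : Module.finrank F K = 2) : Finite K := by
  have : FiniteDimensional F K := FiniteDimensional.of_finrank_pos (by omega)
  exact Module.finite_of_finite F

/-- The Galois group is generated by the Frobenius x ↦ x ^ q, so its fixed elements form F. -/
theorem exists_algebraMap_eq_of_conjHom (hK : Module.finrank F K = 2) {x : K}
    (hx : conjHom F K x = x) : ∃ a, algebraMap F K a = x := by
  have : FiniteDimensional F K := FiniteDimensional.of_finrank_pos (by omega)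
  have : Finite K := finite_of_finrank_eq_two hK
  have h := (IsGalois.mem_range_algebraMap_iff_fixed (F := F) (E := K) x).2 fun f => by
    obtain ⟨n, hn⟩ := (FiniteField.bijective_frobeniusAlgEquivOfAlgebraic_pow F K).2 f
    rw [← hn]
    have hx' : FiniteField.frobeniusAlgEquivOfAlgebraic F K x = x := hx
    change (FiniteField.frobeniusAlgEquivOfAlgebraic F K ^ n.1) x = x
    generalize n.1 = m
    induction m with
    | zero => rfl
    | succ m ih => rw [pow_succ, AlgEquiv.mul_apply, hx', ih]
  exact h

theorem isUnitaryInvolution_conjHom (hK : Module.finrank F K = 2) :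
    IsUnitaryInvolution (conjHom F K) := by
  have : FiniteDimensional F K := FiniteDimensional.of_finrank_pos (by omega)
  have : Finite K := finite_of_finrank_eq_two hK
  have ho := FiniteField.orderOf_frobeniusAlgHom F K
  rw [hK] at ho
  have hcard : Nat.card K = Fintype.card F ^ 2 := by
    rw [Module.natCard_eq_pow_finrank (K := F), hK, Nat.card_eq_fintype_card]
  refine ⟨fun x => ?_, fun r hr => ?_, ?_⟩
  · have h1 := pow_orderOf_eq_one (FiniteField.frobeniusAlgHom F K)
    rw [ho, pow_two] at h1
    exact DFunLike.congr_fun h1 x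
  · obtain ⟨a, rfl⟩ := exists_algebraMap_eq_of_conjHom hK hr
    obtain ⟨x, hx⟩ := FiniteField.norm_surjective F K a
    refine ⟨x, ?_⟩
    rw [← hx, FiniteField.algebraMap_norm_eq_pow, conjHom_apply, hcard, Nat.card_eq_fintype_card]
    have hq : 1 < Fintype.card F := Fintype.one_lt_card
    -- The norm to F is the power with exponent (q² - 1)/(q - 1) = q + 1, that is, x σ(x).
    have : (Fintype.card F ^ 2 - 1) / (Fintype.card F - 1) = Fintype.card F + 1 := by
      obtain ⟨q, hq'⟩ : ∃ q, Fintype.card F = q + 1 := ⟨Fintype.card F - 1, by omega⟩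
      rw [hq']
      have : (q + 1) ^ 2 - 1 = q * (q + 1 + 1) := by
        have : (q + 1) ^ 2 = q * (q + 1 + 1) + 1 := by ring
        omega
      rw [this, Nat.add_sub_cancel, Nat.mul_div_cancel_left _ (by omega)]
    rw [this, pow_succ, mul_comm]
  · by_contra! h
    have h1 : FiniteField.frobeniusAlgHom F K = 1 := by
      ext x
      exact h x
    rw [h1, orderOf_one] at ho
    omega

theorem nonempty_algHom_of_card_eq {L : Type*} [Field L] [Algebra F L] [Finite K] [Finite L]
    (h : Nat.card K = Nat.card L) : Nonempty (K →ₐ[F] L) := by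
  have : FiniteDimensional F K := Module.Finite.of_finite
  have : FiniteDimensional F L := Module.Finite.of_finite
  refine FiniteField.nonempty_algHom_of_finrank_dvd (dvd_of_eq ?_)
  rw [Module.natCard_eq_pow_finrank (K := F) (V := K),
    Module.natCard_eq_pow_finrank (K := F) (V := L)] at h
  exact Nat.pow_right_injective (Finite.one_lt_card (α := F)) h

/-- Field automorphisms extend to the quadratic extension. -/
theorem exists_ringEquiv_extending (hK : Module.finrank F K = 2) (τ₀ : F ≃+* F) :
    ∃ τ : K ≃+* K, ∀ a, τ (algebraMap F K a) = algebraMap F K (τ₀ a) := by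
  have : Finite K := finite_of_finrank_eq_two hK
  -- The target K carries the F-structure twisted by τ₀; F-embeddings into it are the extensions of
  -- τ₀.
  obtain ⟨φ⟩ := @nonempty_algHom_of_card_eq F K _ _ _ _ K _
    ((algebraMap F K).comp (τ₀ : F →+* F)).toAlgebra _ _ rfl
  let ψ : K →+* K := @AlgHom.toRingHom F K K _ _ _ _
    ((algebraMap F K).comp (τ₀ : F →+* F)).toAlgebra φ
  exact ⟨RingEquiv.ofBijective ψ ⟨ψ.injective, Finite.surjective_of_injective ψ.injective⟩,
    fun a => @AlgHom.commutes F K K _ _ _ _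
      ((algebraMap F K).comp (τ₀ : F →+* F)).toAlgebra φ a⟩

/-- Field automorphisms restrict to the subfield. -/
theorem exists_ringEquiv_restricting (hK : Module.finrank F K = 2) (τ : K ≃+* K) :
    ∃ τ₀ : F ≃+* F, ∀ a, τ (algebraMap F K a) = algebraMap F K (τ₀ a) := by
  have h : ∀ a, ∃ b, algebraMap F K b = τ (algebraMap F K a) := fun a =>
    exists_algebraMap_eq_of_conjHom hK (by rw [← ringEquiv_conjHom, conjHom_algebraMap])
  choose b hb using h
  have hinj := (algebraMap F K).injective
  let φ : F →+* F :=
    { toFun := b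
      map_one' := hinj (by rw [hb, map_one, map_one])
      map_zero' := hinj (by rw [hb, map_zero, map_zero])
      map_add' := fun x y => hinj (by rw [hb, map_add, map_add, map_add, hb, hb])
      map_mul' := fun x y => hinj (by rw [hb, map_mul, map_mul, map_mul, hb, hb]) }
  exact ⟨RingEquiv.ofBijective φ ⟨φ.injective, Finite.surjective_of_injective φ.injective⟩,
    fun a => (hb a).symm⟩

end FieldFacts

/-! ### The Plücker image as a projective system -/

section Plucker

variable {K V : Type*} [Field K] [AddCommGroup V] [Module K V] {σ : K →+* K}
  {η : V →ₛₗ[σ] V →ₗ[K] K} {ω : pluckerImage η 2 → ⋀[K]^2 V}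

theorem IsRepresentatives.isIsotropic (hω : IsRepresentatives (pluckerImage η 2) ω)
    (hη : η.IsSymm) (P : pluckerImage η 2) : IsIsotropicBivector η (ω P) := by
  obtain ⟨h0, hP⟩ := hω P
  rw [← mk_mem_pluckerImage_iff hη h0, hP]
  exact P.2

theorem IsRepresentatives.exists_eq_smul (hω : IsRepresentatives (pluckerImage η 2) ω)
    (hη : η.IsSymm) {z : ⋀[K]^2 V} (hz : IsIsotropicBivector η z) :
    ∃ P, ∃ c : Kˣ, z = c • ω P := by
  let P : pluckerImage η 2 := ⟨_, (mk_mem_pluckerImage_iff hη hz.ne_zero).2 hz⟩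
  obtain ⟨h0, hP⟩ := hω P
  obtain ⟨c, hc⟩ := (Projectivization.mk_eq_mk_iff K z (ω P) hz.ne_zero h0).1 hP.symm
  exact ⟨P, c, hc.symm⟩

/-- The wedge modulo the span of ℍ is an alternating map vanishing on isotropic orthogonal pairs,
hence zero: ℍ spans. -/
theorem IsRepresentatives.isProjectiveSystem [FiniteDimensional K V]
    (hω : IsRepresentatives (pluckerImage η 2) ω)
    (hη : η.IsSymm) (hσ : IsUnitaryInvolution σ) (hnd : NondegOn η ⊤)
    (h4 : 4 ≤ Module.finrank K V) : IsProjectiveSystem K ω := by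
  refine ⟨?_, fun P => (hω P).1, fun P P' c h => ?_⟩
  · rw [eq_top_iff]
    rintro z -
    refine wedge_addSubgroup_eq_top (Submodule.span K (Set.range ω)).toAddSubgroup (fun x y => ?_) z
    have := hnd.alternating_eq_zero hσ hη (by rwa [finrank_top])
      (wedge.compr₂ (Submodule.span K (Set.range ω)).mkQ) (by simp)
      (fun x _ y _ hxx hyy hxy => by
        rw [LinearMap.compr₂_apply, Submodule.mkQ_apply, Submodule.Quotient.mk_eq_zero]
        by_cases h0 : wedge (K := K) x y = 0
        · rw [h0]; exact Submodule.zero_mem _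
        · obtain ⟨P, c, hc⟩ := hω.exists_eq_smul hη ((isIsotropicBivector_wedge hη).2
            ⟨wedge_ne_zero_iff.1 h0, hxx, hyy, hxy⟩)
          rw [hc]
          exact Submodule.smul_mem _ _ (Submodule.subset_span ⟨P, rfl⟩))
      (x := x) (y := y) trivial trivial
    rwa [LinearMap.compr₂_apply, Submodule.mkQ_apply, Submodule.Quotient.mk_eq_zero] at this
  · obtain ⟨h0, hP⟩ := hω P
    obtain ⟨h0', hP'⟩ := hω P'
    ext
    rw [← hP, ← hP']
    exact (Projectivization.mk_eq_mk_iff' K _ _ h0 h0').2 ⟨c, h.symm⟩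

theorem Permutes.preservesIsotropic (hω : IsRepresentatives (pluckerImage η 2) ω) (hη : η.IsSymm)
    {g : Equiv.Perm (⋀[K]^2 V)} {τ : K ≃+* K} (hg : IsSemilinearWith τ g)
    {π : Equiv.Perm (pluckerImage η 2)} {d : pluckerImage η 2 → Kˣ} (hp : Permutes ω π d g) :
    PreservesIsotropic η τ g := by
  have key : ∀ {g : Equiv.Perm (⋀[K]^2 V)} {τ : K ≃+* K} {π : Equiv.Perm (pluckerImage η 2)}
      {d : pluckerImage η 2 → Kˣ}, IsSemilinearWith τ g → Permutes ω π d g →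
      ∀ z, IsIsotropicBivector η z → IsIsotropicBivector η (g z) := by
    intro g τ π d hg hp z hz
    obtain ⟨P, c, rfl⟩ := hω.exists_eq_smul hη hz
    rw [Units.smul_def, hg.2, hp, Units.smul_def, smul_smul]
    exact (hω.isIsotropic hη _).smul (by simp)
  refine ⟨hg, fun z => ⟨fun h => ?_, key hg hp z⟩⟩
  have := key hg.inv (hp.inv hg) _ h
  rwa [perm_inv_apply] at this

theorem PreservesIsotropic.exists_permutes [Finite K] [FiniteDimensional K V]
    (hω : IsRepresentatives (pluckerImage η 2) ω) (hη : η.IsSymm)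
    (hω' : IsProjectiveSystem K ω)
    {g : Equiv.Perm (⋀[K]^2 V)} {τ : K ≃+* K} (hg : PreservesIsotropic η τ g) :
    ∃ π d, Permutes (K := K) ω π d g := by
  have : Finite (⋀[K]^2 V) := Module.finite_of_finite K
  choose π c hc using fun P => hω.exists_eq_smul hη ((hg.iff _).2 (hω.isIsotropic hη P))
  have hinj : Function.Injective π := by
    intro P P' h
    refine hω'.eq_of_smul _ _ (τ.symm (c P * (c P')⁻¹ : Kˣ)) (g.injective ?_)
    rw [hg.semilin.2, hc, hc, h, τ.apply_symm_apply, Units.smul_def, Units.smul_def, smul_smul]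
    simp
  have hfin : Finite (pluckerImage η 2) := Finite.of_injective ω fun P P' h =>
    hω'.eq_of_smul P P' 1 (by rw [h, one_smul])
  exact ⟨Equiv.ofBijective π ⟨hinj, Finite.surjective_of_injective hinj⟩, fun P => (c P)⁻¹,
    fun P => by rw [hc P, inv_inv]; rfl⟩

/-- A semilinear map fixing all isotropic lines is a scalar. -/
theorem exists_scalar_of_fixes_lines [FiniteDimensional K V] (hη : η.IsSymm)
    (hσ : IsUnitaryInvolution σ) (hnd : NondegOn η ⊤) (h4 : 4 ≤ Module.finrank K V)
    {τ : K ≃+* K} {k : Equiv.Perm V} (hk : IsSemilinearWith τ k)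
    (h : ∀ x y, IsIsotropicBivector η (wedge x y) →
      ∃ c : K, wedge (K := K) (k x) (k y) = c • wedge x y) :
    ∃ c : Kˣ, ∀ x, k x = c • x := by
  -- For isotropic x, k x lies on every isotropic line through x, and two of these meet in ⟨x⟩. So k
  -- is compared with the identity, without prior knowledge of τ.
  obtain ⟨c, hc⟩ := hnd.proportional hσ hη (by rwa [finrank_top]) (τ := 1) (A := fun x => x)
    (B := k) (fun _ _ => rfl) (fun _ _ => rfl) (fun _ _ h => h) hk.1 (fun x _ hxx => by
      by_cases hx0 : x = 0
      · exact ⟨0, by rw [hx0, hk.map_zero, zero_smul]⟩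
      obtain ⟨f, -, hxf⟩ := hnd.exists_hypPair hσ hη trivial hx0 hxx
      obtain ⟨u, hu, v, hv, huv⟩ := (hxf.nondegOn hη (S := ⊤) trivial trivial hnd).exists_pair hσ hη
        (by
          have := finrank_le_hypPerp η ⊤ x f
          rw [finrank_top] at this
          omega)
      obtain ⟨-, hxu, hfu⟩ := mem_hypPerp.1 hu
      obtain ⟨-, hxv, hfv⟩ := mem_hypPerp.1 hv
      have hmem : ∀ w, η x w = 0 → η f w = 0 → η w w = 0 → w ≠ 0 →
          k x ∈ Submodule.span K {x, w} := by
        intro w hxw hfw hww hw0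
        have hl : LinearIndependent K ![x, w] :=
          linearIndependent_pair_of_perp (by simp [hxf.fe]) hfw hw0
        obtain ⟨c, hc⟩ := h x w ((isIsotropicBivector_wedge hη).2 ⟨hl, hxx, hww, hxw⟩)
        rw [← map_smul] at hc
        have hl' := LinearIndependent.pair_map (S := ⊤) hk.1 hk.2
          (fun x _ hx => k.injective (hx.trans hk.map_zero.symm)) trivial trivial hl
        obtain ⟨a, b, hab⟩ := Submodule.mem_span_pair.1 (mem_span_pair_of_wedge_eq' hl' hc)
        exact Submodule.mem_span_pair.2 ⟨a, b * c, by rw [mul_smul, hab]⟩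
      obtain ⟨a, b, hab⟩ := Submodule.mem_span_pair.1 (hmem u hxu hfu huv.ee huv.ne_zero)
      obtain ⟨a', b', hab'⟩ := Submodule.mem_span_pair.1 (hmem v hxv hfv huv.ff huv.ne_zero')
      have hb : b = 0 := by
        have hvx : η v x = 0 := hη.eq_iff.1 hxv
        have := congrArg (η v) (hab.trans hab'.symm)
        simpa [hvx, huv.fe, huv.ff] using this
      exact ⟨a, by rw [← hab, hb]; simp⟩)
  obtain ⟨e, -, f, -, hef⟩ := hnd.exists_pair hσ hη (by rw [finrank_top]; omega)
  have hc0 : c ≠ 0 := by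
    rintro rfl
    have := hc e trivial
    rw [zero_smul] at this
    exact hef.ne_zero (k.injective (this.trans hk.map_zero.symm))
  exact ⟨Units.mk0 c hc0, fun x => hc x trivial⟩

end Plucker

/-! ### The automorphism groups in dimension at least six -/

section Large

variable {K V : Type*} [Field K] [AddCommGroup V] [Module K V] {σ : K →+* K}

/-- The pairs `(g, k)` of a semilinear similitude `k` and a multiple `g` of its action on
bivectors. -/
def similitudePairs (η : V →ₛₗ[σ] V →ₗ[K] K) :
    Subgroup (Equiv.Perm (⋀[K]^2 V) × Equiv.Perm V) where
  carrier := {p | p.2 ∈ GammaU η ∧ ∃ τ : K ≃+* K, IsSemilinearWith τ p.1 ∧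
    IsSemilinearWith τ p.2 ∧ ∃ c : Kˣ, ∀ x y, p.1 (wedge x y) = c • wedge (p.2 x) (p.2 y)}
  one_mem' := ⟨one_mem _, 1, .one, .one, 1, fun x y => by simp⟩
  mul_mem' := by
    rintro ⟨g, k⟩ ⟨g', k'⟩ ⟨h1, τ, h2, h3, c, h4⟩ ⟨h1', τ', h2', h3', c', h4'⟩
    refine ⟨mul_mem h1 h1', _, h2.mul h2', h3.mul h3', Units.map (τ : K →* K) c' * c,
      fun x y => ?_⟩
    change g (g' (wedge x y)) = _ • wedge (k (k' x)) (k (k' y))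
    have h5 : g' (wedge x y) = c' • wedge (k' x) (k' y) := h4' x y
    have h6 : g (wedge (k' x) (k' y)) = c • wedge (k (k' x)) (k (k' y)) := h4 _ _
    rw [h5, Units.smul_def, h2.2, h6, mul_smul]
    rfl
  inv_mem' := by
    rintro ⟨g, k⟩ ⟨h1, τ, h2, h3, c, h4⟩
    refine ⟨inv_mem h1, _, h2.inv, h3.inv, Units.map ((τ⁻¹ : K ≃+* K) : K →* K) c⁻¹,
      fun x y => ?_⟩
    change g⁻¹ (wedge x y) = _ • wedge (k⁻¹ x) (k⁻¹ y)
    apply g.injective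
    have h6 : g (wedge (k⁻¹ x) (k⁻¹ y)) = c • wedge (k (k⁻¹ x)) (k (k⁻¹ y)) := h4 _ _
    rw [perm_apply_inv, Units.smul_def, h2.2, h6, perm_apply_inv, perm_apply_inv, Units.smul_def,
      smul_smul]
    simp

variable {η : V →ₛₗ[σ] V →ₗ[K] K} {ω : pluckerImage η 2 → ⋀[K]^2 V}

theorem GammaU_le_GammaL (η : V →ₛₗ[σ] V →ₗ[K] K) : GammaU η ≤ GammaL K V := by
  rintro k ⟨τ, c, hk, -⟩
  exact ⟨τ, hk⟩

theorem exists_preservesIsotropic_of_mem_GammaU (hη : η.IsSymm) {k : Equiv.Perm V}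
    (hk : k ∈ GammaU η) : ∃ (τ : K ≃+* K) (g : Equiv.Perm (⋀[K]^2 V)), IsSemilinearWith τ k ∧
      PreservesIsotropic η τ g ∧ ∀ x y, g (wedge x y) = wedge (k x) (k y) := by
  obtain ⟨τ, c, hτ, hc⟩ := hk
  obtain ⟨g, hg, hgw⟩ := hτ.exists_wedge
  refine ⟨τ, g, hτ, ⟨hg, fun z => ?_⟩, hgw⟩
  have hk0 : ∀ x y, η (k x) (k y) = 0 ↔ η x y = 0 := fun x y => by rw [hc]; simp
  have hg0 : ∀ x y, wedge (K := K) (k x) (k y) ≠ 0 ↔ wedge (K := K) x y ≠ 0 := fun x y => by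
    rw [← hgw]
    exact not_congr ⟨fun h => g.injective (h.trans hg.map_zero.symm),
      fun h => h.symm ▸ hg.map_zero⟩
  constructor
  · rintro ⟨x, y, hl, hxx, hyy, hxy, hz⟩
    rw [← perm_apply_inv k x, ← perm_apply_inv k y, ← hgw] at hz
    rw [g.injective hz, isIsotropicBivector_wedge hη, ← hk0 (k⁻¹ x) (k⁻¹ x),
      ← hk0 (k⁻¹ y) (k⁻¹ y), ← hk0 (k⁻¹ x) (k⁻¹ y), ← wedge_ne_zero_iff, ← hg0]
    simp only [perm_apply_inv]
    exact ⟨wedge_ne_zero_iff.2 hl, hxx, hyy, hxy⟩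
  · rintro ⟨x, y, hl, hxx, hyy, hxy, rfl⟩
    rw [hgw, isIsotropicBivector_wedge hη, hk0, hk0, hk0, ← wedge_ne_zero_iff, hg0]
    exact ⟨wedge_ne_zero_iff.2 hl, hxx, hyy, hxy⟩

/-- Both groups correspond to ΓU through `similitudePairs`. The kernels match because a similitude
whose collineation fixes ℍ pointwise is scalar on V, and its bivector map is then scalar too. -/
theorem pluckerCode_large [Finite K] [FiniteDimensional K V] (hη : η.IsSymm)
    (hσ : IsUnitaryInvolution σ) (hcomm : ∀ (τ : K ≃+* K) x, τ (σ x) = σ (τ x))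
    (hnd : NondegOn η ⊤) (h6 : 6 ≤ Module.finrank K V)
    (hω : IsRepresentatives (pluckerImage η 2) ω) :
    Nonempty (PGammaMonAut (codeOf (K := K) ω) ≃* PGammaU η) ∧
    Nonempty (monomialPerm (codeOf (K := K) ω) ≃* PGammaU η) := by
  have hω' := hω.isProjectiveSystem hη hσ hnd (by omega)
  have : Finite V := Module.finite_of_finite K
  have : Finite (⋀[K]^2 V) := Module.finite_of_finite K
  obtain ⟨e, -, f, -, hef⟩ := hnd.exists_pair hσ hη (by rw [finrank_top]; omega)
  have : Nontrivial V := ⟨e, 0, hef.ne_zero⟩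
  have : Nontrivial (⋀[K]^2 V) := ⟨wedge e f, 0, wedge_ne_zero_iff.2
    (linearIndependent_pair_of_perp (f := f) (by simp [hef.fe]) hef.ff hef.ne_zero')⟩
  have hfwd : ∀ g π d τ, IsSemilinearWith (K := K) τ g → Permutes (K := K) ω π d g →
      ∃ k, (g, k) ∈ similitudePairs η := by
    intro g π d τ hg hp
    obtain ⟨k, hk, hkτ, c, hc, h⟩ := (hp.preservesIsotropic hω hη hg).exists_similitude hη hσ hnd h6
      (hcomm τ)
    exact ⟨k, hk, τ, hg, hkτ, Units.mk0 c hc, h⟩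
  have hback : ∀ k ∈ GammaU η, ∃ g π d τ, IsSemilinearWith (K := K) τ g ∧
      Permutes (K := K) ω π d g ∧ (g, k) ∈ similitudePairs η := by
    intro k hk
    obtain ⟨τ, g, hτ, hg, hgw⟩ := exists_preservesIsotropic_of_mem_GammaU hη hk
    obtain ⟨π, d, hp⟩ := hg.exists_permutes hω hη hω'
    exact ⟨g, π, d, τ, hg.semilin, hp, hk, τ, hg.semilin, hτ, 1, fun x y => by
      rw [hgw, one_smul]⟩
  have hscal : ∀ g k, (g, k) ∈ similitudePairs η → (∃ c : Kˣ, ∀ x, k x = c • x) →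
      ∃ c : Kˣ, ∀ z, g z = c • z := by
    rintro g k ⟨-, τ, hg, hk, c, h⟩ ⟨a, ha⟩
    refine ⟨c * a * a, fun z => ?_⟩
    refine eq_of_eq_on_wedge (f := g) (g := fun z => (c * a * a) • z) hg.1
      (fun x y => smul_add _ _ _) (fun x y => ?_) z
    have h1 : g (wedge x y) = c • wedge (k x) (k y) := h x y
    rw [h1, ha, ha, mul_smul, mul_smul, Units.smul_def a x, Units.smul_def a y]
    simp only [map_smul, LinearMap.smul_apply]
    rfl
  have hscal' : ∀ g k, (g, k) ∈ similitudePairs η → (∀ P, ∃ c : K, g (ω P) = c • ω P) →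
      ∃ c : Kˣ, ∀ x, k x = c • x := by
    rintro g k ⟨-, τ, hg, hk, c, h⟩ hfix
    refine exists_scalar_of_fixes_lines hη hσ hnd (by omega) hk fun x y hxy => ?_
    obtain ⟨P, a, ha⟩ := hω.exists_eq_smul hη hxy
    obtain ⟨b, hb⟩ := hfix P
    have h1 : g (wedge x y) = c • wedge (k x) (k y) := h x y
    refine ⟨(c⁻¹ : Kˣ) * (τ a * b * (a⁻¹ : Kˣ)), ?_⟩
    have h2 : ω P = a⁻¹ • wedge x y := by rw [ha, inv_smul_smul]
    rw [ha, Units.smul_def, hg.2, hb, h2, ← inv_smul_eq_iff] at h1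
    rw [← h1]
    simp only [Units.smul_def, smul_smul, mul_assoc]
  constructor
  · refine hω'.nonempty_projGroup_mulEquiv (similitudePairs η) ⊤ (GammaU_le_GammaL η)
      (fun f => ⟨fun hf => ⟨hf, ?_⟩, fun hf => hf.1⟩) (fun g π d τ _ => hfwd g π d τ)
      (fun k hk => ?_) (fun g k τ _ _ h => h.1) (fun g k τ _ hg h => ⟨fun ⟨c, hc⟩ => ?_, hscal g k h⟩)
    · obtain ⟨π, d, τ, h⟩ := hf.1
      exact ⟨π, d, τ, trivial, h⟩
    · obtain ⟨g, π, d, τ, h⟩ := hback k hk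
      exact ⟨g, π, d, τ, trivial, h⟩
    · exact hscal' g k h fun P => ⟨c, hc _⟩
  · refine hω'.nonempty_monomialPerm_mulEquiv (similitudePairs η) (GammaU_le_GammaL η) hfwd hback
      (fun g k h => h.1) (fun g k τ hg h => ⟨hscal' g k h, fun hk P => ?_⟩)
    obtain ⟨c, hc⟩ := hscal g k h hk
    exact ⟨c, hc _⟩

end Large

/-! ### An elliptic quadratic form in six variables -/

section Elliptic

variable {F : Type*} [Field F]

/-- The form `u₀u₁ + δu₂u₃ - (u₄² + t u₄u₅ + n u₅²)` with `δ = t² - 4n`. -/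
noncomputable def ellipticForm (t n : F) : QuadraticForm F (Fin 6 → F) :=
  let p : Fin 6 → (Fin 6 → F) →ₗ[F] F := fun i => LinearMap.proj i
  QuadraticMap.linMulLin (p 0) (p 1) + (t ^ 2 - 4 * n) • QuadraticMap.linMulLin (p 2) (p 3) -
    (QuadraticMap.linMulLin (p 4) (p 4) + t • QuadraticMap.linMulLin (p 4) (p 5) +
      n • QuadraticMap.linMulLin (p 5) (p 5))

theorem ellipticForm_apply (t n : F) (u : Fin 6 → F) : ellipticForm t n u =
    u 0 * u 1 + (t ^ 2 - 4 * n) * (u 2 * u 3) -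
      (u 4 ^ 2 + t * (u 4 * u 5) + n * u 5 ^ 2) := by
  simp [ellipticForm, pow_two]

theorem ellipticForm_polar (t n : F) (u v : Fin 6 → F) :
    QuadraticMap.polar (ellipticForm t n) u v =
    u 0 * v 1 + u 1 * v 0 + (t ^ 2 - 4 * n) * (u 2 * v 3 + u 3 * v 2) -
      (2 * (u 4 * v 4) + t * (u 4 * v 5 + u 5 * v 4) + 2 * n * (u 5 * v 5)) := by
  simp only [QuadraticMap.polar, ellipticForm_apply, Pi.add_apply]
  ring

variable {t n : F}

theorem ellipticForm_polar_nondegenerate (hδ : t ^ 2 - 4 * n ≠ 0) :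
    (ellipticForm t n).polarBilin.Nondegenerate := by
  have key : ∀ u : Fin 6 → F, (∀ v, QuadraticMap.polar (ellipticForm t n) u v = 0) → u = 0 := by
    intro u hu
    have h : ∀ i, QuadraticMap.polar (ellipticForm t n) u (Pi.single i 1) = 0 := fun i => hu _
    simp only [ellipticForm_polar] at h
    have h0 := h 0
    have h1 := h 1
    have h2 := h 2
    have h3 := h 3
    have h4 := h 4
    have h5 := h 5
    simp [hδ] at h0 h1 h2 h3 h4 h5
    have h5' : u 5 = 0 := by
      -- The equations in u 4 and u 5 form a 2 × 2 system with determinant t² - 4n up to sign,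
      -- nonzero also in characteristic two.
      refine (mul_eq_zero.1 (?_ : (t ^ 2 - 4 * n) * u 5 = 0)).resolve_left hδ
      linear_combination -t * h4 + 2 * h5
    have h4' : u 4 = 0 := by
      refine (mul_eq_zero.1 (?_ : (t ^ 2 - 4 * n) * u 4 = 0)).resolve_left hδ
      linear_combination -t * h5 + 2 * n * h4
    ext i
    fin_cases i <;> simp [h0, h1, h2, h3, h4', h5']
  refine ⟨fun u hu => key u hu, fun u hu => key u fun v => ?_⟩
  rw [QuadraticMap.polar_comm]
  exact hu v

/-- The anisotropic part of the form. -/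
def IsAnisotropicPair (t n : F) : Prop := ∀ a b : F, a ^ 2 + t * (a * b) + n * b ^ 2 = 0 →
  a = 0 ∧ b = 0

theorem exists_mem_of_three_le {S : Submodule F (Fin 6 → F)} (hS : 3 ≤ Module.finrank F S)
    (i j : Fin 6) : ∃ s ∈ S, s ≠ 0 ∧ s i = 0 ∧ s j = 0 := by
  have h1 := finrank_le_inf_ker S (LinearMap.proj i)
  have h2 := finrank_le_inf_ker (S ⊓ LinearMap.ker (LinearMap.proj i)) (LinearMap.proj j)
  obtain ⟨s, hs, hs0⟩ := exists_mem_ne_zero_of_finrank_pos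
    (S := S ⊓ LinearMap.ker (LinearMap.proj i) ⊓ LinearMap.ker (LinearMap.proj j)) (by omega)
  exact ⟨s, hs.1.1, hs0, hs.1.2, hs.2⟩

theorem ellipticForm_isElliptic (hδ : t ^ 2 - 4 * n ≠ 0) (han : IsAnisotropicPair t n) :
    IsElliptic (ellipticForm t n) := by
  refine ⟨ellipticForm_polar_nondegenerate hδ,
    ⟨Submodule.span F {Pi.single 0 1, Pi.single 2 1}, ?_, ?_⟩, fun S hS => ?_⟩
  · have hli : LinearIndependent F ![(Pi.single 0 1 : Fin 6 → F), Pi.single 2 1] := by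
      rw [LinearIndependent.pair_iff]
      intro a b hab
      exact ⟨by simpa using congrFun hab 0, by simpa using congrFun hab 2⟩
    have := finrank_span_eq_card hli
    rw [range_pair] at this
    simpa using this
  · intro x hx
    obtain ⟨a, b, rfl⟩ := Submodule.mem_span_pair.1 hx
    simp [ellipticForm_apply]
  · by_contra! hlt
    have h3 : 3 ≤ Module.finrank F S := hlt
    have hzero : ∀ {s}, s ∈ S → s 0 * s 1 = 0 → s 2 * s 3 = 0 → s 4 = 0 ∧ s 5 = 0 := by
      intro s hs h1 h2
      have := hS s hs
      rw [ellipticForm_apply, h1, h2] at this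
      exact han _ _ (by linear_combination -this)
    -- Take nonzero s with s i = s 3 = 0 and r with r i = r 2 = 0 in S. Their anisotropic parts
    -- vanish, and singularity of s + r leaves s 2 * r 3 = 0, so one of them lives on a single
    -- coordinate among 0 and 1.
    have hone : ∀ i : Fin 6, (i = 0 ∨ i = 1) →
        ∃ s ∈ S, s ≠ 0 ∧ s i = 0 ∧ s 2 = 0 ∧ s 3 = 0 ∧ s 4 = 0 ∧ s 5 = 0 := by
      intro i hi
      obtain ⟨s, hs, hs0, hsi, hs3⟩ := exists_mem_of_three_le h3 i 3
      obtain ⟨r, hr, hr0, hri, hr2⟩ := exists_mem_of_three_le h3 i 2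
      have hs01 : s 0 * s 1 = 0 := by rcases hi with rfl | rfl <;> simp [hsi]
      have hr01 : r 0 * r 1 = 0 := by rcases hi with rfl | rfl <;> simp [hri]
      have hsr : s 0 * r 1 + s 1 * r 0 = 0 := by rcases hi with rfl | rfl <;> simp [hsi, hri]
      obtain ⟨hs4, hs5⟩ := hzero hs hs01 (by rw [hs3, mul_zero])
      obtain ⟨hr4, hr5⟩ := hzero hr hr01 (by rw [hr2, zero_mul])
      have hsum := hS _ (S.add_mem hs hr)
      rw [ellipticForm_apply] at hsum
      simp only [Pi.add_apply, hs3, hs4, hs5, hr2, hr4, hr5] at hsum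
      have h23 : s 2 * r 3 = 0 := by
        refine (mul_eq_zero.1 (?_ : (t ^ 2 - 4 * n) * (s 2 * r 3) = 0)).resolve_left hδ
        linear_combination hsum - hs01 - hr01 - hsr
      rcases mul_eq_zero.1 h23 with h | h
      · exact ⟨s, hs, hs0, hsi, h, hs3, hs4, hs5⟩
      · exact ⟨r, hr, hr0, hri, hr2, h, hr4, hr5⟩
    obtain ⟨a, ha, ha0, a1, a2, a3, a4, a5⟩ := hone 1 (Or.inr rfl)
    obtain ⟨b, hb, hb0, b0, b2, b3, b4, b5⟩ := hone 0 (Or.inl rfl)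
    -- a and b are nonzero multiples of the first two unit vectors, whose sum is not singular.
    have hsum := hS _ (S.add_mem ha hb)
    rw [ellipticForm_apply] at hsum
    simp [a1, a2, a3, a4, a5, b0, b2, b3, b4, b5] at hsum
    rcases hsum with h | h
    · apply ha0; ext i; fin_cases i <;> simp [h, a1, a2, a3, a4, a5]
    · apply hb0; ext i; fin_cases i <;> simp [h, b0, b2, b3, b4, b5]

/-- The form is determined up to a scalar by its singular vectors. -/
theorem ellipticForm_unique (hδ : t ^ 2 - 4 * n ≠ 0) {Q : QuadraticForm F (Fin 6 → F)}
    (h : ∀ u, ellipticForm t n u = 0 → Q u = 0) : ∃ c, ∀ u, Q u = c * ellipticForm t n u := by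
  set B := Q.polarBilin with hB
  have hadd : ∀ x y, Q (x + y) = Q x + Q y + B x y := fun x y => QuadraticMap.map_add Q x y
  have hBs : ∀ x y, B x y = B y x := fun x y => QuadraticMap.polar_comm _ _ _
  let e : Fin 6 → Fin 6 → F := fun i => Pi.single i 1
  let k : F → F → Fin 6 → F := fun a b => a • e 4 + b • e 5
  let N : F → F → F := fun a b => a ^ 2 + t * (a * b) + n * b ^ 2
  have he0 : ∀ x : F, Q (x • e 0) = 0 := fun x => h _ (by simp [ellipticForm_apply, e])
  have he1 : ∀ x : F, Q (x • e 1) = 0 := fun x => h _ (by simp [ellipticForm_apply, e])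
  have he2 : ∀ x : F, Q (x • e 2) = 0 := fun x => h _ (by simp [ellipticForm_apply, e])
  have he3 : ∀ x : F, Q (x • e 3) = 0 := fun x => h _ (by simp [ellipticForm_apply, e])
  have horth : ∀ u v, ellipticForm t n u = 0 → ellipticForm t n v = 0 →
      ellipticForm t n (u + v) = 0 → B u v = 0 := by
    intro u v hu hv huv
    have := h _ huv
    rw [hadd, h u hu, h v hv] at this
    simpa using this
  have b02 : B (e 0) (e 2) = 0 := horth _ _ (by simp [ellipticForm_apply, e])
    (by simp [ellipticForm_apply, e])
    (by simp [ellipticForm_apply, e])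
  have b03 : B (e 0) (e 3) = 0 := horth _ _ (by simp [ellipticForm_apply, e])
    (by simp [ellipticForm_apply, e])
    (by simp [ellipticForm_apply, e])
  have b12 : B (e 1) (e 2) = 0 := horth _ _ (by simp [ellipticForm_apply, e])
    (by simp [ellipticForm_apply, e])
    (by simp [ellipticForm_apply, e])
  have b13 : B (e 1) (e 3) = 0 := horth _ _ (by simp [ellipticForm_apply, e])
    (by simp [ellipticForm_apply, e])
    (by simp [ellipticForm_apply, e])
  -- Each hyperbolic plane completes an anisotropic vector to a singular one. Pairing it with a
  -- singular vector of the other plane makes that vector Q-orthogonal to k a b, and the values of Q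
  -- on the three blocks can then be compared.
  have s01 : ∀ a b, ellipticForm t n (k a b + N a b • e 0 + e 1) = 0 := by
    intro a b
    simp [ellipticForm_apply, e, k, N]
  have s23 : ∀ a b, ellipticForm t n (k a b + (N a b / (t ^ 2 - 4 * n)) • e 2 + e 3) = 0 := by
    intro a b
    simp [ellipticForm_apply, e, k, N]
    field_simp
    ring
  have bk0 : ∀ a b, B (e 0) (k a b) = 0 := by
    intro a b
    have := horth (e 0) _ (by simp [ellipticForm_apply, e]) (s23 a b) (by
      have := s23 a b
      rw [ellipticForm_apply] at this ⊢
      simpa [e, k] using this)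
    simpa [b02, b03] using this
  have bk1 : ∀ a b, B (e 1) (k a b) = 0 := by
    intro a b
    have := horth (e 1) _ (by simp [ellipticForm_apply, e]) (s23 a b) (by
      have := s23 a b
      rw [ellipticForm_apply] at this ⊢
      simpa [e, k] using this)
    simpa [b12, b13] using this
  have bk2 : ∀ a b, B (e 2) (k a b) = 0 := by
    intro a b
    have := horth (e 2) _ (by simp [ellipticForm_apply, e]) (s01 a b) (by
      have := s01 a b
      rw [ellipticForm_apply] at this ⊢
      simpa [e, k] using this)
    simpa [hBs (e 2) (e 0), hBs (e 2) (e 1), b02, b12] using this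
  have bk3 : ∀ a b, B (e 3) (k a b) = 0 := by
    intro a b
    have := horth (e 3) _ (by simp [ellipticForm_apply, e]) (s01 a b) (by
      have := s01 a b
      rw [ellipticForm_apply] at this ⊢
      simpa [e, k] using this)
    simpa [hBs (e 3) (e 0), hBs (e 3) (e 1), b03, b13] using this
  set c := B (e 0) (e 1) with hc
  have hk : ∀ a b, Q (k a b) = -(N a b * c) := by
    intro a b
    have h1 := h _ (s01 a b)
    have h2 := he1 1
    rw [one_smul] at h2
    rw [hadd, hadd, he0, h2] at h1
    simp only [map_add, map_smul, LinearMap.add_apply, LinearMap.smul_apply, smul_eq_mul,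
      hBs (k a b), bk0, bk1, ← hc] at h1
    linear_combination h1
  have hc' : B (e 2) (e 3) = (t ^ 2 - 4 * n) * c := by
    have h1 := h _ (s23 1 0)
    have h2 := he3 1
    rw [one_smul] at h2
    rw [hadd, hadd, he2, h2, hk] at h1
    have hN : N 1 0 = 1 := by simp [N]
    simp only [map_add, map_smul, LinearMap.add_apply, LinearMap.smul_apply, smul_eq_mul,
      hBs (k 1 0), bk2, bk3, hN] at h1
    field_simp at h1
    linear_combination h1
  refine ⟨c, fun u => ?_⟩
  have hu : u = u 0 • e 0 + u 1 • e 1 + u 2 • e 2 + u 3 • e 3 + k (u 4) (u 5) := by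
    ext i
    fin_cases i <;> simp [e, k]
  rw [ellipticForm_apply]
  conv_lhs => rw [hu]
  rw [hadd, hadd, hadd, hadd, he0, he1, he2, he3, hk]
  simp only [map_add, map_smul, LinearMap.add_apply, LinearMap.smul_apply, smul_eq_mul,
    bk0, bk1, bk2, bk3, b02, b03, b12, b13, ← hc, hc', N]
  ring

/-- A property of singular vectors that passes along singular lines and is linear holds for all
vectors. -/
theorem ellipticForm_frame_induction {T : Submodule F (Fin 6 → F)} (h2 : Pi.single 2 1 ∈ T)
    (h : ∀ u v, ellipticForm t n u = 0 → ellipticForm t n v = 0 → ellipticForm t n (u + v) = 0 →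
      v ≠ 0 → (∀ a : F, u ≠ a • v) → v ∈ T → u ∈ T) : T = ⊤ := by
  let e : Fin 6 → Fin 6 → F := fun i => Pi.single i 1
  have hne : ∀ i, e i ≠ 0 := fun i => by simp [e]
  have hnot : ∀ (u : Fin 6 → F) (i j : Fin 6), i ≠ j → u i = 1 → ∀ a : F, u ≠ a • e j := by
    rintro u i j hij hu a rfl
    simp [e, hij] at hu
  have he0 : e 0 ∈ T := h (e 0) (e 2) (by simp [ellipticForm_apply, e])
    (by simp [ellipticForm_apply, e])
    (by simp [ellipticForm_apply, e]) (hne 2)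
    (hnot _ 0 2 (by decide) (by simp [e])) h2
  have he1 : e 1 ∈ T := h (e 1) (e 2) (by simp [ellipticForm_apply, e])
    (by simp [ellipticForm_apply, e])
    (by simp [ellipticForm_apply, e]) (hne 2)
    (hnot _ 1 2 (by decide) (by simp [e])) h2
  have he3 : e 3 ∈ T := h (e 3) (e 0) (by simp [ellipticForm_apply, e])
    (by simp [ellipticForm_apply, e])
    (by simp [ellipticForm_apply, e]) (hne 0)
    (hnot _ 3 0 (by decide) (by simp [e])) he0
  -- The first plane compensates the values -1 and -n of the form at e 4 and e 5; both sums are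
  -- orthogonal to e 2.
  have hs4 : e 4 + e 0 + e 1 ∈ T := h _ (e 2) (by simp [ellipticForm_apply, e])
    (by simp [ellipticForm_apply, e])
    (by simp [ellipticForm_apply, e]) (hne 2)
    (hnot _ 1 2 (by decide) (by simp [e])) h2
  have hs5 : e 5 + n • e 0 + e 1 ∈ T := h _ (e 2)
    (by simp [ellipticForm_apply, e])
    (by simp [ellipticForm_apply, e])
    (by simp [ellipticForm_apply, e]) (hne 2)
    (hnot _ 1 2 (by decide) (by simp [e])) h2
  have he4 : e 4 ∈ T := by
    have := T.sub_mem (T.sub_mem hs4 he1) he0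
    simpa using this
  have he5 : e 5 ∈ T := by
    have := T.sub_mem (T.sub_mem hs5 he1) (T.smul_mem n he0)
    simpa using this
  rw [eq_top_iff]
  rintro u -
  have hu : u = u 0 • e 0 + u 1 • e 1 + u 2 • e 2 + u 3 • e 3 + u 4 • e 4 + u 5 • e 5 := by
    ext i
    fin_cases i <;> simp [e]
  rw [hu]
  exact T.add_mem (T.add_mem (T.add_mem (T.add_mem (T.add_mem (T.smul_mem _ he0)
    (T.smul_mem _ he1)) (T.smul_mem _ h2)) (T.smul_mem _ he3)) (T.smul_mem _ he4))
    (T.smul_mem _ he5)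

/-- A semilinear bijection that preserves the singular vectors is a semilinear similitude. -/
theorem mem_GammaO_of_singular (hδ : t ^ 2 - 4 * n ≠ 0) {τ : F ≃+* F}
    {h : Equiv.Perm (Fin 6 → F)} (hh : IsSemilinearWith τ h)
    (hs : ∀ u, ellipticForm t n u = 0 → ellipticForm t n (h u) = 0) :
    h ∈ GammaO (ellipticForm t n) := by
  let q : (Fin 6 → F) → F := fun u => τ.symm (ellipticForm t n (h u))
  have hpol : ∀ x y, QuadraticMap.polar q x y =
      τ.symm (QuadraticMap.polar (ellipticForm t n) (h x) (h y)) := by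
    intro x y
    simp only [QuadraticMap.polar, q, hh.1, map_sub]
  let Q : QuadraticForm F (Fin 6 → F) := QuadraticMap.ofPolar q
    (fun a x => by simp [q, hh.2, QuadraticMap.map_smul])
    (fun x x' y => by simp only [hpol, hh.1, QuadraticMap.polar_add_left, map_add])
    (fun a x y => by
      simp only [hpol, hh.2, QuadraticMap.polar_smul_left, smul_eq_mul, map_mul,
        τ.symm_apply_apply])
  obtain ⟨c, hc⟩ := ellipticForm_unique hδ (Q := Q) (fun u hu => by
    change τ.symm _ = 0
    rw [hs u hu, map_zero])
  have hc' : ∀ u, ellipticForm t n (h u) = τ c * τ (ellipticForm t n u) := by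
    intro u
    rw [← map_mul, ← hc]
    exact (τ.apply_symm_apply _).symm
  have hc0 : τ c ≠ 0 := by
    intro h0
    -- The form takes the value 1 at this vector, so it cannot vanish on the image of h.
    have h1 := hc' (h⁻¹ (Pi.single 0 1 + Pi.single 1 1))
    rw [perm_apply_inv, h0, zero_mul] at h1
    simp [ellipticForm_apply] at h1
  exact ⟨τ, Units.mk0 _ hc0, hh, hc'⟩

end Elliptic

/-! ### Collineations preserving a quadric of a subgeometry -/

section Subgeometry

variable {F K W ι : Type*} [Field F] [Field K] [Algebra F K] [AddCommGroup W] [Module K W]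
  [Fintype ι] (b : Module.Basis ι K W)

/-- The embedding of `F^ι` in `W` as the `F`-span of a `K`-basis `b`. -/
noncomputable def subEmb (u : ι → F) : W := ∑ i, algebraMap F K (u i) • b i

variable {b}

theorem subEmb_add (u v : ι → F) : subEmb b (u + v) = subEmb b u + subEmb b v := by
  simp [subEmb, add_smul, Finset.sum_add_distrib]

theorem subEmb_smul (a : F) (u : ι → F) : subEmb b (a • u) = algebraMap F K a • subEmb b u := by
  simp [subEmb, Finset.smul_sum, smul_smul]

theorem repr_subEmb (u : ι → F) (i : ι) : b.repr (subEmb b u) i = algebraMap F K (u i) := by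
  classical
  simp [subEmb, Finsupp.single_apply, Algebra.smul_def]

theorem subEmb_injective : Function.Injective (subEmb b : (ι → F) → W) := by
  intro u v h
  ext i
  apply (algebraMap F K).injective
  rw [← repr_subEmb (b := b), h, repr_subEmb]

theorem subEmb_zero : subEmb b (0 : ι → F) = 0 := by simp [subEmb]

theorem subEmb_sum {κ : Type*} (s : Finset κ) (x : κ → ι → F) :
    subEmb b (∑ i ∈ s, x i) = ∑ i ∈ s, subEmb b (x i) := by
  classical
  induction s using Finset.induction_on with
  | empty => simp [subEmb_zero]
  | insert i s hi ih => rw [Finset.sum_insert hi, Finset.sum_insert hi, subEmb_add, ih]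

theorem subEmb_eq_zero {u : ι → F} : subEmb b u = 0 ↔ u = 0 := by
  rw [← subEmb_zero (F := F) (b := b), subEmb_injective.eq_iff]

theorem subEmb_single [DecidableEq ι] (i : ι) : subEmb b (Pi.single i 1 : ι → F) = b i := by
  simp [subEmb, Pi.single_apply]

/-- The factor is the quotient of two coordinates, both in F: points of the subgeometry have
representatives unique up to F. -/
theorem exists_of_subEmb_eq_smul {u v : ι → F} (hv : v ≠ 0) {k : K}
    (h : subEmb b u = k • subEmb b v) : ∃ a : F, k = algebraMap F K a ∧ u = a • v := by
  obtain ⟨i, hi⟩ := Function.ne_iff.1 hv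
  have hi' : algebraMap F K (v i) ≠ 0 := by simpa using hi
  have h1 : k = algebraMap F K (u i / v i) := by
    have := congrArg (fun w => b.repr w i) h
    simp only [map_smul, Finsupp.smul_apply, repr_subEmb, smul_eq_mul] at this
    rw [map_div₀, this, mul_div_cancel_right₀ _ hi']
  refine ⟨_, h1, ?_⟩
  apply subEmb_injective (b := b)
  rw [subEmb_smul, ← h1, h]

/-- The pairs of a semilinear map of `W` and a semilinear similitude of `Q` that induce the same
map on the points of the subgeometry. -/
def quadricPairs (b : Module.Basis ι K W) (Q : QuadraticForm F (ι → F)) :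
    Subgroup (Equiv.Perm W × Equiv.Perm (ι → F)) where
  carrier := {p | p.2 ∈ GammaO Q ∧ ∃ τ : K ≃+* K, IsSemilinearWith τ p.1 ∧
    ∃ c : Kˣ, ∀ u, p.1 (subEmb b u) = (c : K) • subEmb b (p.2 u)}
  one_mem' := ⟨one_mem _, 1, .one, 1, fun u => by simp⟩
  mul_mem' := by
    rintro p p' ⟨h, τ, hg, c, hc⟩ ⟨h', τ', hg', c', hc'⟩
    refine ⟨mul_mem h h', τ * τ', hg.mul hg', Units.map (τ : K →* K) c' * c, fun u => ?_⟩
    simp [hc', hg.2, hc, smul_smul]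
  inv_mem' := by
    rintro p ⟨h, τ, hg, c, hc⟩
    refine ⟨inv_mem h, τ⁻¹, hg.inv, Units.map ((τ⁻¹ : K ≃+* K) : K →* K) c⁻¹, fun u => ?_⟩
    apply p.1.injective
    rw [Prod.fst_inv, perm_apply_inv, hg.2, hc, Prod.snd_inv, perm_apply_inv, smul_smul]
    simp

variable {Q : QuadraticForm F (ι → F)}
  {g : Equiv.Perm W} {h : Equiv.Perm (ι → F)}

/-- `z` is a nonzero vector on a point of the quadric `Q = 0` of the subgeometry. -/
def IsQuadricVector (b : Module.Basis ι K W) (Q : QuadraticForm F (ι → F)) (z : W) : Prop :=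
  ∃ u : ι → F, u ≠ 0 ∧ Q u = 0 ∧ ∃ c : K, c ≠ 0 ∧ z = c • subEmb b u

theorem isQuadricVector_subEmb {u : ι → F} (hu : u ≠ 0) (hQ : Q u = 0) :
    IsQuadricVector b Q (subEmb b u) := ⟨u, hu, hQ, 1, one_ne_zero, (one_smul _ _).symm⟩

theorem IsQuadricVector.map_of_mem (hgh : (g, h) ∈ quadricPairs b Q) {z : W}
    (hz : IsQuadricVector b Q z) : IsQuadricVector b Q (g z) := by
  obtain ⟨⟨τ₀, c₀, hh, hQ⟩, τ, hg, c, hc⟩ := hgh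
  obtain ⟨u, hu, hQu, k, hk, rfl⟩ := hz
  refine ⟨h u, fun h0 => hu (h.injective (h0.trans hh.map_zero.symm)), ?_, τ k * c, by simp [hk], ?_⟩
  · rw [hQ, hQu, map_zero, mul_zero]
  · rw [hg.2, hc, smul_smul]

theorem isQuadricVector_apply_iff (hgh : (g, h) ∈ quadricPairs b Q) (z : W) :
    IsQuadricVector b Q (g z) ↔ IsQuadricVector b Q z := by
  refine ⟨fun hz => ?_, fun hz => hz.map_of_mem hgh⟩
  have := hz.map_of_mem (g := g⁻¹) (h := h⁻¹) (inv_mem hgh)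
  rwa [perm_inv_apply] at this

/-- A semilinear similitude of the quadratic form extends to `W`. -/
theorem exists_mem_quadricPairs [Finite W] (hh : h ∈ GammaO Q) {τ₀ : F ≃+* F}
    (hτ₀ : IsSemilinearWith τ₀ h) {τ : K ≃+* K}
    (hτ : ∀ a, τ (algebraMap F K a) = algebraMap F K (τ₀ a)) :
    ∃ g : Equiv.Perm W, IsSemilinearWith τ g ∧ (g, h) ∈ quadricPairs b Q := by
  classical
  let e : ι → ι → F := fun i => Pi.single i 1
  let g : W → W := fun w => ∑ i, τ (b.repr w i) • subEmb b (h (e i))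
  have hadd : ∀ x y, g (x + y) = g x + g y := fun x y => by
    simp [g, add_smul, Finset.sum_add_distrib]
  have hsmul : ∀ (c : K) x, g (c • x) = τ c • g x := fun c x => by
    simp [g, Finset.smul_sum, smul_smul]
  have hsum : ∀ (s : Finset ι) (x : ι → W), g (∑ i ∈ s, x i) = ∑ i ∈ s, g (x i) := fun s x =>
    map_sum (AddMonoidHom.mk' g hadd) x s
  have hbi : ∀ i, g (b i) = subEmb b (h (e i)) := fun i => by
    simp [g, Finsupp.single_apply]
  have hhsum : ∀ (s : Finset ι) (x : ι → ι → F), h (∑ i ∈ s, x i) = ∑ i ∈ s, h (x i) := fun s x =>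
    map_sum (AddMonoidHom.mk' (fun u => h u) hτ₀.1) x s
  have hemb : ∀ u, g (subEmb b u) = subEmb b (h u) := by
    intro u
    have hu : u = ∑ i, u i • e i := by
      ext j
      simp [e, Pi.single_apply]
    have h1 : h u = ∑ i, τ₀ (u i) • h (e i) := by
      conv_lhs => rw [hu, hhsum]
      simp only [hτ₀.2]
    rw [h1, subEmb_sum, subEmb, hsum]
    simp only [hsmul, hbi, subEmb_smul, hτ]
  have hsurj : Function.Surjective g := by
    intro w
    refine ⟨∑ i, τ.symm (b.repr w i) • subEmb b (h⁻¹ (e i)), ?_⟩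
    rw [hsum]
    simp only [hsmul, hemb, perm_apply_inv, RingEquiv.apply_symm_apply]
    conv_rhs => rw [← b.sum_repr w]
    simp only [e, subEmb_single]
  exact ⟨Equiv.ofBijective g ⟨Finite.injective_iff_surjective.2 hsurj, hsurj⟩, ⟨hadd, hsmul⟩, hh, τ,
    ⟨hadd, hsmul⟩, 1, fun u => by rw [Units.val_one, one_smul]; exact hemb u⟩

theorem linear_of_mem_quadricPairs (hgh : (g, h) ∈ quadricPairs b Q)
    (hg : IsSemilinearWith (1 : K ≃+* K) g) : h ∈ linearMaps F (ι → F) := by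
  obtain ⟨⟨τ₀, c₀, hh, hQ⟩, τ, -, c, hc⟩ := hgh
  refine ⟨hh.1, fun a u => ?_⟩
  apply subEmb_injective (b := b)
  apply smul_right_injective W c.ne_zero
  have := hc (a • u)
  simp only at this hc ⊢
  rw [← this, subEmb_smul, hg.2, hc, RingAut.one_apply, RingAut.one_apply, subEmb_smul, smul_comm]

/-- Only points of the subgeometry are claimed to be fixed: g may act as conjugation on the
coordinates and need not be scalar on W. -/
theorem exists_smul_of_scalar (hgh : (g, h) ∈ quadricPairs b Q) {a : Fˣ}
    (ha : ∀ u, h u = a • u) {z : W} (hz : IsQuadricVector b Q z) : ∃ k : K, g z = k • z := by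
  obtain ⟨-, τ, hg, c, hc⟩ := hgh
  obtain ⟨u, hu, hQu, k, hk, rfl⟩ := hz
  refine ⟨τ k * c * algebraMap F K a * k⁻¹, ?_⟩
  simp only at hc
  rw [hg.2, hc, ha, Units.smul_def, subEmb_smul, smul_smul, smul_smul, smul_smul]
  congr 1
  field_simp

theorem scalar_of_scalar (hgh : (g, h) ∈ quadricPairs b Q)
    (hg : IsSemilinearWith (1 : K ≃+* K) g) {a : Fˣ} (ha : ∀ u, h u = a • u) :
    ∃ k : Kˣ, ∀ z, g z = k • z := by
  classical
  obtain ⟨-, -, -, c, hc⟩ := hgh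
  refine ⟨c * Units.map (algebraMap F K : F →* K) a, eq_smul_of_span (ω := b) hg rfl b.span_eq
    fun i => ?_⟩
  have := hc (Pi.single i 1)
  simp only at this
  rw [ha, Units.smul_def, subEmb_smul, subEmb_single, smul_smul] at this
  exact this

end Subgeometry

/-! ### Collineations preserving an elliptic quadric over a quadratic extension -/

section EllipticQuadric

variable {F K W : Type*} [Field F] [Field K] [Algebra F K] [AddCommGroup W] [Module K W]
  {b : Module.Basis (Fin 6) K W} {t n : F} {g : Equiv.Perm W} {h : Equiv.Perm (Fin 6 → F)}

/-- Each singular vector is an eigenvector of h. Singular lines force equal eigenvalues and a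
trivial companion automorphism, and they connect a spanning set. -/
theorem scalar_of_fixes_quadric (hgh : (g, h) ∈ quadricPairs b (ellipticForm t n))
    (hfix : ∀ z, IsQuadricVector b (ellipticForm t n) z → ∃ k : K, g z = k • z) :
    ∃ a : Fˣ, ∀ u, h u = a • u := by
  obtain ⟨⟨τ₀, c₀, hh, hQ⟩, τ, hg, c, hc⟩ := hgh
  simp only at hh hg hc
  have hsing : ∀ u, u ≠ 0 → ellipticForm t n u = 0 → ∃ a : F, h u = a • u := by
    intro u hu hQu
    obtain ⟨k, hk⟩ := hfix _ (isQuadricVector_subEmb hu hQu)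
    obtain ⟨a, -, ha⟩ := exists_of_subEmb_eq_smul (b := b) (u := h u) hu (k := (c : K)⁻¹ * k) (by
      rw [mul_smul, ← hk, hc, smul_smul, inv_mul_cancel₀ c.ne_zero, one_smul])
    exact ⟨a, ha⟩
  let e : Fin 6 → Fin 6 → F := fun i => Pi.single i 1
  obtain ⟨a, ha⟩ := hsing (e 0) (by simp [e]) (by simp [ellipticForm_apply, e])
  obtain ⟨a₂, ha₂⟩ := hsing (e 2) (by simp [e]) (by simp [ellipticForm_apply, e])
  -- The vectors e 0 + x • e 2 on one singular line detect both the equality of the eigenvalues (x =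
  -- 1) and τ₀ = 1.
  have hmix : ∀ x : F, a * x = τ₀ x * a₂ := by
    intro x
    obtain ⟨a', ha'⟩ := hsing (e 0 + x • e 2)
      (fun h0 => by simpa [e] using congrFun h0 0) (by simp [ellipticForm_apply, e])
    rw [hh.1, hh.2, ha, ha₂] at ha'
    have h0 := congrFun ha' 0
    have h2 := congrFun ha' 2
    simp [e] at h0 h2
    rw [h0, h2]
  have haa : a = a₂ := by simpa using hmix 1
  subst haa
  have ha0 : a ≠ 0 := by
    rintro rfl
    rw [zero_smul, ← hh.map_zero] at ha
    have := congrFun (h.injective ha) 0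
    simp [e] at this
  have hτ₀ : ∀ x, τ₀ x = x := fun x =>
    mul_right_cancel₀ ha0 ((hmix x).symm.trans (mul_comm _ _))
  let T : Submodule F (Fin 6 → F) :=
    { carrier := {u | h u = a • u}
      zero_mem' := by simp [hh.map_zero]
      add_mem' := by
        intro u v hu hv
        simp only [Set.mem_ofPred_eq] at hu hv ⊢
        rw [hh.1, hu, hv, smul_add]
      smul_mem' := by
        intro x u hu
        simp only [Set.mem_ofPred_eq] at hu ⊢
        rw [hh.2, hu, hτ₀, smul_comm] }
  have hT : T = ⊤ := by
    refine ellipticForm_frame_induction (t := t) (n := n) ha₂ ?_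
    intro u v hu hv huv hv0 hne hvT
    have hvT' : h v = a • v := hvT
    have hu0 : u ≠ 0 := fun h0 => hne 0 (by simp [h0])
    have huv0 : u + v ≠ 0 := fun h0 => hne (-1) (by simpa using eq_neg_of_add_eq_zero_left h0)
    obtain ⟨x, hx⟩ := hsing u hu0 hu
    obtain ⟨y, hy⟩ := hsing _ huv0 huv
    rw [hh.1, hx, hvT'] at hy
    have h1 : (x - y) • u = (y - a) • v := by
      rw [sub_smul, sub_smul, sub_eq_sub_iff_add_eq_add, hy, smul_add, add_comm]
    have hxy : x = y := by
      by_contra hne'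
      have h0 := sub_ne_zero.2 hne'
      refine hne ((x - y)⁻¹ * (y - a)) ?_
      rw [mul_smul, ← h1, smul_smul, inv_mul_cancel₀ h0, one_smul]
    rw [hxy, sub_self, zero_smul] at h1
    have h2 := (smul_eq_zero.1 h1.symm).resolve_right hv0
    change h u = a • u
    rw [hx, hxy, sub_eq_zero.1 h2]
  refine ⟨Units.mk0 a ha0, fun u => ?_⟩
  have : u ∈ T := hT ▸ trivial
  exact this

variable [Fintype F]

/-- Subtracting the conjugate relation gives a dependency of u and v with coefficients x - σ x and y
- σ y; F-independence makes both vanish. -/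
theorem exists_algebraMap_of_comb (hK : Module.finrank F K = 2) {ι : Type*} [Fintype ι]
    {b : Module.Basis ι K W} {u v w : ι → F} (hv : v ≠ 0)
    (huv : ∀ a : F, u ≠ a • v) {x y : K} (h : x • subEmb b u + y • subEmb b v = subEmb b w) :
    (∃ a, algebraMap F K a = x) ∧ ∃ a, algebraMap F K a = y := by
  have h1 : ∀ i, x * algebraMap F K (u i) + y * algebraMap F K (v i) = algebraMap F K (w i) := by
    intro i
    have := congrArg (fun z => b.repr z i) h
    simpa [repr_subEmb] using this
  have h2 : ∀ i, (x - conjHom F K x) * algebraMap F K (u i) +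
      (y - conjHom F K y) * algebraMap F K (v i) = 0 := by
    intro i
    have := congrArg (conjHom F K) (h1 i)
    simp only [map_add, map_mul, conjHom_algebraMap] at this
    linear_combination h1 i - this
  have hx : conjHom F K x = x := by
    by_contra hx
    have hx' : x - conjHom F K x ≠ 0 := fun h0 => hx (sub_eq_zero.1 h0).symm
    have h3 : subEmb b u = (-(y - conjHom F K y) / (x - conjHom F K x)) • subEmb b v := by
      apply b.repr.injective
      ext i
      simp only [map_smul, Finsupp.smul_apply, repr_subEmb, smul_eq_mul]
      field_simp
      linear_combination h2 i
    obtain ⟨a, -, ha⟩ := exists_of_subEmb_eq_smul hv h3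
    exact huv a ha
  have hy : conjHom F K y = y := by
    obtain ⟨i, hi⟩ := Function.ne_iff.1 hv
    have := h2 i
    rw [hx, sub_self, zero_mul, zero_add, mul_eq_zero] at this
    rcases this with h0 | h0
    · exact (sub_eq_zero.1 h0).symm
    · exact absurd (by simpa using h0) hi
  exact ⟨exists_algebraMap_eq_of_conjHom hK hx, exists_algebraMap_eq_of_conjHom hK hy⟩

/-- A collineation that preserves an elliptic quadric of a subgeometry comes from a semilinear
similitude of the quadratic form. -/
theorem exists_similitude_of_preserves (hK : Module.finrank F K = 2) (hδ : t ^ 2 - 4 * n ≠ 0)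
    {τ : K ≃+* K} (hg : IsSemilinearWith τ g)
    (hp : ∀ z, IsQuadricVector b (ellipticForm t n) z → IsQuadricVector b (ellipticForm t n) (g z)) :
    ∃ h, (g, h) ∈ quadricPairs b (ellipticForm t n) := by
  obtain ⟨τ₀, hτ₀⟩ := exists_ringEquiv_restricting hK τ
  have hsing : ∀ u, u ≠ 0 → ellipticForm t n u = 0 → ∃ u', u' ≠ 0 ∧ ellipticForm t n u' = 0 ∧
      ∃ c : K, c ≠ 0 ∧ g (subEmb b u) = c • subEmb b u' := fun u hu hQ =>
    hp _ (isQuadricVector_subEmb hu hQ)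
  obtain ⟨v₂, hv₂, -, c, hc, hgc⟩ := hsing (Pi.single 2 1) (by simp) (by simp [ellipticForm_apply])
  -- The scalar c is fixed at one singular vector; T collects the vectors sent into c times the
  -- subgeometry.
  let T : Submodule F (Fin 6 → F) :=
    { carrier := {u | ∃ v : Fin 6 → F, g (subEmb b u) = c • subEmb b v}
      zero_mem' := ⟨0, by simp [subEmb_zero, hg.map_zero]⟩
      add_mem' := by
        rintro u u' ⟨v, hv⟩ ⟨v', hv'⟩
        exact ⟨v + v', by rw [subEmb_add, hg.1, hv, hv', subEmb_add, smul_add]⟩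
      smul_mem' := by
        rintro a u ⟨v, hv⟩
        exact ⟨τ₀ a • v, by rw [subEmb_smul, hg.2, hv, hτ₀, subEmb_smul, smul_comm]⟩ }
  have hT : T = ⊤ := by
    refine ellipticForm_frame_induction (t := t) (n := n) ⟨v₂, hgc⟩ ?_
    rintro u v hu hv huv hv0 hne ⟨v₁, hv₁⟩
    have hu0 : u ≠ 0 := fun h0 => hne 0 (by simp [h0])
    have huv0 : u + v ≠ 0 := fun h0 => hne (-1) (by simpa using eq_neg_of_add_eq_zero_left h0)
    obtain ⟨u', hu', -, cu, hcu, hgu⟩ := hsing u hu0 hu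
    obtain ⟨w', hw', -, cw, hcw, hgw⟩ := hsing (u + v) huv0 huv
    have hv₁0 : v₁ ≠ 0 := by
      rintro rfl
      rw [subEmb_zero, smul_zero, ← hg.map_zero] at hv₁
      exact hv0 (subEmb_eq_zero.1 (g.injective hv₁))
    have hind : ∀ a : F, u' ≠ a • v₁ := by
      rintro a rfl
      have : g (subEmb b u) = g (τ.symm (cu * algebraMap F K a * c⁻¹) • subEmb b v) := by
        rw [hg.2, hgu, hv₁, subEmb_smul, smul_smul, smul_smul, RingEquiv.apply_symm_apply]
        congr 1
        field_simp
      obtain ⟨a', -, ha'⟩ := exists_of_subEmb_eq_smul hv0 (g.injective this)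
      exact hne a' ha'
    rw [subEmb_add, hg.1, hgu, hv₁] at hgw
    -- The image of u + v lies on the quadric as well, so cu/cw and c/cw are in F, hence so is cu/c:
    -- the scalar at u may be replaced by c.
    obtain ⟨⟨α, hα⟩, β, hβ⟩ := exists_algebraMap_of_comb (b := b) hK hv₁0 hind (w := w')
      (x := cu / cw) (y := c / cw) (by
        rw [div_eq_inv_mul, div_eq_inv_mul, mul_smul, mul_smul, ← smul_add, hgw, smul_smul,
          inv_mul_cancel₀ hcw, one_smul])
    refine ⟨(α / β) • u', ?_⟩
    rw [hgu, subEmb_smul, smul_smul, map_div₀, hα, hβ]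
    congr 1
    field_simp
  have hall : ∀ u, ∃ v : Fin 6 → F, g (subEmb b u) = c • subEmb b v := fun u => by
    have : u ∈ T := hT ▸ trivial
    exact this
  choose h hh using hall
  have hcan : ∀ v v' : Fin 6 → F, c • subEmb b v = c • subEmb b v' → v = v' := fun v v' h =>
    subEmb_injective (smul_right_injective W hc h)
  have hinj : Function.Injective h := fun u v huv =>
    subEmb_injective (b := b) (g.injective (by rw [hh, hh, huv]))
  have hsemi : IsSemilinearWith τ₀ (Equiv.ofBijective h ⟨hinj, Finite.surjective_of_injective hinj⟩) :=
    ⟨fun x y => hcan _ _ (by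
        change c • subEmb b (h (x + y)) = c • subEmb b (h x + h y)
        rw [← hh, subEmb_add, hg.1, hh, hh, subEmb_add, smul_add]),
      fun a x => hcan _ _ (by
        change c • subEmb b (h (a • x)) = c • subEmb b (τ₀ a • h x)
        rw [← hh, subEmb_smul, hg.2, hh, subEmb_smul, hτ₀, smul_comm])⟩
  refine ⟨_, mem_GammaO_of_singular hδ hsemi fun u hu => ?_, τ, hg, Units.mk0 c hc, hh⟩
  change ellipticForm t n (h u) = 0
  by_cases hu0 : u = 0
  · have h0 : h u = 0 := by
      rw [hu0]
      exact hsemi.map_zero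
    rw [h0, QuadraticMap.map_zero]
  · obtain ⟨u', hu', hQ, cu, hcu, hgu⟩ := hsing u hu0 hu
    rw [hh] at hgu
    obtain ⟨a, -, ha⟩ := exists_of_subEmb_eq_smul (b := b) (u := h u) hu' (k := c⁻¹ * cu) (by
      rw [mul_smul, ← hgu, smul_smul, inv_mul_cancel₀ hc, one_smul])
    rw [ha, QuadraticMap.map_smul, hQ, smul_zero]

end EllipticQuadric

/-! ### The code of the elliptic quadric -/

section QuadricCode

variable {F K V : Type*} [Field F] [Fintype F] [Field K] [Algebra F K] [AddCommGroup V] [Module K V]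
  {η : V →ₛₗ[conjHom F K] V →ₗ[K] K} {ω : pluckerImage η 2 → ⋀[K]^2 V}
  {b : Module.Basis (Fin 6) K (⋀[K]^2 V)} {t n : F}

theorem GammaO_le_GammaL {F U : Type*} [Field F] [AddCommGroup U] [Module F U]
    (Q : QuadraticForm F U) : GammaO Q ≤ GammaL F U := fun _ ⟨τ, _, h, _⟩ => ⟨τ, h⟩

theorem pluckerCode_quadric [FiniteDimensional K V] (hK : Module.finrank F K = 2) (hη : η.IsSymm)
    (hnd : NondegOn η ⊤) (h4 : 4 ≤ Module.finrank K V)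
    (hω : IsRepresentatives (pluckerImage η 2) ω) (hδ : t ^ 2 - 4 * n ≠ 0)
    (hb : ∀ z, IsIsotropicBivector η z ↔ IsQuadricVector b (ellipticForm t n) z) :
    Nonempty (PMonAut (codeOf (K := K) ω) ≃* PGO (ellipticForm t n)) ∧
    Nonempty (monomialPerm (codeOf (K := K) ω) ≃* PGammaO (ellipticForm t n)) := by
  have hσ := isUnitaryInvolution_conjHom hK
  have hω' := hω.isProjectiveSystem hη hσ hnd h4
  have : Finite K := finite_of_finrank_eq_two hK
  have : Finite (⋀[K]^2 V) := Module.finite_of_finite K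
  have : Nontrivial (⋀[K]^2 V) := ⟨b 0, 0, b.ne_zero 0⟩
  have hne : Nonempty (pluckerImage η 2) := by
    obtain ⟨P, -⟩ := hω.exists_eq_smul hη ((hb _).2 (isQuadricVector_subEmb
      (u := (Pi.single 0 1 : Fin 6 → F)) (by simp) (by simp [ellipticForm_apply])))
    exact ⟨P⟩
  have hfwd : ∀ g π d τ, IsSemilinearWith (K := K) τ g → Permutes (K := K) ω π d g →
      ∃ h, (g, h) ∈ quadricPairs b (ellipticForm t n) := by
    intro g π d τ hg hp
    refine exists_similitude_of_preserves hK hδ hg fun z hz => ?_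
    rw [← hb] at hz ⊢
    exact ((hp.preservesIsotropic hω hη hg).iff z).2 hz
  have hback : ∀ h ∈ GammaO (ellipticForm t n), ∀ τ₀ (τ : K ≃+* K), IsSemilinearWith τ₀ h →
      (∀ a, τ (algebraMap F K a) = algebraMap F K (τ₀ a)) →
      ∃ g π d, IsSemilinearWith (K := K) τ g ∧ Permutes (K := K) ω π d g ∧
        (g, h) ∈ quadricPairs b (ellipticForm t n) := by
    intro h hh τ₀ τ hτ₀ hτ
    obtain ⟨g, hg, hgh⟩ := exists_mem_quadricPairs (b := b) hh hτ₀ hτ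
    have hp : PreservesIsotropic η τ g := ⟨hg, fun z => by
      rw [hb, hb]
      exact isQuadricVector_apply_iff hgh z⟩
    obtain ⟨π, d, hp⟩ := hp.exists_permutes hω hη hω'
    exact ⟨g, π, d, hg, hp, hgh⟩
  have hscal : ∀ g h, (g, h) ∈ quadricPairs b (ellipticForm t n) →
      (∀ P, ∃ c : K, g (ω P) = c • ω P) → ∃ a : Fˣ, ∀ u, h u = a • u := by
    intro g h hgh hfix
    refine scalar_of_fixes_quadric hgh fun z hz => ?_
    obtain ⟨P, c, rfl⟩ := hω.exists_eq_smul hη ((hb z).2 hz)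
    obtain ⟨-, τ, hg, -⟩ := hgh
    obtain ⟨k, hk⟩ := hfix P
    refine ⟨τ c * k * (c⁻¹ : Kˣ), ?_⟩
    rw [Units.smul_def, hg.2, hk, smul_smul, smul_smul]
    simp
  constructor
  · refine hω'.nonempty_projGroup_mulEquiv (quadricPairs b (ellipticForm t n)) ⊥
      (inf_le_left.trans (GammaO_le_GammaL _)) (fun f => ?_) (fun g π d τ _ => hfwd g π d τ)
      (fun h hh => ?_) (fun g h τ hτ hg hgh => ?_)
      (fun g h τ hτ hg hgh => ⟨fun ⟨c, hc⟩ => hscal g h hgh fun P => ⟨c, hc _⟩, fun ⟨a, ha⟩ => ?_⟩)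
    · constructor
      · rintro ⟨hf, hlin⟩
        obtain ⟨π, d, τ, hm⟩ := hf.1
        exact ⟨hf, π, d, τ, (isMonomialWith_linear_iff hm).1 hlin, hm⟩
      · rintro ⟨hf, π, d, τ, hτ, hm⟩
        exact ⟨hf, (isMonomialWith_linear_iff hm).2 hτ⟩
    · obtain ⟨g, π, d, h'⟩ := hback h hh.1 1 1 hh.2 fun _ => rfl
      exact ⟨g, π, d, 1, rfl, h'⟩
    · obtain rfl : τ = 1 := hτ
      exact ⟨hgh.1, linear_of_mem_quadricPairs hgh hg⟩
    · obtain rfl : τ = 1 := hτ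
      exact scalar_of_scalar hgh hg ha
  · refine hω'.nonempty_monomialPerm_mulEquiv (quadricPairs b (ellipticForm t n))
      (GammaO_le_GammaL _) hfwd (fun h hh => ?_) (fun g h hgh => hgh.1)
      (fun g h τ hg hgh => ⟨hscal g h hgh, fun ⟨a, ha⟩ P =>
        exists_smul_of_scalar hgh ha ((hb _).1 (hω.isIsotropic hη P))⟩)
    obtain ⟨τ₀, c, hτ₀, -⟩ := id hh
    -- Any extension of τ₀ will do: only the permutation of ℍ counts, and it is determined on the
    -- subgeometry.
    obtain ⟨τ, hτ⟩ := exists_ringEquiv_extending hK τ₀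
    obtain ⟨g, π, d, h'⟩ := hback h hh τ₀ τ hτ₀ hτ
    exact ⟨g, π, d, τ, h'⟩

end QuadricCode

/-! ### Isotropic lines of a four-dimensional Hermitian space -/

section HypFrame

variable {K V : Type*} [Field K] [AddCommGroup V] [Module K V] {σ : K →+* K}

/-- Two orthogonal hyperbolic pairs that span `V`. -/
structure IsHypFrame (η : V →ₛₗ[σ] V →ₗ[K] K) (e₁ f₁ e₂ f₂ : V) : Prop where
  fst : IsHypPair η e₁ f₁
  snd : IsHypPair η e₂ f₂
  e₁e₂ : η e₁ e₂ = 0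
  e₁f₂ : η e₁ f₂ = 0
  f₁e₂ : η f₁ e₂ = 0
  f₁f₂ : η f₁ f₂ = 0
  e₂e₁ : η e₂ e₁ = 0
  e₂f₁ : η e₂ f₁ = 0
  f₂e₁ : η f₂ e₁ = 0
  f₂f₁ : η f₂ f₁ = 0
  expand : ∀ v, v = η f₁ v • e₁ + η f₂ v • e₂ + η e₁ v • f₁ + η e₂ v • f₂

variable {η : V →ₛₗ[σ] V →ₗ[K] K}

theorem NondegOn.exists_hypFrame [FiniteDimensional K V] (hσ : IsUnitaryInvolution σ)
    (hη : η.IsSymm) (hnd : NondegOn η ⊤) (h4 : Module.finrank K V = 4) :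
    ∃ e₁ f₁ e₂ f₂, IsHypFrame η e₁ f₁ e₂ f₂ := by
  obtain ⟨e₁, -, f₁, -, h₁⟩ := hnd.exists_pair hσ hη (by rw [finrank_top]; omega)
  obtain ⟨e₂, he₂, f₂, hf₂, h₂⟩ := (h₁.nondegOn hη (S := ⊤) trivial trivial hnd).exists_pair hσ hη
    (by
      have := finrank_le_hypPerp η ⊤ e₁ f₁
      rw [finrank_top] at this
      omega)
  obtain ⟨-, he₁e₂, hf₁e₂⟩ := mem_hypPerp.1 he₂
  obtain ⟨-, he₁f₂, hf₁f₂⟩ := mem_hypPerp.1 hf₂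
  have he₂e₁ : η e₂ e₁ = 0 := hη.eq_iff.1 he₁e₂
  have he₂f₁ : η e₂ f₁ = 0 := hη.eq_iff.1 hf₁e₂
  have hf₂e₁ : η f₂ e₁ = 0 := hη.eq_iff.1 he₁f₂
  have hf₂f₁ : η f₂ f₁ = 0 := hη.eq_iff.1 hf₁f₂
  have hli : LinearIndependent K ![e₁, e₂, f₁, f₂] := by
    rw [Fintype.linearIndependent_iff]
    intro g hg
    simp only [Fin.sum_univ_four] at hg
    have k1 := congrArg (η f₁) hg
    have k2 := congrArg (η f₂) hg
    have k3 := congrArg (η e₁) hg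
    have k4 := congrArg (η e₂) hg
    simp [h₁.fe, h₁.ff, h₁.ee, h₁.ef, h₂.fe, h₂.ff, h₂.ee, h₂.ef, he₁e₂, hf₁e₂, he₁f₂, hf₁f₂,
      he₂e₁, he₂f₁, hf₂e₁, hf₂f₁] at k1 k2 k3 k4
    intro i
    fin_cases i <;> assumption
  have hspan := hli.span_eq_top_of_card_eq_finrank (by simp [h4])
  refine ⟨e₁, f₁, e₂, f₂, h₁, h₂, he₁e₂, he₁f₂, hf₁e₂, hf₁f₂, he₂e₁, he₂f₁, hf₂e₁, hf₂f₁,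
    fun v => ?_⟩
  have hv : v ∈ Submodule.span K (Set.range ![e₁, e₂, f₁, f₂]) := hspan ▸ trivial
  obtain ⟨g, rfl⟩ := (Submodule.mem_span_range_iff_exists_fun K).1 hv
  simp [Fin.sum_univ_four, h₁.fe, h₁.ff, h₁.ee, h₁.ef, h₂.fe, h₂.ff, h₂.ee, h₂.ef, he₁e₂, hf₁e₂,
    he₁f₂, hf₁f₂, he₂e₁, he₂f₁, hf₂e₁, hf₂f₁]

/-- The vector with the given coordinates in a frame. -/
def frameVec (e₁ f₁ e₂ f₂ : V) (a₁ a₂ a₃ a₄ : K) : V :=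
  a₁ • e₁ + a₂ • e₂ + a₃ • f₁ + a₄ • f₂

/-- The bivector with the given Plücker coordinates in a frame. -/
noncomputable def frameBivec (e₁ f₁ e₂ f₂ : V) (p₀ p₁ p₂ p₃ p₄ p₅ : K) : ⋀[K]^2 V :=
  p₀ • wedge e₁ e₂ + p₁ • wedge f₁ f₂ + p₂ • wedge e₁ f₂ + p₃ • wedge e₂ f₁ + p₄ • wedge e₁ f₁ +
    p₅ • wedge e₂ f₂

theorem wedge_frameVec (e₁ f₁ e₂ f₂ : V) (a₁ a₂ a₃ a₄ c₁ c₂ c₃ c₄ : K) :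
    wedge (K := K) (frameVec e₁ f₁ e₂ f₂ a₁ a₂ a₃ a₄) (frameVec e₁ f₁ e₂ f₂ c₁ c₂ c₃ c₄) =
      frameBivec e₁ f₁ e₂ f₂ (a₁ * c₂ - a₂ * c₁) (a₃ * c₄ - a₄ * c₃) (a₁ * c₄ - a₄ * c₁)
        (a₂ * c₃ - a₃ * c₂) (a₁ * c₃ - a₃ * c₁) (a₂ * c₄ - a₄ * c₂) := by
  simp only [frameVec, frameBivec, map_add, map_smul, LinearMap.add_apply, LinearMap.smul_apply,
    wedge_self]
  rw [wedge_swap e₂ e₁, wedge_swap f₁ e₁, wedge_swap f₁ e₂, wedge_swap f₂ e₁, wedge_swap f₂ e₂,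
    wedge_swap f₂ f₁]
  module

theorem smul_frameBivec (e₁ f₁ e₂ f₂ : V) (c p₀ p₁ p₂ p₃ p₄ p₅ : K) :
    c • frameBivec e₁ f₁ e₂ f₂ p₀ p₁ p₂ p₃ p₄ p₅ =
      frameBivec e₁ f₁ e₂ f₂ (c * p₀) (c * p₁) (c * p₂) (c * p₃) (c * p₄) (c * p₅) := by
  simp only [frameBivec]
  module

variable {e₁ f₁ e₂ f₂ : V}

theorem IsHypFrame.form_frameVec (h : IsHypFrame η e₁ f₁ e₂ f₂) (a₁ a₂ a₃ a₄ c₁ c₂ c₃ c₄ : K) :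
    η (frameVec e₁ f₁ e₂ f₂ a₁ a₂ a₃ a₄) (frameVec e₁ f₁ e₂ f₂ c₁ c₂ c₃ c₄) =
      σ a₁ * c₃ + σ a₃ * c₁ + σ a₂ * c₄ + σ a₄ * c₂ := by
  simp only [frameVec, map_add, LinearMap.map_smulₛₗ, LinearMap.add_apply, LinearMap.smul_apply,
    h.fst.ee, h.fst.ef, h.fst.fe, h.fst.ff, h.snd.ee, h.snd.ef, h.snd.fe, h.snd.ff, h.e₁e₂, h.e₁f₂,
    h.f₁e₂, h.f₁f₂, h.e₂e₁, h.e₂f₁, h.f₂e₁, h.f₂f₁, smul_eq_mul, RingHom.id_apply]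
  ring

/-- Contraction with η x followed by η y, for frame vectors x and y, reads off one coordinate at a
time. -/
theorem IsHypFrame.frameBivec_eq_zero (h : IsHypFrame η e₁ f₁ e₂ f₂) {p₀ p₁ p₂ p₃ p₄ p₅ : K}
    (hp : frameBivec e₁ f₁ e₂ f₂ p₀ p₁ p₂ p₃ p₄ p₅ = 0) :
    p₀ = 0 ∧ p₁ = 0 ∧ p₂ = 0 ∧ p₃ = 0 ∧ p₄ = 0 ∧ p₅ = 0 := by
  have key : ∀ x y : V, η y (contract (η x) (frameBivec e₁ f₁ e₂ f₂ p₀ p₁ p₂ p₃ p₄ p₅)) = 0 :=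
    fun x y => by rw [hp, map_zero, map_zero]
  have k0 := key f₁ f₂
  have k1 := key e₁ e₂
  have k2 := key f₁ e₂
  have k3 := key f₂ e₁
  have k4 := key f₁ e₁
  have k5 := key f₂ e₂
  simp only [frameBivec, map_add, map_sub, map_smul, contract_wedge, h.fst.ee, h.fst.ef, h.fst.fe,
    h.fst.ff, h.snd.ee, h.snd.ef, h.snd.fe, h.snd.ff, h.e₁e₂, h.e₁f₂, h.f₁e₂, h.f₁f₂, h.e₂e₁,
    h.e₂f₁, h.f₂e₁, h.f₂f₁, smul_eq_mul, mul_zero, mul_one, sub_zero, sub_self, add_zero,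
    zero_add] at k0 k1 k2 k3 k4 k5
  exact ⟨k0, k1, k2, k3, k4, k5⟩

end HypFrame

/-! ### Reality conditions on the Plücker coordinates of isotropic lines -/

section FrameLines

variable {K V : Type*} [Field K] [AddCommGroup V] [Module K V] {σ : K →+* K}
  {η : V →ₛₗ[σ] V →ₗ[K] K} {e₁ f₁ e₂ f₂ : V}

/-- `z` is a multiple of a bivector on the quadric whose Plücker coordinates satisfy the reality
conditions imposed by a Hermitian form. -/
def IsRealBivec (σ : K →+* K) (e₁ f₁ e₂ f₂ : V) (z : ⋀[K]^2 V) : Prop :=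
  ∃ c q₀ q₁ q₂ q₃ y : K, c ≠ 0 ∧ σ q₀ = q₀ ∧ σ q₁ = q₁ ∧ σ q₂ = -q₂ ∧ σ q₃ = -q₃ ∧
    q₀ * q₁ + q₂ * q₃ = y * σ y ∧ z = c • frameBivec e₁ f₁ e₂ f₂ q₀ q₁ q₂ q₃ y (σ y)

theorem IsRealBivec.smul {z : ⋀[K]^2 V} (hz : IsRealBivec σ e₁ f₁ e₂ f₂ z) {k : K} (hk : k ≠ 0) :
    IsRealBivec σ e₁ f₁ e₂ f₂ (k • z) := by
  obtain ⟨c, q₀, q₁, q₂, q₃, y, hc, h0, h1, h2, h3, hq, rfl⟩ := hz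
  exact ⟨k * c, q₀, q₁, q₂, q₃, y, mul_ne_zero hk hc, h0, h1, h2, h3, hq, by rw [mul_smul]⟩

theorem IsHypFrame.isIsotropicBivector_of_smul (h : IsHypFrame η e₁ f₁ e₂ f₂) {z : ⋀[K]^2 V}
    (hz : z ≠ 0) {k : K} (hk : k ≠ 0) {a₁ a₂ a₃ a₄ c₁ c₂ c₃ c₄ : K}
    (haa : σ a₁ * a₃ + σ a₃ * a₁ + σ a₂ * a₄ + σ a₄ * a₂ = 0)
    (hcc : σ c₁ * c₃ + σ c₃ * c₁ + σ c₂ * c₄ + σ c₄ * c₂ = 0)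
    (hac : σ a₁ * c₃ + σ a₃ * c₁ + σ a₂ * c₄ + σ a₄ * c₂ = 0)
    (heq : k • z = wedge (frameVec e₁ f₁ e₂ f₂ a₁ a₂ a₃ a₄) (frameVec e₁ f₁ e₂ f₂ c₁ c₂ c₃ c₄)) :
    IsIsotropicBivector η z := by
  have h1 : IsIsotropicBivector η (k • z) := by
    refine ⟨_, _, wedge_ne_zero_iff.1 ?_, ?_, ?_, ?_, heq⟩
    · rw [← heq]
      exact smul_ne_zero hk hz
    · rw [h.form_frameVec, haa]
    · rw [h.form_frameVec, hcc]
    · rw [h.form_frameVec, hac]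
  have h2 := h1.smul (inv_ne_zero hk)
  rwa [smul_smul, inv_mul_cancel₀ hk, one_smul] at h2

/-- The Plücker relation lets two spanning vectors be written down from the coordinates once one of
q₀, q₂ is nonzero. If both vanish then y = 0, and the bivector is f₁ ∧ (q₁ f₂ - q₃ e₂). -/
theorem IsRealBivec.isIsotropicBivector (hσ : IsUnitaryInvolution σ)
    (h : IsHypFrame η e₁ f₁ e₂ f₂) {z : ⋀[K]^2 V} (hz : IsRealBivec σ e₁ f₁ e₂ f₂ z)
    (hz0 : z ≠ 0) : IsIsotropicBivector η z := by
  obtain ⟨c, q₀, q₁, q₂, q₃, y, hc, h0, h1, h2, h3, hq, rfl⟩ := hz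
  refine IsIsotropicBivector.smul ?_ hc
  replace hz0 := (smul_ne_zero_iff.1 hz0).2
  have hyy := hσ.invol y
  by_cases hq0 : q₀ = 0
  · by_cases hq2 : q₂ = 0
    · subst hq0 hq2
      have hy : y = 0 := by simpa using hq.symm
      subst hy
      refine h.isIsotropicBivector_of_smul hz0 one_ne_zero (a₁ := 0) (a₂ := 0) (a₃ := 1) (a₄ := 0)
        (c₁ := 0) (c₂ := -q₃) (c₃ := 0) (c₄ := q₁) (by simp) ?_ (by simp) ?_
      · simp only [map_neg, h3, h1, map_zero]
        ring
      · rw [wedge_frameVec, one_smul]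
        congr 1 <;> simp
    · subst hq0
      refine h.isIsotropicBivector_of_smul hz0 hq2 (a₁ := q₂) (a₂ := σ y) (a₃ := q₁) (a₄ := 0)
        (c₁ := 0) (c₂ := 0) (c₃ := y) (c₄ := q₂) ?_ (by simp) ?_ ?_
      · simp only [h2, h1, map_zero]
        ring
      · simp only [h2, hyy, map_zero]
        ring
      · rw [wedge_frameVec, smul_frameBivec]
        congr 1 <;> first | ring1 | linear_combination hq
  · refine h.isIsotropicBivector_of_smul hz0 hq0 (a₁ := q₀) (a₂ := 0) (a₃ := -q₃) (a₄ := -σ y)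
      (c₁ := 0) (c₂ := q₀) (c₃ := y) (c₄ := q₂) ?_ ?_ ?_ ?_
    · simp only [h0, h3, map_neg, map_zero]
      ring
    · simp only [h0, h2, map_zero]
      ring
    · simp only [h0, hyy, map_neg, map_zero]
      ring
    · rw [wedge_frameVec, smul_frameBivec]
      congr 1 <;> first | ring1 | linear_combination hq

/-- The line misses ⟨f₁, f₂⟩ and is in echelon form; isotropy says that a₃ and c₄ are skew and c₃ =
-σ(a₄), which are the reality conditions with q₀ = 1. -/
theorem isRealBivec_of_frameVec (hσ : IsUnitaryInvolution σ) {a₃ a₄ c₃ c₄ : K}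
    (haa : a₃ + σ a₃ = 0) (hcc : c₄ + σ c₄ = 0) (hac : c₃ + σ a₄ = 0) :
    IsRealBivec σ e₁ f₁ e₂ f₂
      (wedge (frameVec e₁ f₁ e₂ f₂ 1 0 a₃ a₄) (frameVec e₁ f₁ e₂ f₂ 0 1 c₃ c₄)) := by
  have h1 : σ a₃ = -a₃ := eq_neg_of_add_eq_zero_right haa
  have h2 : σ c₄ = -c₄ := eq_neg_of_add_eq_zero_right hcc
  have h3 : σ a₄ = -c₃ := eq_neg_of_add_eq_zero_right hac
  have h4 : σ c₃ = -a₄ := by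
    have := congrArg σ h3
    rw [hσ.invol, map_neg] at this
    rw [this, neg_neg]
  refine ⟨1, 1, a₃ * c₄ - a₄ * c₃, c₄, -a₃, c₃, one_ne_zero, map_one _, ?_, h2, ?_, ?_, ?_⟩
  · rw [map_sub, map_mul, map_mul, h1, h2, h3, h4]
    ring
  · rw [map_neg, h1]
  · rw [h4]
    ring
  · rw [wedge_frameVec, one_smul, h4]
    congr 1 <;> ring

theorem isRealBivec_of_frameVec' {D : K} (hσ : IsUnitaryInvolution σ) (hD0 : D ≠ 0)
    (hD : σ D = -D) {a₁ a₂ a₃ a₄ c₃ c₄ : K} (ha : ¬(a₁ = 0 ∧ a₂ = 0))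
    (haa : σ a₁ * a₃ + σ a₃ * a₁ + σ a₂ * a₄ + σ a₄ * a₂ = 0)
    (hac : σ a₁ * c₃ + σ a₂ * c₄ = 0) (hc : ¬(c₃ = 0 ∧ c₄ = 0)) :
    IsRealBivec σ e₁ f₁ e₂ f₂
      (wedge (frameVec e₁ f₁ e₂ f₂ a₁ a₂ a₃ a₄) (frameVec e₁ f₁ e₂ f₂ 0 0 c₃ c₄)) := by
  -- Orthogonality determines (c₃, c₄) up to a factor. The coordinates then have the wrong symmetry
  -- under σ, which the skew factor D corrects.
  obtain ⟨k, rfl, rfl⟩ : ∃ k, c₃ = k * σ a₂ ∧ c₄ = k * -σ a₁ := by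
    by_cases h1 : a₁ = 0
    · have h2 : σ a₂ ≠ 0 := (map_ne_zero σ).2 fun h2 => ha ⟨h1, h2⟩
      refine ⟨c₃ / σ a₂, by field_simp, ?_⟩
      rw [h1, map_zero, zero_mul, zero_add, mul_eq_zero] at hac
      rw [h1, hac.resolve_left h2]
      simp
    · have h1' : σ a₁ ≠ 0 := (map_ne_zero σ).2 h1
      refine ⟨-c₄ / σ a₁, ?_, by field_simp⟩
      field_simp
      linear_combination hac
  have hk : k ≠ 0 := by
    rintro rfl
    exact hc ⟨by simp, by simp⟩
  refine ⟨k / D, 0, -D * (a₃ * σ a₁ + a₄ * σ a₂), -D * (a₁ * σ a₁), D * (a₂ * σ a₂),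
    D * (a₁ * σ a₂), div_ne_zero hk hD0, map_zero _, ?_, ?_, ?_, ?_, ?_⟩
  · simp only [map_mul, map_neg, map_add, hD, hσ.invol]
    linear_combination D * haa
  · simp only [map_mul, map_neg, hD, hσ.invol]
    ring
  · simp only [map_mul, hD, hσ.invol]
    ring
  · simp only [map_mul, hD, hσ.invol]
    ring
  · rw [wedge_frameVec, smul_frameBivec]
    simp only [map_mul, hD, hσ.invol]
    congr 1 <;> field_simp <;> ring

theorem IsHypFrame.eq_frameVec (h : IsHypFrame η e₁ f₁ e₂ f₂) (v : V) :
    v = frameVec e₁ f₁ e₂ f₂ (η f₁ v) (η f₂ v) (η e₁ v) (η e₂ v) := h.expand v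

/-- Here w lies in ⟨f₁, f₂⟩: the line either equals that plane or meets it in the point of w. -/
theorem IsHypFrame.isRealBivec_of_zero {D : K} (hσ : IsUnitaryInvolution σ) (hD0 : D ≠ 0)
    (hD : σ D = -D) (h : IsHypFrame η e₁ f₁ e₂ f₂) {v w : V} (hvv : η v v = 0) (hvw : η v w = 0)
    (hw₁ : η f₁ w = 0) (hw₂ : η f₂ w = 0) (hz : wedge (K := K) v w ≠ 0) :
    IsRealBivec σ e₁ f₁ e₂ f₂ (wedge v w) := by
  rw [h.eq_frameVec v, h.eq_frameVec w] at hz hvw ⊢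
  rw [h.eq_frameVec v] at hvv
  rw [hw₁, hw₂] at hz hvw ⊢
  rw [h.form_frameVec] at hvv hvw
  generalize η f₁ v = a₁ at *
  generalize η f₂ v = a₂ at *
  generalize η e₁ v = a₃ at *
  generalize η e₂ v = a₄ at *
  generalize η e₁ w = c₃ at *
  generalize η e₂ w = c₄ at *
  by_cases ha : a₁ = 0 ∧ a₂ = 0
  · obtain ⟨rfl, rfl⟩ := ha
    rw [wedge_frameVec] at hz ⊢
    refine ⟨a₃ * c₄ - a₄ * c₃, 0, 1, 0, 0, 0, ?_, by simp, by simp, by simp, by simp, by simp, ?_⟩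
    · intro h0
      apply hz
      rw [h0]
      simp [frameBivec]
    · rw [smul_frameBivec]
      congr 1 <;> simp
  · refine isRealBivec_of_frameVec' hσ hD0 hD ha hvv (by simpa using hvw) ?_
    rintro ⟨rfl, rfl⟩
    apply hz
    simp [frameVec]

theorem IsHypFrame.isRealBivec (hσ : IsUnitaryInvolution σ) (hη : η.IsSymm)
    (h : IsHypFrame η e₁ f₁ e₂ f₂) {z : ⋀[K]^2 V} (hz : IsIsotropicBivector η z) :
    IsRealBivec σ e₁ f₁ e₂ f₂ z := by
  obtain ⟨D, hD0, hD⟩ := hσ.exists_skew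
  have hz0 := hz.ne_zero
  obtain ⟨x, y, -, hxx, hyy, hxy, rfl⟩ := hz
  have hyx : η y x = 0 := hη.eq_iff.1 hxy
  -- The Plücker coordinate at e₁ ∧ e₂ vanishes exactly when the line meets ⟨f₁, f₂⟩; otherwise x',
  -- y' below are its echelon basis.
  by_cases hp : η f₁ x * η f₂ y - η f₂ x * η f₁ y = 0
  · by_cases hx : η f₁ x = 0 ∧ η f₂ x = 0
    · rw [wedge_swap, ← neg_one_smul K] at hz0 ⊢
      exact (h.isRealBivec_of_zero hσ hD0 hD hyy hyx hx.1 hx.2 (smul_ne_zero_iff.1 hz0).2).smul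
        (neg_ne_zero.2 one_ne_zero)
    · obtain ⟨k, hk1, hk2⟩ : ∃ k, η f₁ y = k * η f₁ x ∧ η f₂ y = k * η f₂ x := by
        by_cases h1 : η f₁ x = 0
        · have h2 : η f₂ x ≠ 0 := fun h2 => hx ⟨h1, h2⟩
          refine ⟨η f₂ y / η f₂ x, ?_, by field_simp⟩
          rw [h1, zero_mul, zero_sub, neg_eq_zero, mul_eq_zero] at hp
          rw [h1, mul_zero, hp.resolve_left h2]
        · refine ⟨η f₁ y / η f₁ x, by field_simp, ?_⟩
          field_simp
          linear_combination hp
      have hw : wedge (K := K) x y = wedge x (y - k • x) := by simp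
      rw [hw] at hz0 ⊢
      exact h.isRealBivec_of_zero hσ hD0 hD hxx (by simp [hxx, hxy]) (by simp [hk1]) (by simp [hk2]) hz0
  · set p := η f₁ x * η f₂ y - η f₂ x * η f₁ y with hpdef
    obtain ⟨x', hx'⟩ : ∃ x', x' = p⁻¹ • (η f₂ y • x - η f₂ x • y) := ⟨_, rfl⟩
    obtain ⟨y', hy'⟩ : ∃ y', y' = p⁻¹ • (η f₁ x • y - η f₁ y • x) := ⟨_, rfl⟩
    have h1 : η f₁ x' = 1 := by
      simp only [hx', map_smul, map_sub, smul_eq_mul]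
      field_simp
      rw [hpdef]
      ring
    have h2 : η f₂ x' = 0 := by
      simp only [hx', map_smul, map_sub, smul_eq_mul]
      ring
    have h3 : η f₁ y' = 0 := by
      simp only [hy', map_smul, map_sub, smul_eq_mul]
      ring
    have h4 : η f₂ y' = 1 := by
      simp only [hy', map_smul, map_sub, smul_eq_mul]
      field_simp
      rw [hpdef]
      ring
    have hxx' : η x' x' = 0 := by simp [hx', hxx, hxy, hyx, hyy]
    have hyy' : η y' y' = 0 := by simp [hy', hxx, hxy, hyx, hyy]
    have hxy' : η x' y' = 0 := by simp [hx', hy', hxx, hxy, hyx, hyy]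
    have hw : wedge (K := K) x y = p • wedge x' y' := by
      have : wedge (K := K) x' y' = (p⁻¹ * p⁻¹ * p) • wedge x y := by
        rw [hx', hy', hpdef]
        simp only [map_smul, map_sub, LinearMap.smul_apply, LinearMap.sub_apply, wedge_self]
        rw [wedge_swap y x]
        module
      rw [this, smul_smul]
      field_simp
      rw [one_smul]
    rw [hw]
    refine IsRealBivec.smul ?_ hp
    rw [h.eq_frameVec x', h1, h2] at hxx' hxy' ⊢
    rw [h.eq_frameVec y', h3, h4] at hyy' hxy' ⊢
    rw [h.form_frameVec] at hxx' hyy' hxy'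
    exact isRealBivec_of_frameVec hσ (by simpa using hxx') (by simpa using hyy')
      (by simpa using hxy')

end FrameLines

/-! ### The elliptic quadric of isotropic lines for m = 4 -/

section QuadricModel

variable {F K V : Type*} [Field F] [Fintype F] [Field K] [Algebra F K] [AddCommGroup V] [Module K V]
  {η : V →ₛₗ[conjHom F K] V →ₗ[K] K}

/-- Trace and norm of a generator of a quadratic extension. -/
theorem exists_generator (hK : Module.finrank F K = 2) : ∃ (z : K) (t n : F),
    conjHom F K z ≠ z ∧ algebraMap F K t = z + conjHom F K z ∧
      algebraMap F K n = z * conjHom F K z := by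
  have hσ := isUnitaryInvolution_conjHom (F := F) hK
  obtain ⟨z, hz⟩ := hσ.exists_ne
  obtain ⟨t, ht⟩ := exists_algebraMap_eq_of_conjHom (F := F) hK (x := z + conjHom F K z)
    (by rw [map_add, hσ.invol, add_comm])
  obtain ⟨n, hn⟩ := exists_algebraMap_eq_of_conjHom (F := F) hK (x := z * conjHom F K z)
    (by rw [map_mul, hσ.invol, mul_comm])
  exact ⟨z, t, n, hz, ht, hn⟩

/-- For `m = 4` the isotropic bivectors are those on an elliptic quadric of a subgeometry. -/
theorem exists_quadric_model [FiniteDimensional K V] (hK : Module.finrank F K = 2) (hη : η.IsSymm)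
    (hnd : NondegOn η ⊤) (h4 : Module.finrank K V = 4) :
    ∃ t n : F, t ^ 2 - 4 * n ≠ 0 ∧ IsAnisotropicPair t n ∧
      ∃ b : Module.Basis (Fin 6) K (⋀[K]^2 V),
        ∀ w, IsIsotropicBivector η w ↔ IsQuadricVector b (ellipticForm t n) w := by
  have hσ := isUnitaryInvolution_conjHom (F := F) hK
  have hinj := (algebraMap F K).injective
  obtain ⟨z, t, n, hz, ht, hn⟩ := exists_generator (F := F) hK
  obtain ⟨e₁, f₁, e₂, f₂, hfr⟩ := hnd.exists_hypFrame hσ hη h4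
  -- D is skew with square t² - 4n, so dividing by D turns skew coordinates into elements of F.
  obtain ⟨D, hD⟩ : ∃ D, D = z - conjHom F K z := ⟨_, rfl⟩
  have hD0 : D ≠ 0 := hD ▸ sub_ne_zero.2 (Ne.symm hz)
  have hσD : conjHom F K D = -D := by rw [hD, map_sub, hσ.invol, neg_sub]
  have hdisc : algebraMap F K (t ^ 2 - 4 * n) = D ^ 2 := by
    rw [map_sub, map_pow, map_mul, ht, hn, hD, map_ofNat]
    ring
  have hσy : ∀ a b : F, conjHom F K (algebraMap F K a + algebraMap F K b * z) =
      algebraMap F K a + algebraMap F K b * conjHom F K z := fun a b => by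
    rw [map_add, map_mul, conjHom_algebraMap, conjHom_algebraMap]
  have hnorm : ∀ a b : F, algebraMap F K (a ^ 2 + t * (a * b) + n * b ^ 2) =
      (algebraMap F K a + algebraMap F K b * z) *
        conjHom F K (algebraMap F K a + algebraMap F K b * z) := fun a b => by
    rw [hσy]
    simp only [map_add, map_mul, map_pow, ht, hn]
    ring
  have hcoord : ∀ y : K, ∃ a b : F, y = algebraMap F K a + algebraMap F K b * z := by
    intro y
    obtain ⟨b, hb⟩ := exists_algebraMap_eq_of_conjHom (F := F) hK (x := (y - conjHom F K y) / D)
      (by rw [map_div₀, map_sub, hσ.invol, hσD, div_neg, ← neg_div, neg_sub])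
    have hb' : algebraMap F K b * D = y - conjHom F K y := by
      rw [hb, div_mul_cancel₀ _ hD0]
    obtain ⟨a, ha⟩ := exists_algebraMap_eq_of_conjHom (F := F) hK (x := y - algebraMap F K b * z)
      (by
        rw [map_sub, map_mul, conjHom_algebraMap]
        rw [hD] at hb'
        linear_combination hb')
    exact ⟨a, b, by rw [ha]; ring⟩
  have hzero : ∀ a b : F, algebraMap F K a + algebraMap F K b * z = 0 → a = 0 ∧ b = 0 := by
    intro a b hab
    have h1 := hσy a b
    rw [hab, map_zero] at h1
    have h2 : algebraMap F K b * D = 0 := by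
      rw [hD]
      linear_combination hab + h1
    have hb : algebraMap F K b = 0 := (mul_eq_zero.1 h2).resolve_right hD0
    rw [hb, zero_mul, add_zero] at hab
    exact ⟨hinj (by rw [hab, map_zero]), hinj (by rw [hb, map_zero])⟩
  -- The F-span consists of the bivectors satisfying the reality conditions. The last two vectors
  -- give the conjugate coordinates y = u₄ + u₅ z and σ(y).
  let v : Fin 6 → ⋀[K]^2 V := ![wedge e₁ e₂, wedge f₁ f₂, D • wedge e₁ f₂, D • wedge e₂ f₁,
    wedge e₁ f₁ + wedge e₂ f₂, z • wedge e₁ f₁ + conjHom F K z • wedge e₂ f₂]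
  have hv : ∀ g : Fin 6 → K, ∑ i, g i • v i = frameBivec e₁ f₁ e₂ f₂ (g 0) (g 1) (D * g 2) (D * g 3)
      (g 4 + g 5 * z) (g 4 + g 5 * conjHom F K z) := by
    intro g
    rw [Fin.sum_univ_six]
    change g 0 • wedge e₁ e₂ + g 1 • wedge f₁ f₂ + g 2 • D • wedge e₁ f₂ + g 3 • D • wedge e₂ f₁ +
      g 4 • (wedge e₁ f₁ + wedge e₂ f₂) +
      g 5 • (z • wedge e₁ f₁ + conjHom F K z • wedge e₂ f₂) = _
    rw [frameBivec]
    module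
  have hli : LinearIndependent K v := by
    rw [Fintype.linearIndependent_iff]
    intro g hg
    rw [hv] at hg
    obtain ⟨h0, h1, h2, h3, h4, h5⟩ := hfr.frameBivec_eq_zero hg
    have h5' : g 5 * D = 0 := by
      rw [hD]
      linear_combination h4 - h5
    have h5'' := (mul_eq_zero.1 h5').resolve_right hD0
    rw [h5'', zero_mul, add_zero] at h4
    have h2' := (mul_eq_zero.1 h2).resolve_left hD0
    have h3' := (mul_eq_zero.1 h3).resolve_left hD0
    intro i
    fin_cases i <;> assumption
  have hrank : Fintype.card (Fin 6) = Module.finrank K (⋀[K]^2 V) := by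
    rw [exteriorPower.finrank_eq, h4]
    rfl
  let b : Module.Basis (Fin 6) K (⋀[K]^2 V) := basisOfLinearIndependentOfCardEqFinrank hli hrank
  have hb : ∀ u : Fin 6 → F, subEmb b u = frameBivec e₁ f₁ e₂ f₂ (algebraMap F K (u 0))
      (algebraMap F K (u 1)) (D * algebraMap F K (u 2)) (D * algebraMap F K (u 3))
      (algebraMap F K (u 4) + algebraMap F K (u 5) * z)
      (conjHom F K (algebraMap F K (u 4) + algebraMap F K (u 5) * z)) := by
    intro u
    rw [hσy, ← hv fun i => algebraMap F K (u i), subEmb]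
    simp only [b, coe_basisOfLinearIndependentOfCardEqFinrank]
  have hQ : ∀ u : Fin 6 → F, algebraMap F K (ellipticForm t n u) =
      algebraMap F K (u 0) * algebraMap F K (u 1) +
        D * algebraMap F K (u 2) * (D * algebraMap F K (u 3)) -
        (algebraMap F K (u 4) + algebraMap F K (u 5) * z) *
          conjHom F K (algebraMap F K (u 4) + algebraMap F K (u 5) * z) := by
    intro u
    rw [ellipticForm_apply, map_sub, hnorm, map_add, map_mul, map_mul, hdisc, map_mul]
    ring
  refine ⟨t, n, fun h0 => ?_, fun a b' hab => ?_, b, fun w => ⟨fun hw => ?_, fun hw => ?_⟩⟩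
  · rw [h0, map_zero] at hdisc
    exact pow_ne_zero 2 hD0 hdisc.symm
  · have h1 := hnorm a b'
    rw [hab, map_zero, eq_comm, mul_eq_zero, map_eq_zero, or_self] at h1
    exact hzero a b' h1
  · have hw0 := hw.ne_zero
    obtain ⟨c, q₀, q₁, q₂, q₃, y, hc, h0, h1, h2, h3, hq, rfl⟩ := hfr.isRealBivec hσ hη hw
    obtain ⟨u₀, rfl⟩ := exists_algebraMap_eq_of_conjHom hK h0
    obtain ⟨u₁, rfl⟩ := exists_algebraMap_eq_of_conjHom hK h1
    obtain ⟨u₂, hu₂⟩ := exists_algebraMap_eq_of_conjHom (F := F) hK (x := q₂ / D)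
      (by rw [map_div₀, h2, hσD, neg_div_neg_eq])
    obtain ⟨u₃, hu₃⟩ := exists_algebraMap_eq_of_conjHom (F := F) hK (x := q₃ / D)
      (by rw [map_div₀, h3, hσD, neg_div_neg_eq])
    obtain rfl : q₂ = D * algebraMap F K u₂ := by rw [hu₂]; field_simp
    obtain rfl : q₃ = D * algebraMap F K u₃ := by rw [hu₃]; field_simp
    obtain ⟨u₄, u₅, rfl⟩ := hcoord y
    have hu := hb ![u₀, u₁, u₂, u₃, u₄, u₅]
    refine ⟨![u₀, u₁, u₂, u₃, u₄, u₅], ?_, hinj ?_, c, hc, by rw [hu]; rfl⟩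
    · intro h
      refine hw0 (smul_eq_zero_of_right c ?_)
      exact hu.symm.trans (subEmb_eq_zero.2 h)
    · rw [hQ, map_zero]
      exact sub_eq_zero.2 hq
  · obtain ⟨u, hu, hQu, c, hc, rfl⟩ := hw
    have hne : subEmb b u ≠ 0 := fun h0 => hu (subEmb_eq_zero.1 h0)
    refine IsRealBivec.isIsotropicBivector hσ hfr ?_ (smul_ne_zero hc hne)
    have h1 := hQ u
    rw [hQu, map_zero] at h1
    exact ⟨c, _, _, _, _, _, hc, conjHom_algebraMap _, conjHom_algebraMap _,
      by rw [map_mul, hσD, conjHom_algebraMap, neg_mul],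
      by rw [map_mul, hσD, conjHom_algebraMap, neg_mul], (sub_eq_zero.1 h1.symm), by rw [hb]⟩

theorem mem_pluckerImage_iff_exists {b : Module.Basis (Fin 6) K (⋀[K]^2 V)}
    {Q : QuadraticForm F (Fin 6 → F)} (hη : η.IsSymm)
    (hb : ∀ w, IsIsotropicBivector η w ↔ IsQuadricVector b Q w) (P : ℙ K (⋀[K]^2 V)) :
    P ∈ pluckerImage η 2 ↔ ∃ u : Fin 6 → F, u ≠ 0 ∧ Q u = 0 ∧
      P.submodule = Submodule.span K {∑ i, algebraMap F K (u i) • b i} := by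
  induction P using Projectivization.ind with
  | h w hw =>
    rw [mk_mem_pluckerImage_iff hη hw, hb, Projectivization.submodule_mk]
    constructor
    · rintro ⟨u, hu, hQ, c, hc, rfl⟩
      exact ⟨u, hu, hQ, Submodule.span_singleton_smul_eq hc.isUnit _⟩
    · rintro ⟨u, hu, hQ, hs⟩
      obtain ⟨c, hc⟩ := Submodule.mem_span_singleton.1 (hs ▸ Submodule.mem_span_singleton_self w)
      refine ⟨u, hu, hQ, c, ?_, hc.symm⟩
      rintro rfl
      exact hw (by rw [← hc, zero_smul])

end QuadricModel

/-! ### The main theorem -/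

theorem mainTheorem6 {F K V : Type*} [Field F] [Fintype F] [Field K] [Algebra F K]
    [AddCommGroup V] [Module K V] (hK : Module.finrank F K = 2)
    (m : ℕ) (hm : Module.finrank K V = m)
    (η : V →ₛₗ[conjHom F K] V →ₗ[K] K) (hη : η.IsSymm) (hη' : η.Nondegenerate)
    (ω : pluckerImage η 2 → ⋀[K]^2 V) (hω : IsRepresentatives (pluckerImage η 2) ω) :
    (5 < m →
      Nonempty (PGammaMonAut (codeOf (K := K) ω) ≃* PGammaU η) ∧
      Nonempty (monomialPerm (codeOf (K := K) ω) ≃* PGammaU η)) ∧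
    (m = 4 →
      ∃ Q : QuadraticForm F (Fin 6 → F), IsElliptic Q ∧
        (∃ b : Module.Basis (Fin 6) K (⋀[K]^2 V), ∀ P : Projectivization K (⋀[K]^2 V),
          P ∈ pluckerImage η 2 ↔
            ∃ u : Fin 6 → F, u ≠ 0 ∧ Q u = 0 ∧
              P.submodule = Submodule.span K {∑ i, algebraMap F K (u i) • b i}) ∧
        Nonempty (PMonAut (codeOf (K := K) ω) ≃* PGO Q) ∧
        Nonempty (monomialPerm (codeOf (K := K) ω) ≃* PGammaO Q)) := by
  have hσ := isUnitaryInvolution_conjHom (F := F) hK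
  have hnd : NondegOn η ⊤ := fun x _ hx => hη'.1 x fun y => hx y trivial
  have : Finite K := finite_of_finrank_eq_two hK
  constructor
  · intro h5
    have : FiniteDimensional K V := FiniteDimensional.of_finrank_pos (by omega)
    exact pluckerCode_large hη hσ (fun τ x => ringEquiv_conjHom τ x) hnd (by omega) hω
  · rintro rfl
    have : FiniteDimensional K V := FiniteDimensional.of_finrank_pos (by omega)
    obtain ⟨t, n, hδ, han, b, hb⟩ := exists_quadric_model hK hη hnd hm
    exact ⟨ellipticForm t n, ellipticForm_isElliptic hδ han,
      ⟨b, mem_pluckerImage_iff_exists hη hb⟩,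
      pluckerCode_quadric hK hη hnd (by omega) hω hδ hb⟩
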